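/- Let $A$ be a complete discrete valuation ring with maximal ideal $\mathfrak m$ and field of fractions $Q=Q(A)$. For an $A$-module $M$ let $E(M)$ denote its injective envelope, let $E=E\big(\bigoplus_{\mathfrak n}A/\mathfrak n\big)$, where $\mathfrak n$ runs through the maximal ideals of $A$ (so $E\cong E(A/\mathfrak m)$), and put $M^\vee=\operatorname{Hom}_A(M,E)$. The module $M$ is called Matlis reflexive if the evaluation map $M\to (M^\vee)^\vee$ is bijective. Let $\operatorname{refl}A$, $\operatorname{noeth}A$, $\operatorname{art}A$ and $\operatorname{fl}A$ be the categories of Matlis reflexive, noetherian, artinian and finite length $A$-modules, and let $\operatorname{arno}A$ be the category of $A$-modules $M$ having a noetherian submodule $U$ such that $M/U$ is artinian. For a ring $S$ let $\operatorname{mod}S$ be the category of finitely presented left $S$-modules. For $\mathcal C\in\{\operatorname{refl}A,\operatorname{noeth}A,\operatorname{art}A\}$, the quotient category $\mathcal C/\operatorname{fl}A$ is the localization of $\mathcal C$ at the homomorphisms with kernel and cokernel of finite length. Then the following hold. 1. An indecomposable $A$-module is Matlis reflexive if and only if it is pure-injective. 2. The modules $$A=\varprojlim A/\mathfrak m^i,\qquad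 E(A/\mathfrak m)\cong\varinjlim A/\mathfrak m^i,\qquad Q,\qquad A/\mathfrak m^i\ \ (i\ge 1)$$ are indecomposable and Matlis reflexive, and every indecomposable Matlis reflexive $A$-module is isomorphic to exactly one of them. Here, the colimit is taken along the maps $A/\mathfrak m^i\to A/\mathfrak m^j$ ($i\le j$) given by multiplication with $\pi^{j-i}$, for any uniformizer $\pi$ of $A$. 3. $\operatorname{refl}A=\operatorname{arno}A$, and this is an abelian category with enough projective and enough injective objects. The module $Q$ is, up to isomorphism, its unique indecomposable object that is both projective and injective. 4. Let $\bar A=\begin{pmatrix}A&Q\\0&Q\end{pmatrix}$, which acts from the right on $A\oplus Q$, viewed as row vectors. Then the functor $\operatorname{Hom}_A(A\oplus Q,-)$ induces an equivalence $\operatorname{refl}A\xrightarrow{\sim}\operatorname{mod}\bar A$. 5. There are equivalences of categories $$\frac{\operatorname{refl}A}{\operatorname{fl}A}\simeq\operatorname{mod}T_2(Q),\qquad \frac{\operatorname{noeth}A}{\operatorname{fl}A}\simeq\operatorname{mod}Q\simeq\frac{\operatorname{art}A}{\operatorname{fl}A},\qquad\text{where } T_2(Q)=\begin{pmatrix}Q&Q\\0&Q\end{pmatrix}.$$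 -/

import Mathlib

open CategoryTheory

universe u

/-! ### Injective envelopes -/

/-- `i : M → E` is an injective envelope: `E` is injective and `i` is an essential embedding. -/
structure IsInjectiveEnvelope {R : Type u} [CommRing R] {M E : Type u} [AddCommGroup M]
    [Module R M] [AddCommGroup E] [Module R E] (i : M →ₗ[R] E) : Prop where
  injective_module : Module.Injective R E
  injective_map : Function.Injective i
  essential : ∀ K : Submodule R E, Disjoint K (LinearMap.range i) → K = ⊥

theorem exists_maximal_essential {R : Type u} [CommRing R] {J : Type u} [AddCommGroup J]
    [Module R J] (S : Submodule R J) :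
    ∃ N : Submodule R J, Maximal (fun N => S ≤ N ∧
      ∀ K : Submodule R J, K ≤ N → Disjoint K S → K = ⊥) N := by
  have hz := zorn_le_nonempty₀ {N : Submodule R J | S ≤ N ∧
      ∀ K : Submodule R J, K ≤ N → Disjoint K S → K = ⊥} (fun c hc hchain y hy => by
    refine ⟨sSup c, ⟨(hc hy).1.trans (le_sSup hy), fun K hK hd => ?_⟩, fun z hz => le_sSup hz⟩
    refine (Submodule.eq_bot_iff K).2 fun x hx => ?_
    obtain ⟨N, hN, hxN⟩ := (Submodule.mem_sSup_of_directed ⟨y, hy⟩ hchain.directedOn).1 (hK hx)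
    have h1 : Submodule.span R {x} = ⊥ := (hc hN).2 _
      ((Submodule.span_singleton_le_iff_mem _ _).2 hxN)
      (hd.mono_left ((Submodule.span_singleton_le_iff_mem _ _).2 hx))
    simpa using h1) S ⟨le_rfl, fun K hK hd => disjoint_self.1 (hd.mono_right hK)⟩
  obtain ⟨N, -, hN⟩ := hz
  exact ⟨N, hN⟩

theorem exists_maximal_disjoint_submodule {R : Type u} [CommRing R] {J : Type u} [AddCommGroup J]
    [Module R J] (N : Submodule R J) :
    ∃ C : Submodule R J, Maximal (fun C => Disjoint N C) C := by
  have hz := zorn_le_nonempty₀ {C : Submodule R J | Disjoint N C} (fun c hc hchain y hy =>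
    ⟨sSup c, (hchain.directedOn.disjoint_sSup_right).2 fun b hb => hc hb,
      fun z hz => le_sSup hz⟩) ⊥ disjoint_bot_right
  obtain ⟨C, -, hC⟩ := hz
  exact ⟨C, hC⟩

/-- Every module has an injective envelope. -/
theorem exists_isInjectiveEnvelope (R : Type u) [CommRing R] (M : Type u) [AddCommGroup M]
    [Module R M] : ∃ (E : ModuleCat.{u} R) (i : M →ₗ[R] E), IsInjectiveEnvelope i := by
  let P : InjectivePresentation (ModuleCat.of R M) := Classical.choice
    (EnoughInjectives.presentation _)
  let J := P.J
  have hJ : Module.Injective R J :=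
    Module.injective_module_of_injective_object R J (inj := P.injective)
  let e : M →ₗ[R] J := P.f.hom
  have he : Function.Injective e := (ModuleCat.mono_iff_injective P.f).1 P.mono
  obtain ⟨N, hN⟩ := exists_maximal_essential (LinearMap.range e)
  obtain ⟨C, hC⟩ := exists_maximal_disjoint_submodule N
  have hmax : ∀ K : Submodule R J, C ≤ K → Disjoint N K → K ≤ C := fun K h1 h2 => hC.2 h2 h1
  have hf : Function.Injective (C.mkQ ∘ₗ N.subtype) := by
    rw [← LinearMap.ker_eq_bot, LinearMap.ker_comp, Submodule.ker_mkQ]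
    refine (Submodule.eq_bot_iff _).2 fun x hx => ?_
    exact Subtype.ext (Submodule.disjoint_def.1 hC.1 x x.2 hx)
  obtain ⟨g, hg⟩ := hJ.out (C.mkQ ∘ₗ N.subtype) hf N.subtype
  have hg' : ∀ x ∈ N, g (C.mkQ x) = x := fun x hx => hg ⟨x, hx⟩
  have key : ∀ K : Submodule R J, Disjoint N K → K ⊓ LinearMap.range g = ⊥ := by
    intro K hK
    refine (Submodule.eq_bot_iff _).2 ?_
    rintro _ ⟨hx, z, rfl⟩
    obtain ⟨w, rfl⟩ := C.mkQ_surjective z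
    have h1 : C ≤ (K.comap g).comap C.mkQ := fun c hc => by
      have : C.mkQ c = 0 := (Submodule.Quotient.mk_eq_zero C).2 hc
      simp [this]
    have h2 : Disjoint N ((K.comap g).comap C.mkQ) := by
      refine Submodule.disjoint_def.2 fun x hx hx' => ?_
      have : g (C.mkQ x) ∈ K := hx'
      rw [hg' x hx] at this
      exact Submodule.disjoint_def.1 hK x hx this
    have h3 : w ∈ C := hmax _ h1 h2 hx
    have : C.mkQ w = 0 := (Submodule.Quotient.mk_eq_zero C).2 h3
    simp [this]
  have hle : N ≤ LinearMap.range g := fun x hx => ⟨C.mkQ x, hg' x hx⟩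
  have hrange : LinearMap.range g ≤ N := by
    refine hN.2 ⟨hN.1.1.trans hle, fun K hK hd => ?_⟩ hle
    have h1 : Disjoint N K := by
      rw [disjoint_iff]
      exact hN.1.2 _ inf_le_left (hd.mono_left inf_le_right)
    have := key K h1
    rwa [inf_eq_left.2 hK] at this
  let r : J →ₗ[R] N := (g ∘ₗ C.mkQ).codRestrict N fun x => hrange ⟨_, rfl⟩
  refine ⟨ModuleCat.of R N, e.codRestrict N fun x => hN.1.1 ⟨x, rfl⟩, ⟨⟨?_⟩, ?_, ?_⟩⟩
  · intro X Y _ _ _ _ a ha b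
    obtain ⟨h, hh⟩ := hJ.out a ha (N.subtype ∘ₗ b)
    refine ⟨r ∘ₗ h, fun x => Subtype.ext ?_⟩
    change g (C.mkQ (h (a x))) = _
    rw [hh x]
    exact hg' _ (b x).2
  · intro x y hxy
    exact he (congrArg Subtype.val hxy)
  · intro K hK
    have h1 : K.map N.subtype = ⊥ := by
      refine hN.1.2 _ (Submodule.map_subtype_le N K) (Submodule.disjoint_def.2 ?_)
      rintro _ ⟨k, hk, rfl⟩ ⟨m, hm⟩
      have : k = 0 := Submodule.disjoint_def.1 hK k hk ⟨m, Subtype.ext hm⟩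
      simp [this]
    exact Submodule.map_injective_of_injective N.injective_subtype (h1.trans (Submodule.map_bot _).symm)

/-- The injective envelope `E(M)` of a module `M`. -/
noncomputable def injectiveEnvelope (R : Type u) [CommRing R] (M : Type u) [AddCommGroup M]
    [Module R M] : ModuleCat.{u} R :=
  (exists_isInjectiveEnvelope R M).choose

/-! ### Matlis duality -/

/-- The injective envelope `E` of the direct sum of the simple modules `R ⧸ 𝔪`,
where `𝔪` runs through the maximal ideals of `R`. -/
noncomputable def matlisInjective (R : Type u) [CommRing R] : ModuleCat.{u} R :=
  injectiveEnvelope R (DirectSum (MaximalSpectrum R) fun m => R ⧸ m.asIdeal)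

/-- The Matlis dual `Hom_R(M, E)`. -/
abbrev MatlisDual (R : Type u) [CommRing R] (M : Type u) [AddCommGroup M] [Module R M] : Type u :=
  M →ₗ[R] matlisInjective R

/-- The evaluation map from a module to its Matlis bidual. -/
noncomputable def matlisEval (R : Type u) [CommRing R] (M : Type u) [AddCommGroup M]
    [Module R M] : M →ₗ[R] MatlisDual R (MatlisDual R M) :=
  LinearMap.applyₗ

/-- `refl R`: the Matlis reflexive modules. -/
def reflProp (R : Type u) [CommRing R] : ObjectProperty (ModuleCat.{u} R) :=
  fun M => Function.Bijective (matlisEval R M)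

/-- `noeth R`: the noetherian modules. -/
def noethProp (R : Type u) [CommRing R] : ObjectProperty (ModuleCat.{u} R) :=
  fun M => IsNoetherian R M

/-- `art R`: the artinian modules. -/
def artProp (R : Type u) [CommRing R] : ObjectProperty (ModuleCat.{u} R) :=
  fun M => IsArtinian R M

/-- `fl R`: the modules of finite length. -/
def flProp (R : Type u) [CommRing R] : ObjectProperty (ModuleCat.{u} R) :=
  fun M => IsFiniteLength R M

/-- `arno R`: the modules having a noetherian submodule with artinian quotient. -/
def arnoProp (R : Type u) [CommRing R] : ObjectProperty (ModuleCat.{u} R) :=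
  fun M => ∃ U : Submodule R M, IsNoetherian R U ∧ IsArtinian R (M ⧸ U)

/-- Let `P` be a class of modules closed under submodules and quotients, viewed as a full
subcategory. The quotient category `P / fl R` is the localization of `P` at the
homomorphisms whose kernel and cokernel have finite length. -/
def modFlProp {R : Type u} [CommRing R] (P : ObjectProperty (ModuleCat.{u} R)) :
    MorphismProperty P.FullSubcategory :=
  fun _ N f => IsFiniteLength R (LinearMap.ker f.hom.hom) ∧
    IsFiniteLength R (N.obj ⧸ LinearMap.range f.hom.hom)

/-- The quotient category `P / fl R`. -/
abbrev QuotFl {R : Type u} [CommRing R] (P : ObjectProperty (ModuleCat.{u} R)) :=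
  (modFlProp P).Localization

/-! ### Pure-injective modules -/

/-- A pure monomorphism: it remains injective after tensoring with any module. -/
def IsPureMono {R : Type u} [CommRing R] {X Y : Type u} [AddCommGroup X] [Module R X]
    [AddCommGroup Y] [Module R Y] (f : X →ₗ[R] Y) : Prop :=
  ∀ (N : Type u) [AddCommGroup N] [Module R N], Function.Injective (f.lTensor N)

/-- A module is pure-injective if homomorphisms into it extend along pure monomorphisms. -/
def IsPureInjective (R : Type u) [CommRing R] (M : Type u) [AddCommGroup M] [Module R M] : Prop :=
  ∀ (X Y : Type u) [AddCommGroup X] [AddCommGroup Y] [Module R X] [Module R Y]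
    (f : X →ₗ[R] Y), IsPureMono f → ∀ g : X →ₗ[R] M, ∃ h : Y →ₗ[R] M, h ∘ₗ f = g

/-! ### Triangular matrix rings -/

/-- For a commutative `A`-algebra `B`, the ring of matrices `[[a, b], [0, d]]` with
`a ∈ A` and `b, d ∈ B`. -/
@[ext] structure TriRing (A B : Type u) where
  a : A
  b : B
  d : B

namespace TriRing

section

variable {A B : Type u} [CommRing A] [CommRing B]

instance : Zero (TriRing A B) := ⟨⟨0, 0, 0⟩⟩
instance : One (TriRing A B) := ⟨⟨1, 0, 1⟩⟩
instance : Add (TriRing A B) := ⟨fun x y => ⟨x.a + y.a, x.b + y.b, x.d + y.d⟩⟩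
instance : Neg (TriRing A B) := ⟨fun x => ⟨-x.a, -x.b, -x.d⟩⟩

@[simp] theorem zero_a : (0 : TriRing A B).a = 0 := rfl
@[simp] theorem zero_b : (0 : TriRing A B).b = 0 := rfl
@[simp] theorem zero_d : (0 : TriRing A B).d = 0 := rfl
@[simp] theorem one_a : (1 : TriRing A B).a = 1 := rfl
@[simp] theorem one_b : (1 : TriRing A B).b = 0 := rfl
@[simp] theorem one_d : (1 : TriRing A B).d = 1 := rfl
@[simp] theorem add_a (x y : TriRing A B) : (x + y).a = x.a + y.a := rfl
@[simp] theorem add_b (x y : TriRing A B) : (x + y).b = x.b + y.b := rfl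
@[simp] theorem add_d (x y : TriRing A B) : (x + y).d = x.d + y.d := rfl
@[simp] theorem neg_a (x : TriRing A B) : (-x).a = -x.a := rfl
@[simp] theorem neg_b (x : TriRing A B) : (-x).b = -x.b := rfl
@[simp] theorem neg_d (x : TriRing A B) : (-x).d = -x.d := rfl

end

section

variable {A B : Type u} [CommRing A] [CommRing B] [Algebra A B]

instance : Mul (TriRing A B) :=
  ⟨fun x y => ⟨x.a * y.a, x.a • y.b + x.b * y.d, x.d * y.d⟩⟩

@[simp] theorem mul_a (x y : TriRing A B) : (x * y).a = x.a * y.a := rfl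
@[simp] theorem mul_b (x y : TriRing A B) : (x * y).b = x.a • y.b + x.b * y.d := rfl
@[simp] theorem mul_d (x y : TriRing A B) : (x * y).d = x.d * y.d := rfl

instance : Ring (TriRing A B) where
  add_assoc x y z := by ext <;> simp [add_assoc]
  zero_add x := by ext <;> simp
  add_zero x := by ext <;> simp
  add_comm x y := by ext <;> simp [add_comm]
  neg_add_cancel x := by ext <;> simp
  left_distrib x y z := by ext <;> simp [mul_add]; abel
  right_distrib x y z := by ext <;> simp [add_mul, add_smul]; abel
  zero_mul x := by ext <;> simp
  mul_zero x := by ext <;> simp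
  mul_assoc x y z := by
    ext <;> simp [mul_assoc, add_mul, mul_smul, smul_add, add_assoc]
  one_mul x := by ext <;> simp
  mul_one x := by ext <;> simp
  nsmul := nsmulRec
  zsmul := zsmulRec

/-- Right multiplication by the matrix `x` on the row vectors `A ⊕ B`:
`(s, t) ↦ (s a, s b + t d)`. -/
def rowMul (x : TriRing A B) : (A × B) →ₗ[A] (A × B) where
  toFun v := (v.1 * x.a, v.1 • x.b + v.2 * x.d)
  map_add' v w := by ext <;> simp [add_mul, add_smul]; abel
  map_smul' r v := by ext <;> simp [mul_assoc, mul_smul]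

@[simp] theorem rowMul_apply (x : TriRing A B) (v : A × B) :
    rowMul x v = (v.1 * x.a, v.1 • x.b + v.2 * x.d) := rfl

theorem rowMul_mul (x y : TriRing A B) : rowMul (x * y) = rowMul y ∘ₗ rowMul x := by
  refine LinearMap.ext fun v => ?_
  ext <;> simp [mul_assoc, mul_smul, add_mul, smul_add, add_assoc]

theorem rowMul_add (x y : TriRing A B) : rowMul (x + y) = rowMul x + rowMul y := by
  refine LinearMap.ext fun v => ?_
  ext <;> simp [mul_add]; abel

theorem rowMul_one : rowMul (1 : TriRing A B) = LinearMap.id := by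
  refine LinearMap.ext fun v => ?_
  ext <;> simp

theorem rowMul_zero : rowMul (0 : TriRing A B) = 0 := by
  refine LinearMap.ext fun v => ?_
  ext <;> simp

/-- `Hom_A(A ⊕ B, M)` as a left module over the triangular matrix ring; the action is
induced by the right action of matrices on the row vectors `A ⊕ B`. -/
instance homModule (M : Type u) [AddCommGroup M] [Module A M] :
    Module (TriRing A B) ((A × B) →ₗ[A] M) where
  smul x f := f ∘ₗ rowMul x
  one_smul f := by change f ∘ₗ rowMul 1 = f; rw [rowMul_one, LinearMap.comp_id]
  mul_smul x y f := by
    change f ∘ₗ rowMul (x * y) = (f ∘ₗ rowMul y) ∘ₗ rowMul x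
    rw [rowMul_mul, LinearMap.comp_assoc]
  smul_zero x := LinearMap.zero_comp _
  smul_add x f g := LinearMap.add_comp _ _ _
  add_smul x y f := by
    change f ∘ₗ rowMul (x + y) = f ∘ₗ rowMul x + f ∘ₗ rowMul y
    rw [rowMul_add, LinearMap.comp_add]
  zero_smul f := by change f ∘ₗ rowMul 0 = 0; rw [rowMul_zero, LinearMap.comp_zero]

end

end TriRing

/-- The functor `Hom_A(A ⊕ B, -)` from `A`-modules to left modules over the triangular
matrix ring `[[A, B], [0, B]]`. -/
def homRow (A B : Type u) [CommRing A] [CommRing B] [Algebra A B] :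
    ModuleCat.{u} A ⥤ ModuleCat.{u} (TriRing A B) where
  obj M := ModuleCat.of (TriRing A B) ((A × B) →ₗ[A] M)
  map {M N} f := ModuleCat.ofHom
    { toFun := fun h => f.hom ∘ₗ h
      map_add' := fun h k => LinearMap.comp_add _ _ _
      map_smul' := fun _ _ => rfl }

/-- `mod S`: the finitely presented left modules over a ring `S`. -/
def fpProp (S : Type u) [Ring S] : ObjectProperty (ModuleCat.{u} S) :=
  fun M => Module.FinitePresentation S M

/-! ### The modules over a complete discrete valuation ring -/

section

open IsLocalRing

/-- The map `A ⧸ 𝔪 ^ i → A ⧸ 𝔪 ^ j`, for `i ≤ j`, given by multiplication with `π ^ (j - i)`. -/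
noncomputable def powTransition {A : Type u} [CommRing A] [IsLocalRing A] {π : A}
    (hπ : π ∈ maximalIdeal A) (i j : ℕ) (hij : i ≤ j) :
    (A ⧸ maximalIdeal A ^ i) →ₗ[A] (A ⧸ maximalIdeal A ^ j) :=
  Submodule.mapQ (maximalIdeal A ^ i) (maximalIdeal A ^ j) (LinearMap.lsmul A A (π ^ (j - i)))
    (fun x hx => by
      have h := Ideal.mul_mem_mul (Ideal.pow_mem_pow hπ (j - i)) hx
      rw [← pow_add, Nat.sub_add_cancel hij] at h
      exact h)

/-- Labels of the modules `A`, `E(A ⧸ 𝔪)`, `Q(A)` and `A ⧸ 𝔪 ^ i`, `i ≥ 1`. -/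
inductive MatlisLabel : Type
  | ring
  | envelope
  | quotientField
  | cyclic (i : ℕ) (hi : 1 ≤ i)

/-- The module with a given label. -/
noncomputable def matlisModule (A : Type u) [CommRing A] [IsLocalRing A] :
    MatlisLabel → ModuleCat.{u} A
  | .ring => ModuleCat.of A A
  | .envelope => injectiveEnvelope A (A ⧸ maximalIdeal A)
  | .quotientField => ModuleCat.of A (FractionRing A)
  | .cyclic i _ => ModuleCat.of A (A ⧸ maximalIdeal A ^ i)

end

/-! ### Injective modules and injective envelopes -/

section InjectiveModules

variable {R : Type u} [CommRing R]

/-! Write `K` for the field of fractions `Q`. The injective envelope of the residue field, and hence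
the Matlis injective `E`, is `K ⧸ A`: it is divisible, hence injective, and each nonzero submodule
contains the class of `π⁻¹`. Completeness enters through `exists_smul_of_fracQuotient_end`:
endomorphisms of `K ⧸ A` are scalars. So `A` and `E` are dual to each other and reflexive.
Reflexivity passes to submodules, quotients and extensions because `E` is an injective cogenerator.

An infinite direct sum of copies of a nonzero module is never reflexive. A reflexive module
therefore has finite rank and finite socle, which yields `refl A = arno A`. As a reflexive module is
a dual, `Hom(F, M) = (F ⊗ M^∨)^∨` for reflexive `M`; hence reflexive modules are pure-injective, and
flat modules are projective relative to them. So `A ⊕ K` is projective. It generates `refl A`, since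
`M^∨` embeds into a power of `K ⊕ K ⧸ A` and dualizing gives a cover of `M`. Its endomorphisms are
triangular matrices, because `Hom(K, A) = 0`; the equivalence with `mod` follows as in Morita
theory.

The classification looks for a summand in an arbitrary nonzero module. A socle element of finite
height gives a cyclic summand. If there is none, the torsion is divisible: nonzero torsion gives `K
⧸ A`, and a torsion-free module has a summand `K` or `A` according to whether it is divisible.

For the quotient categories, `M ↦ (K ⊗ M, Hom(K, M))` is exact on reflexive modules and kills
exactly those of finite length: `K ⊗ M = 0` means torsion, hence artinian, and `Hom(K, M) = 0` means
noetherian. It sends `A ⊕ K` to the free module of rank one over `T₂(K)`, and clearing denominators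
turns each map between its values into a roof (`exists_roof`). A calculus of fractions then
identifies the localization with `mod T₂(K)`. For noetherian or artinian modules one component
vanishes and the other gives `mod K`. -/

theorem Module.Injective.exists_extend {Q X Y : Type u} [AddCommGroup Q] [Module R Q]
    [AddCommGroup X] [Module R X] [AddCommGroup Y] [Module R Y] (hQ : Module.Injective R Q)
    (g : X →ₗ[R] Y) (h : X →ₗ[R] Q) (hgh : LinearMap.ker g ≤ LinearMap.ker h) :
    ∃ k : Y →ₗ[R] Q, k ∘ₗ g = h := by
  obtain ⟨k, hk⟩ := hQ.out ((LinearMap.ker g).liftQ g le_rfl)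
    (LinearMap.ker_eq_bot.1 (Submodule.ker_liftQ_eq_bot _ _ _ le_rfl))
    ((LinearMap.ker g).liftQ h hgh)
  refine ⟨k, LinearMap.ext fun x => ?_⟩
  simpa using hk (Submodule.Quotient.mk x)

theorem Module.Injective.exists_extend_of_injective {Q X Y : Type u} [AddCommGroup Q] [Module R Q]
    [AddCommGroup X] [Module R X] [AddCommGroup Y] [Module R Y] (hQ : Module.Injective R Q)
    (g : X →ₗ[R] Y) (hg : Function.Injective g) (h : X →ₗ[R] Q) :
    ∃ k : Y →ₗ[R] Q, k ∘ₗ g = h :=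
  hQ.exists_extend g h (by rw [LinearMap.ker_eq_bot.2 hg]; exact bot_le)

theorem Module.Injective.of_linearEquiv {Q Q' : Type u} [AddCommGroup Q] [Module R Q]
    [AddCommGroup Q'] [Module R Q'] (e : Q ≃ₗ[R] Q') (hQ : Module.Injective R Q) :
    Module.Injective R Q' := by
  refine ⟨fun X Y _ _ _ _ f hf g => ?_⟩
  obtain ⟨h, hh⟩ := hQ.out f hf (e.symm.toLinearMap ∘ₗ g)
  exact ⟨e.toLinearMap ∘ₗ h, fun x => by simp [hh]⟩

theorem Module.Injective.of_pi {n : Type} {Q : Type u} [AddCommGroup Q] [Module R Q]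
    (hQ : Module.Injective R Q) : Module.Injective R (n → Q) := by
  refine ⟨fun X Y _ _ _ _ f hf g => ?_⟩
  choose h hh using fun i => hQ.out f hf (LinearMap.proj i ∘ₗ g)
  exact ⟨LinearMap.pi h, fun x => by ext i; simp [hh]⟩

theorem Module.Injective.of_prod {Q Q' : Type u} [AddCommGroup Q] [Module R Q]
    [AddCommGroup Q'] [Module R Q'] (hQ : Module.Injective R Q) (hQ' : Module.Injective R Q') :
    Module.Injective R (Q × Q') := by
  refine ⟨fun X Y _ _ _ _ f hf g => ?_⟩
  obtain ⟨h, hh⟩ := hQ.out f hf (LinearMap.fst R Q Q' ∘ₗ g)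
  obtain ⟨h', hh'⟩ := hQ'.out f hf (LinearMap.snd R Q Q' ∘ₗ g)
  exact ⟨h.prod h', fun x => by ext <;> simp [hh, hh']⟩

/-- Divisible modules over a principal ideal domain are injective. -/
theorem Module.Injective.of_divisible [IsDomain R] [IsPrincipalIdealRing R] {Q : Type u}
    [AddCommGroup Q] [Module R Q] (hQ : ∀ a : R, a ≠ 0 → ∀ x : Q, ∃ y, a • y = x) :
    Module.Injective R Q := by
  refine Module.Baer.injective fun I g => ?_
  obtain ⟨a, rfl⟩ := (IsPrincipalIdealRing.principal I).principal
  by_cases ha : a = 0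
  · refine ⟨0, fun x hx => ?_⟩
    have hx0 : x = 0 := by simpa [ha] using hx
    subst hx0
    exact (map_zero g).symm
  · obtain ⟨y, hy⟩ := hQ a ha (g ⟨a, Submodule.mem_span_singleton_self a⟩)
    refine ⟨LinearMap.toSpanSingleton R Q y, fun x hx => ?_⟩
    obtain ⟨r, rfl⟩ := Submodule.mem_span_singleton.1 hx
    have : (⟨r • a, hx⟩ : Submodule.span R {a}) = r • ⟨a, Submodule.mem_span_singleton_self a⟩ :=
      rfl
    rw [this, map_smul, map_smul, ← hy, LinearMap.toSpanSingleton_apply]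

/-- Injective envelopes of a module are unique up to isomorphism. -/
theorem IsInjectiveEnvelope.nonempty_linearEquiv {M E E' : Type u} [AddCommGroup M] [Module R M]
    [AddCommGroup E] [Module R E] [AddCommGroup E'] [Module R E'] {i : M →ₗ[R] E}
    {i' : M →ₗ[R] E'} (hi : IsInjectiveEnvelope i) (hi' : IsInjectiveEnvelope i') :
    Nonempty (E ≃ₗ[R] E') := by
  obtain ⟨e, he⟩ := hi'.injective_module.exists_extend_of_injective i hi.injective_map i'
  have he1 : Function.Injective e := by
    rw [← LinearMap.ker_eq_bot]
    refine hi.essential _ (Submodule.disjoint_def.2 ?_)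
    rintro _ hx ⟨y, rfl⟩
    have : i' y = 0 := by rw [← he]; exact hx
    rw [hi'.injective_map (this.trans (map_zero i').symm), map_zero]
  -- The retraction `r` of `e` is injective, since its kernel misses the image of `i'`. An injective
  -- retraction makes `e` surjective.
  obtain ⟨r, hr⟩ := hi.injective_module.exists_extend_of_injective e he1 LinearMap.id
  have hr' : ∀ x, r (e x) = x := fun x => LinearMap.congr_fun hr x
  have hr1 : Function.Injective r := by
    rw [← LinearMap.ker_eq_bot]
    refine hi'.essential _ (Submodule.disjoint_def.2 ?_)
    rintro _ hx ⟨y, rfl⟩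
    have h1 : r (i' y) = 0 := hx
    rw [← he, LinearMap.comp_apply, hr'] at h1
    rw [hi.injective_map (h1.trans (map_zero i).symm), map_zero]
  exact ⟨LinearEquiv.ofBijective e ⟨he1, fun y => ⟨r y, hr1 (hr' _)⟩⟩⟩

theorem isInjectiveEnvelope_injectiveEnvelope (M : Type u) [AddCommGroup M] [Module R M] :
    ∃ i : M →ₗ[R] injectiveEnvelope R M, IsInjectiveEnvelope i :=
  (exists_isInjectiveEnvelope R M).choose_spec

end InjectiveModules

/-! ### The module `K ⧸ A` over a discrete valuation ring -/

section FracQuotient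

variable (A : Type u) [CommRing A]

/-- The module `K ⧸ A`, where `K` is the field of fractions of `A`. -/
abbrev FracQuotient : Type u := FractionRing A ⧸ LinearMap.range (Algebra.linearMap A (FractionRing A))

variable {A}

/-- The class of a fraction in `K ⧸ A`. -/
abbrev fracClass : FractionRing A →ₗ[A] FracQuotient A :=
  (LinearMap.range (Algebra.linearMap A (FractionRing A))).mkQ

theorem fracClass_eq_zero {q : FractionRing A} :
    fracClass q = 0 ↔ ∃ a, algebraMap A (FractionRing A) a = q := by
  rw [fracClass, Submodule.mkQ_apply, Submodule.Quotient.mk_eq_zero]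
  rfl

variable [IsDomain A] [IsDiscreteValuationRing A]

theorem exists_smul_eq_of_irreducible {M : Type*} [AddCommGroup M] [Module A M] {π : A}
    (hπ : Irreducible π) (h : ∀ x : M, ∃ y, π • y = x) (a : A) (ha : a ≠ 0) (x : M) :
    ∃ y, a • y = x := by
  obtain ⟨n, u, rfl⟩ := IsDiscreteValuationRing.eq_unit_mul_pow_irreducible ha hπ
  induction n generalizing x with
  | zero => exact ⟨(u⁻¹ : Aˣ) • x, by simp [Units.smul_def, smul_smul]⟩
  | succ n ih =>
    obtain ⟨y, rfl⟩ := ih x (by simpa using pow_ne_zero n hπ.ne_zero)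
    obtain ⟨z, rfl⟩ := h y
    exact ⟨z, by rw [smul_smul, pow_succ, mul_assoc]⟩

theorem injective_of_smul_surjective {M : Type u} [AddCommGroup M] [Module A M] {π : A}
    (hπ : Irreducible π) (h : ∀ x : M, ∃ y, π • y = x) : Module.Injective A M :=
  .of_divisible (exists_smul_eq_of_irreducible hπ h)

theorem smul_surjective_fractionRing (a : A) (ha : a ≠ 0) (x : FractionRing A) :
    ∃ y, a • y = x := by
  have ha' : algebraMap A (FractionRing A) a ≠ 0 := by simpa using ha
  exact ⟨(algebraMap A (FractionRing A) a)⁻¹ * x, by rw [Algebra.smul_def, mul_inv_cancel_left₀ ha']⟩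

theorem smul_surjective_fracQuotient (a : A) (ha : a ≠ 0) (x : FracQuotient A) :
    ∃ y, a • y = x := by
  obtain ⟨q, rfl⟩ := Submodule.mkQ_surjective _ x
  obtain ⟨y, rfl⟩ := smul_surjective_fractionRing a ha q
  exact ⟨fracClass y, (map_smul _ _ _).symm⟩

variable (A) in
theorem injective_fractionRing : Module.Injective A (FractionRing A) :=
  .of_divisible smul_surjective_fractionRing

variable (A) in
theorem injective_fracQuotient : Module.Injective A (FracQuotient A) :=
  .of_divisible smul_surjective_fracQuotient

/-- The class of `π⁻ⁿ` in `K ⧸ A`. -/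
noncomputable def invPow (π : A) (n : ℕ) : FracQuotient A :=
  fracClass ((algebraMap A (FractionRing A) π)⁻¹ ^ n)

/-- The annihilator of `π⁻ⁿ` is exactly `πⁿA`. With the next lemmas, this presents `K ⧸ A` as the
increasing union of cyclic modules generated by the `π⁻ⁿ`. -/
theorem smul_invPow_eq_zero {π : A} (hπ : Irreducible π) {n : ℕ} {a : A} :
    a • invPow π n = 0 ↔ π ^ n ∣ a := by
  have h0 : algebraMap A (FractionRing A) π ≠ 0 := by simpa using hπ.ne_zero
  rw [invPow, ← map_smul, fracClass_eq_zero]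
  constructor
  · rintro ⟨b, hb⟩
    refine ⟨b, IsFractionRing.injective A (FractionRing A) ?_⟩
    rw [map_mul, hb, map_pow, Algebra.smul_def, inv_pow]
    field_simp
  · rintro ⟨b, rfl⟩
    refine ⟨b, ?_⟩
    rw [Algebra.smul_def, map_mul, map_pow, inv_pow]
    field_simp

theorem pow_smul_invPow {π : A} (hπ : Irreducible π) (m n : ℕ) :
    π ^ m • invPow π (m + n) = invPow π n := by
  have h0 : algebraMap A (FractionRing A) π ≠ 0 := by simpa using hπ.ne_zero
  rw [invPow, ← map_smul, Algebra.smul_def, map_pow, inv_pow, invPow, inv_pow, pow_add]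
  congr 1
  field_simp

theorem exists_eq_smul_invPow {π : A} (hπ : Irreducible π) (x : FracQuotient A) :
    ∃ (n : ℕ) (b : A), x = b • invPow π n := by
  have h0 : algebraMap A (FractionRing A) π ≠ 0 := by simpa using hπ.ne_zero
  obtain ⟨q, rfl⟩ := Submodule.mkQ_surjective _ x
  obtain ⟨b, c, hc, rfl⟩ := IsFractionRing.div_surjective (A := A) q
  obtain ⟨n, u, rfl⟩ := IsDiscreteValuationRing.eq_unit_mul_pow_irreducible
    (nonZeroDivisors.ne_zero hc) hπ
  refine ⟨n, (u⁻¹ : Aˣ) * b, ?_⟩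
  rw [invPow, ← map_smul, Algebra.smul_def, map_mul, map_pow]
  congr 1
  have hu : algebraMap A (FractionRing A) u * algebraMap A (FractionRing A) (u⁻¹ : Aˣ) = 1 := by
    rw [← map_mul, Units.mul_inv, map_one]
  have hu' := left_ne_zero_of_mul_eq_one hu
  rw [eq_comm, inv_pow, map_mul]
  field_simp
  linear_combination (algebraMap A (FractionRing A) b) * hu

theorem exists_eq_smul_invPow_of_pow_smul {π : A} (hπ : Irreducible π) {n : ℕ}
    {x : FracQuotient A} (hx : π ^ n • x = 0) : ∃ b : A, x = b • invPow π n := by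
  have h0 : algebraMap A (FractionRing A) π ≠ 0 := by simpa using hπ.ne_zero
  obtain ⟨q, rfl⟩ := Submodule.mkQ_surjective _ x
  rw [← map_smul, fracClass_eq_zero] at hx
  obtain ⟨b, hb⟩ := hx
  refine ⟨b, ?_⟩
  rw [invPow, ← map_smul]
  congr 1
  rw [Algebra.smul_def, hb, Algebra.smul_def, map_pow, inv_pow]
  field_simp

theorem invPow_one_ne_zero {π : A} (hπ : Irreducible π) : invPow π 1 ≠ 0 := by
  intro h
  have := (smul_invPow_eq_zero hπ (n := 1) (a := 1)).1 (by rw [one_smul, h])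
  exact hπ.not_isUnit (isUnit_of_dvd_one (by simpa using this))

/-- For `x = u πᵐ π⁻ⁿ` with `u` a unit and `m < n`, the factor `u⁻¹ π^(n-m-1)` moves `x` to `π⁻¹`.
So a map out of `K ⧸ A` is injective as soon as it does not kill `π⁻¹`. -/
theorem exists_smul_eq_invPow_one {π : A} (hπ : Irreducible π) {x : FracQuotient A} (hx : x ≠ 0) :
    ∃ a : A, a • x = invPow π 1 := by
  obtain ⟨n, b, rfl⟩ := exists_eq_smul_invPow hπ x
  have hb : b ≠ 0 := by rintro rfl; simp at hx
  obtain ⟨m, u, rfl⟩ := IsDiscreteValuationRing.eq_unit_mul_pow_irreducible hb hπ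
  have hmn : m < n := by
    by_contra! h
    exact hx ((smul_invPow_eq_zero hπ).2 ((pow_dvd_pow π h).mul_left _))
  refine ⟨(u⁻¹ : Aˣ) * π ^ (n - m - 1), ?_⟩
  have : (u⁻¹ : Aˣ) * π ^ (n - m - 1) * (u * π ^ m) = π ^ (n - 1) := by
    rw [mul_mul_mul_comm, Units.inv_mul, one_mul, ← pow_add]
    congr 1
    omega
  have h2 := pow_smul_invPow hπ (n - 1) 1
  rwa [Nat.sub_add_cancel (by omega), ← this, ← smul_smul] at h2

/-- Every embedding of a nonzero module into `K ⧸ A` is an injective envelope. -/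
theorem isInjectiveEnvelope_fracQuotient {M : Type u} [AddCommGroup M] [Module A M] [Nontrivial M]
    (i : M →ₗ[A] FracQuotient A) (hi : Function.Injective i) : IsInjectiveEnvelope i := by
  obtain ⟨π, hπ⟩ := IsDiscreteValuationRing.exists_irreducible A
  have key : ∀ K : Submodule A (FracQuotient A), K ≠ ⊥ → invPow π 1 ∈ K := fun K hK => by
    obtain ⟨x, hx, hx0⟩ := K.exists_mem_ne_zero_of_ne_bot hK
    obtain ⟨a, ha⟩ := exists_smul_eq_invPow_one hπ hx0
    exact ha ▸ K.smul_mem a hx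
  refine ⟨injective_fracQuotient A, hi, fun K hK => ?_⟩
  by_contra hK0
  refine invPow_one_ne_zero hπ (Submodule.disjoint_def.1 hK _ (key K hK0) (key _ fun h => ?_))
  obtain ⟨x, hx⟩ := exists_ne (0 : M)
  exact hx (hi (((Submodule.mem_bot A).1 (h ▸ ⟨x, rfl⟩)).trans (map_zero i).symm))

open IsLocalRing

theorem mem_maximalIdeal_pow_iff {π : A} (hπ : Irreducible π) {n : ℕ} {a : A} :
    a ∈ maximalIdeal A ^ n ↔ π ^ n ∣ a := by
  rw [hπ.maximalIdeal_eq, Ideal.span_singleton_pow, Ideal.mem_span_singleton]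

/-- The embedding `A ⧸ 𝔪ⁿ → K ⧸ A` with `1 ↦ π⁻ⁿ`. -/
noncomputable def cyclicToFracQuotient {π : A} (hπ : Irreducible π) (n : ℕ) :
    (A ⧸ maximalIdeal A ^ n) →ₗ[A] FracQuotient A :=
  (maximalIdeal A ^ n).liftQ (LinearMap.toSpanSingleton A _ (invPow π n)) fun a ha => by
    rw [LinearMap.mem_ker, LinearMap.toSpanSingleton_apply, smul_invPow_eq_zero hπ]
    exact (mem_maximalIdeal_pow_iff hπ).1 ha

@[simp] theorem cyclicToFracQuotient_mk {π : A} (hπ : Irreducible π) (n : ℕ) (a : A) :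
    cyclicToFracQuotient hπ n (Submodule.Quotient.mk a) = a • invPow π n := rfl

theorem cyclicToFracQuotient_injective {π : A} (hπ : Irreducible π) (n : ℕ) :
    Function.Injective (cyclicToFracQuotient hπ n) := by
  refine LinearMap.ker_eq_bot.1 (Submodule.ker_liftQ_eq_bot _ _ _ fun a ha => ?_)
  rw [LinearMap.mem_ker, LinearMap.toSpanSingleton_apply, smul_invPow_eq_zero hπ] at ha
  exact (mem_maximalIdeal_pow_iff hπ).2 ha

/-- The embedding `A ⧸ 𝔪 → K ⧸ A` with `1 ↦ π⁻¹`. -/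
theorem exists_residue_to_fracQuotient :
    ∃ i : (A ⧸ maximalIdeal A) →ₗ[A] FracQuotient A, Function.Injective i := by
  obtain ⟨π, hπ⟩ := IsDiscreteValuationRing.exists_irreducible A
  have := cyclicToFracQuotient_injective hπ 1
  exact ⟨cyclicToFracQuotient hπ 1 ∘ₗ (Submodule.quotEquivOfEq _ _ (pow_one _).symm).toLinearMap,
    this.comp (LinearEquiv.injective _)⟩

variable (A) in
theorem nonempty_envelope_equiv_fracQuotient :
    Nonempty (injectiveEnvelope A (A ⧸ maximalIdeal A) ≃ₗ[A] FracQuotient A) := by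
  obtain ⟨i, hi⟩ := exists_residue_to_fracQuotient (A := A)
  obtain ⟨j, hj⟩ := isInjectiveEnvelope_injectiveEnvelope (R := A) (A ⧸ maximalIdeal A)
  have : Nontrivial (A ⧸ maximalIdeal A) := Submodule.Quotient.nontrivial_iff.2 Ideal.IsPrime.ne_top'
  exact hj.nonempty_linearEquiv (isInjectiveEnvelope_fracQuotient i hi)

variable (A) in
-- As `A` is local, the direct sum over maximal ideals has a single summand, the residue field.
theorem nonempty_matlisInjective_equiv_fracQuotient :
    Nonempty (matlisInjective A ≃ₗ[A] FracQuotient A) := by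
  classical
  obtain ⟨i, hi⟩ := exists_residue_to_fracQuotient (A := A)
  obtain ⟨j, hj⟩ := isInjectiveEnvelope_injectiveEnvelope (R := A)
    (DirectSum (MaximalSpectrum A) fun m => A ⧸ m.asIdeal)
  have hm : ∀ m : MaximalSpectrum A, m.asIdeal = maximalIdeal A := fun m =>
    eq_maximalIdeal m.isMaximal
  let m₀ : MaximalSpectrum A := ⟨maximalIdeal A, inferInstance⟩
  have hu : ∀ m, m = m₀ := fun m => MaximalSpectrum.ext (hm m)
  let f : (DirectSum (MaximalSpectrum A) fun m => A ⧸ m.asIdeal) →ₗ[A] (A ⧸ maximalIdeal A) :=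
    DirectSum.component A _ _ m₀
  have hf : Function.Injective f := fun x y h => by
    refine DFinsupp.ext fun m => ?_
    obtain rfl := hu m
    exact h
  have : Nontrivial (A ⧸ maximalIdeal A) := Submodule.Quotient.nontrivial_iff.2 Ideal.IsPrime.ne_top'
  have : Nontrivial (DirectSum (MaximalSpectrum A) fun m => A ⧸ m.asIdeal) := by
    refine (Function.Surjective.nontrivial (f := f) fun x => ?_)
    exact ⟨DirectSum.lof A _ (fun m : MaximalSpectrum A => A ⧸ m.asIdeal) m₀ x,
      DirectSum.component.lof_self ..⟩
  exact hj.nonempty_linearEquiv (isInjectiveEnvelope_fracQuotient (i ∘ₗ f) (hi.comp hf))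

/-- Over a complete discrete valuation ring, the endomorphisms of `K ⧸ A` are scalars. -/
theorem exists_smul_of_fracQuotient_end [IsAdicComplete (maximalIdeal A) A]
    (f : FracQuotient A →ₗ[A] FracQuotient A) : ∃ a : A, ∀ x, f x = a • x := by
  obtain ⟨π, hπ⟩ := IsDiscreteValuationRing.exists_irreducible A
  have h1 : ∀ n, ∃ b : A, f (invPow π n) = b • invPow π n := fun n => by
    refine exists_eq_smul_invPow_of_pow_smul hπ ?_
    rw [← map_smul, (smul_invPow_eq_zero hπ).2 dvd_rfl, map_zero]
  choose b hb using h1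
  -- Applying `f` to `π⁻ᵐ = π^(n-m) π⁻ⁿ` gives `b m ≡ b n` modulo `πᵐ`, so the `b n` have a limit in
  -- the complete ring.
  obtain ⟨a, ha⟩ := IsPrecomplete.prec (inferInstance : IsPrecomplete (maximalIdeal A) A)
    (f := b) fun {m n} hmn => by
      rw [SModEq.sub_mem, smul_eq_mul, Ideal.mul_top, mem_maximalIdeal_pow_iff hπ,
        ← smul_invPow_eq_zero hπ]
      have h2 := pow_smul_invPow hπ (n - m) m
      rw [Nat.sub_add_cancel hmn] at h2
      have h3 : f (invPow π m) = b n • invPow π m := by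
        rw [← h2, map_smul, hb, smul_comm]
      rw [sub_smul, ← hb, h3, sub_self]
  refine ⟨a, fun x => ?_⟩
  obtain ⟨n, c, rfl⟩ := exists_eq_smul_invPow hπ x
  have h4 := ha n
  rw [SModEq.sub_mem, smul_eq_mul, Ideal.mul_top, mem_maximalIdeal_pow_iff hπ,
    ← smul_invPow_eq_zero hπ, sub_smul, sub_eq_zero] at h4
  rw [map_smul, hb, h4, smul_comm]

theorem eq_zero_of_smul_fracQuotient {a : A} (h : ∀ x : FracQuotient A, a • x = 0) : a = 0 := by
  obtain ⟨π, hπ⟩ := IsDiscreteValuationRing.exists_irreducible A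
  by_contra ha
  obtain ⟨m, u, rfl⟩ := IsDiscreteValuationRing.eq_unit_mul_pow_irreducible ha hπ
  have := (smul_invPow_eq_zero hπ).1 (h (invPow π (m + 1)))
  rw [Units.dvd_mul_left, pow_dvd_pow_iff hπ.ne_zero hπ.not_isUnit] at this
  omega

end FracQuotient

/-! ### Matlis reflexive modules over a discrete valuation ring -/

section MatlisReflexive

open TensorProduct IsLocalRing

/-- A module is Matlis reflexive if the evaluation map to its Matlis bidual is bijective. -/
abbrev IsMatlisReflexive (R : Type u) [CommRing R] (M : Type u) [AddCommGroup M] [Module R M] :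
    Prop :=
  Function.Bijective (matlisEval R M)

@[simp] theorem matlisEval_apply {R : Type u} [CommRing R] {M : Type u} [AddCommGroup M]
    [Module R M] (x : M) (f : MatlisDual R M) : matlisEval R M x f = f x := rfl

theorem injective_matlisInjective (R : Type u) [CommRing R] :
    Module.Injective R (matlisInjective R) :=
  (isInjectiveEnvelope_injectiveEnvelope _).choose_spec.injective_module

/-- The dual of a linear map. -/
noncomputable abbrev matlisDualMap {R : Type u} [CommRing R] {M N : Type u} [AddCommGroup M] [Module R M]
    [AddCommGroup N] [Module R N] (f : M →ₗ[R] N) : MatlisDual R N →ₗ[R] MatlisDual R M :=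
  LinearMap.lcomp R _ f

theorem matlisDualMap_injective {R : Type u} [CommRing R] {M N : Type u} [AddCommGroup M]
    [Module R M] [AddCommGroup N] [Module R N] {f : M →ₗ[R] N} (hf : Function.Surjective f) :
    Function.Injective (matlisDualMap f) := fun g h hgh => LinearMap.ext fun y => by
  obtain ⟨x, rfl⟩ := hf y
  exact LinearMap.congr_fun hgh x

theorem matlisDualMap_surjective {R : Type u} [CommRing R] {M N : Type u} [AddCommGroup M]
    [Module R M] [AddCommGroup N] [Module R N] {f : M →ₗ[R] N} (hf : Function.Injective f) :
    Function.Surjective (matlisDualMap f) := fun g =>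
  (injective_matlisInjective R).exists_extend_of_injective f hf g

theorem IsMatlisReflexive.exists_eval {R : Type u} [CommRing R] {M : Type u} [AddCommGroup M]
    [Module R M] (h : IsMatlisReflexive R M) (φ : MatlisDual R (MatlisDual R M)) :
    ∃ x, ∀ f, φ f = f x :=
  (h.2 φ).imp fun x hx f => by rw [← hx, matlisEval_apply]

variable {A : Type u} [CommRing A] [IsDomain A] [IsDiscreteValuationRing A]
variable {L M N : Type u} [AddCommGroup L] [Module A L] [AddCommGroup M] [Module A M]
  [AddCommGroup N] [Module A N]

/-- The annihilator of `x ≠ 0` lies in `πA`, which kills `π⁻¹`. Hence `x ↦ π⁻¹` is well defined on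
`Ax`, and it extends by injectivity: `K ⧸ A` is a cogenerator. -/
theorem exists_fracQuotient_ne_zero {x : M} (hx : x ≠ 0) : ∃ f : M →ₗ[A] FracQuotient A, f x ≠ 0 := by
  obtain ⟨π, hπ⟩ := IsDiscreteValuationRing.exists_irreducible A
  obtain ⟨k, hk⟩ := (injective_fracQuotient A).exists_extend (LinearMap.toSpanSingleton A M x)
    (LinearMap.toSpanSingleton A _ (invPow π 1)) fun a ha => by
      rw [LinearMap.mem_ker, LinearMap.toSpanSingleton_apply] at ha ⊢
      rw [smul_invPow_eq_zero hπ, pow_one, ← Ideal.mem_span_singleton, ← hπ.maximalIdeal_eq,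
        mem_maximalIdeal, mem_nonunits_iff]
      intro h
      exact hx ((h.smul_eq_zero).1 ha)
  have := LinearMap.congr_fun hk 1
  simp only [LinearMap.comp_apply, LinearMap.toSpanSingleton_apply, one_smul] at this
  exact ⟨k, this ▸ invPow_one_ne_zero hπ⟩

theorem exists_matlisDual_ne_zero {x : M} (hx : x ≠ 0) : ∃ f : MatlisDual A M, f x ≠ 0 := by
  obtain ⟨e⟩ := nonempty_matlisInjective_equiv_fracQuotient A
  obtain ⟨f, hf⟩ := exists_fracQuotient_ne_zero (A := A) hx
  exact ⟨e.symm.toLinearMap ∘ₗ f, by simpa using hf⟩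

theorem eq_zero_of_matlisDual {x : M} (hx : ∀ f : MatlisDual A M, f x = 0) : x = 0 := by
  by_contra h
  obtain ⟨f, hf⟩ := exists_matlisDual_ne_zero (A := A) h
  exact hf (hx f)

/-- A submodule is the annihilator of the functionals vanishing on it. -/
theorem exists_matlisDual_of_notMem {S : Submodule A M} {x : M} (hx : x ∉ S) :
    ∃ f : MatlisDual A M, (∀ y ∈ S, f y = 0) ∧ f x ≠ 0 := by
  obtain ⟨f, hf⟩ := exists_matlisDual_ne_zero (A := A) (x := S.mkQ x)
    (by simpa [Submodule.Quotient.mk_eq_zero] using hx)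
  refine ⟨f ∘ₗ S.mkQ, fun y hy => ?_, hf⟩
  have : S.mkQ y = 0 := (Submodule.Quotient.mk_eq_zero S).2 hy
  simp [this]

variable (A M) in
theorem matlisEval_injective : Function.Injective (matlisEval A M) := by
  refine (injective_iff_map_eq_zero _).2 fun x hx => eq_zero_of_matlisDual (A := A) fun f => ?_
  exact LinearMap.congr_fun hx f

theorem IsMatlisReflexive.of_exists
    (h : ∀ φ : MatlisDual A (MatlisDual A M), ∃ x, ∀ f, φ f = f x) : IsMatlisReflexive A M :=
  ⟨matlisEval_injective A M, fun φ => (h φ).imp fun _ hx => (LinearMap.ext hx).symm⟩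

/-- On functionals pulled back from `N`, `φ` is evaluation at some `m`. The difference kills every
functional vanishing on the image of `i`, so it factors through restriction to `L` and is evaluation
at some `i l`. -/
theorem IsMatlisReflexive.of_exact {i : L →ₗ[A] M} {p : M →ₗ[A] N} (hL : IsMatlisReflexive A L)
    (hN : IsMatlisReflexive A N) (hp : Function.Surjective p)
    (hip : Function.Exact i p) : IsMatlisReflexive A M := by
  refine .of_exists fun φ => ?_
  obtain ⟨n, hn⟩ := hN.exists_eval (φ ∘ₗ matlisDualMap p)
  obtain ⟨m, rfl⟩ := hp n
  have hφ : ∀ f : MatlisDual A M, f ∘ₗ i = 0 → φ f = f m := fun f hf => by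
    obtain ⟨k, rfl⟩ := (injective_matlisInjective A).exists_extend p f fun x hx => by
      obtain ⟨l, rfl⟩ := (hip x).1 hx
      exact LinearMap.congr_fun hf l
    exact hn k
  obtain ⟨ψ, hψ⟩ := (injective_matlisInjective A).exists_extend (matlisDualMap i)
    (φ - matlisEval A M m) fun f hf => by
      rw [LinearMap.mem_ker, LinearMap.sub_apply, hφ f hf, matlisEval_apply, sub_self]
  obtain ⟨l, hl⟩ := hL.exists_eval ψ
  refine ⟨m + i l, fun f => ?_⟩
  have h1 := LinearMap.congr_fun hψ f
  rw [LinearMap.comp_apply, hl, LinearMap.sub_apply, matlisEval_apply] at h1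
  rw [map_add, eq_add_of_sub_eq' h1.symm]
  rfl

/-- Viewed on the dual of `M`, `φ` is evaluation at some `m`. If `m` were outside the image of `i`,
a functional killing that image but not `m` would give a contradiction. -/
theorem IsMatlisReflexive.of_injective {i : L →ₗ[A] M} (hM : IsMatlisReflexive A M)
    (hi : Function.Injective i) : IsMatlisReflexive A L := by
  refine .of_exists fun φ => ?_
  obtain ⟨m, hm⟩ := hM.exists_eval (φ ∘ₗ matlisDualMap i)
  have : m ∈ LinearMap.range i := by
    by_contra h
    obtain ⟨f, hf, hfm⟩ := exists_matlisDual_of_notMem (A := A) h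
    have h0 : matlisDualMap i f = 0 := LinearMap.ext fun x => hf _ ⟨x, rfl⟩
    refine hfm ?_
    rw [← hm, LinearMap.comp_apply, h0, map_zero]
  obtain ⟨l, rfl⟩ := this
  refine ⟨l, fun f => ?_⟩
  obtain ⟨g, rfl⟩ := matlisDualMap_surjective hi f
  exact hm g

theorem IsMatlisReflexive.of_surjective {p : M →ₗ[A] N} (hM : IsMatlisReflexive A M)
    (hp : Function.Surjective p) : IsMatlisReflexive A N := by
  refine .of_exists fun φ => ?_
  obtain ⟨ψ, hψ⟩ := (injective_matlisInjective A).exists_extend_of_injective (matlisDualMap p)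
    (matlisDualMap_injective hp) φ
  obtain ⟨m, hm⟩ := hM.exists_eval ψ
  refine ⟨p m, fun f => ?_⟩
  rw [← hψ, LinearMap.comp_apply, hm]
  rfl

theorem IsMatlisReflexive.of_linearEquiv (e : M ≃ₗ[A] N) (hM : IsMatlisReflexive A M) :
    IsMatlisReflexive A N :=
  hM.of_surjective (p := e.toLinearMap) e.surjective

theorem IsMatlisReflexive.prod (hM : IsMatlisReflexive A M) (hN : IsMatlisReflexive A N) :
    IsMatlisReflexive A (M × N) :=
  .of_exact (i := LinearMap.inl A M N) (p := LinearMap.snd A M N) hM hN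
    LinearMap.snd_surjective .inl_snd

theorem IsMatlisReflexive.of_subsingleton [Subsingleton M] : IsMatlisReflexive A M :=
  .of_exists fun φ => ⟨0, fun f => by rw [Subsingleton.elim f 0, map_zero, map_zero]⟩

theorem IsMatlisReflexive.pi (hM : IsMatlisReflexive A M) (n : ℕ) :
    IsMatlisReflexive A (Fin n → M) := by
  induction n with
  | zero => exact .of_subsingleton
  | succ n ih => exact (hM.prod ih).of_linearEquiv (Fin.consLinearEquiv A fun _ => M)

theorem IsMatlisReflexive.matlisDual (hM : IsMatlisReflexive A M) :
    IsMatlisReflexive A (MatlisDual A M) := by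
  refine .of_exists fun φ => ⟨φ ∘ₗ matlisEval A M, fun ψ => ?_⟩
  obtain ⟨x, rfl⟩ := hM.2 ψ
  rfl

/-- A flat module is projective with respect to surjections out of a reflexive module. -/
theorem IsMatlisReflexive.exists_lift_of_flat {F : Type u} [AddCommGroup F] [Module A F]
    [Module.Flat A F] (hM : IsMatlisReflexive A M) {p : M →ₗ[A] N} (hp : Function.Surjective p)
    (f : F →ₗ[A] N) : ∃ g : F →ₗ[A] M, p ∘ₗ g = f := by
  -- By adjunction, `f` is a functional on `F ⊗ N^∨`. Flatness keeps `F ⊗ N^∨ → F ⊗ M^∨` injective,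
  -- so it extends to `F ⊗ M^∨`, and currying gives a map from `F` to the bidual of `M`.
  obtain ⟨ψ, hψ⟩ := (injective_matlisInjective A).exists_extend_of_injective
    ((matlisDualMap p).lTensor F)
    (Module.Flat.lTensor_preserves_injective_linearMap _ (matlisDualMap_injective hp))
    (TensorProduct.lift (matlisEval A N ∘ₗ f))
  let e := LinearEquiv.ofBijective _ hM
  refine ⟨e.symm.toLinearMap ∘ₗ TensorProduct.curry ψ, LinearMap.ext fun x => ?_⟩
  refine matlisEval_injective A N (LinearMap.ext fun d => ?_)
  have h1 : matlisEval A M (e.symm (TensorProduct.curry ψ x)) = TensorProduct.curry ψ x :=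
    e.apply_symm_apply _
  have h2 := LinearMap.congr_fun h1 (matlisDualMap p d)
  have h3 := LinearMap.congr_fun hψ (x ⊗ₜ d)
  exact h2.trans h3

/-- `Hom(X, M)` is the dual of `M^∨ ⊗ X`, because `M` is its own bidual. Purity keeps the tensored
map injective, so the corresponding functional extends. -/
theorem IsMatlisReflexive.isPureInjective (hM : IsMatlisReflexive A M) : IsPureInjective A M := by
  intro X Y _ _ _ _ f hf g
  obtain ⟨ψ, hψ⟩ := (injective_matlisInjective A).exists_extend_of_injective
    (f.lTensor (MatlisDual A M)) (hf _)
    (TensorProduct.lift (LinearMap.flip (matlisEval A M ∘ₗ g)))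
  let e := LinearEquiv.ofBijective _ hM
  refine ⟨e.symm.toLinearMap ∘ₗ (TensorProduct.curry ψ).flip, LinearMap.ext fun x => ?_⟩
  refine matlisEval_injective A M (LinearMap.ext fun d => ?_)
  have h1 : matlisEval A M (e.symm ((TensorProduct.curry ψ).flip (f x))) =
    (TensorProduct.curry ψ).flip (f x) := e.apply_symm_apply _
  have h2 := LinearMap.congr_fun h1 d
  have h3 := LinearMap.congr_fun hψ (d ⊗ₜ x)
  exact h2.trans h3

/-! ### Reflexivity of `A`, `K ⧸ A` and `K` over a complete ring -/

section Complete

variable [IsAdicComplete (maximalIdeal A) A]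

theorem exists_smul_of_matlisInjective_end (f : matlisInjective A →ₗ[A] matlisInjective A) :
    ∃ a : A, ∀ x, f x = a • x := by
  obtain ⟨e⟩ := nonempty_matlisInjective_equiv_fracQuotient A
  obtain ⟨a, ha⟩ := exists_smul_of_fracQuotient_end
    (e.toLinearMap ∘ₗ f ∘ₗ e.symm.toLinearMap)
  refine ⟨a, fun x => e.injective ?_⟩
  simpa using ha (e x)

variable (A) in
-- Evaluation at `1` identifies the dual of `A` with `E`, so a functional on this dual is an
-- endomorphism of `E`, hence a scalar.
theorem isMatlisReflexive_self : IsMatlisReflexive A A := by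
  refine .of_exists fun φ => ?_
  obtain ⟨a, ha⟩ := exists_smul_of_matlisInjective_end
    (φ ∘ₗ (LinearMap.ringLmapEquivSelf A A (matlisInjective A)).symm.toLinearMap)
  refine ⟨a, fun f => ?_⟩
  have := ha (LinearMap.ringLmapEquivSelf A A (matlisInjective A) f)
  simp only [LinearMap.comp_apply, LinearEquiv.coe_coe, LinearEquiv.symm_apply_apply] at this
  rw [this, LinearMap.ringLmapEquivSelf_apply, ← map_smul, smul_eq_mul, mul_one]

variable (A) in
-- Functionals on `E` are multiples of the identity, so `φ` is evaluation at `φ id`.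
theorem isMatlisReflexive_matlisInjective : IsMatlisReflexive A (matlisInjective A) := by
  refine .of_exists fun φ => ⟨φ LinearMap.id, fun f => ?_⟩
  obtain ⟨a, ha⟩ := exists_smul_of_matlisInjective_end f
  have : f = a • LinearMap.id := LinearMap.ext ha
  rw [this, map_smul]
  rfl

variable (A) in
theorem isMatlisReflexive_fracQuotient : IsMatlisReflexive A (FracQuotient A) :=
  (isMatlisReflexive_matlisInjective A).of_linearEquiv
    (nonempty_matlisInjective_equiv_fracQuotient A).some

variable (A) in
theorem isMatlisReflexive_fractionRing : IsMatlisReflexive A (FractionRing A) := by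
  refine .of_exact (i := Algebra.linearMap A (FractionRing A)) (isMatlisReflexive_self A)
    (isMatlisReflexive_fracQuotient A)
    (Submodule.mkQ_surjective _) fun x => ?_
  rw [Submodule.mkQ_apply, Submodule.Quotient.mk_eq_zero]
  rfl

theorem IsMatlisReflexive.of_finite [Module.Finite A M] : IsMatlisReflexive A M := by
  obtain ⟨n, f, hf⟩ := Module.Finite.exists_fin' A M
  exact ((isMatlisReflexive_self A).pi n).of_surjective hf

end Complete

end MatlisReflexive

/-! ### Finiteness conditions and reflexivity -/

section Finiteness

open TensorProduct IsLocalRing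

variable {A : Type u} [CommRing A] [IsDomain A] [IsDiscreteValuationRing A]
variable {L M N : Type u} [AddCommGroup L] [Module A L] [AddCommGroup M] [Module A M]
  [AddCommGroup N] [Module A N]

/-- Infinite direct sums of nonzero modules are not reflexive. -/
theorem IsMatlisReflexive.finite_of_finsupp {I : Type u} [Nontrivial M]
    (h : IsMatlisReflexive A (I →₀ M)) : Finite I := by
  classical
  by_contra hI
  rw [not_finite_iff_infinite] at hI
  obtain ⟨c, hc⟩ := exists_ne (0 : M)
  obtain ⟨d, hd⟩ := exists_matlisDual_ne_zero (A := A) hc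
  let s : MatlisDual A (I →₀ M) := Finsupp.lsum A fun _ => d
  -- Functionals that are nonzero on finitely many summands only. The functional `s` is not among
  -- them, so some `φ` kills `S` but not `s`. If `φ` were evaluation at `m`, all coordinates of `m`
  -- would vanish, because functionals of one coordinate lie in `S`.
  let S : Submodule A (MatlisDual A (I →₀ M)) :=
    { carrier := {f | {i | f ∘ₗ Finsupp.lsingle i ≠ 0}.Finite}
      zero_mem' := by simp
      add_mem' := fun {f g} hf hg => (hf.union hg).subset fun i hi => by
        by_contra h
        simp only [Set.mem_union, Set.mem_ofPred_eq, not_or, not_not] at h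
        exact hi (by rw [LinearMap.add_comp, h.1, h.2, add_zero])
      smul_mem' := fun a f hf => Set.Finite.subset hf fun i hi h => hi (by
        rw [LinearMap.smul_comp, h, smul_zero]) }
  have hs : s ∉ S := fun h => by
    refine Set.infinite_univ (α := I) (Set.Finite.subset h fun i _ h0 => hd ?_)
    have := LinearMap.congr_fun h0 c
    simpa [s] using this
  obtain ⟨φ, hφ, hφs⟩ := exists_matlisDual_of_notMem (A := A) hs
  obtain ⟨m, hm⟩ := h.exists_eval φ
  have hm0 : m = 0 := Finsupp.ext fun i => eq_zero_of_matlisDual (A := A) fun f => by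
    have h1 := hm (f ∘ₗ Finsupp.lapply i)
    rw [hφ _ (Set.Finite.subset (Set.finite_singleton i) fun j hj => by
      by_contra hji
      refine hj (LinearMap.ext fun x => ?_)
      simp [Finsupp.single_eq_of_ne (Ne.symm hji)])] at h1
    exact h1.symm
  exact hφs (by rw [hm, hm0, map_zero])

/-- An artinian module embeds into a finite power of `K ⧸ A`. -/
theorem exists_embedding_of_isArtinian [IsArtinian A M] :
    ∃ (n : ℕ) (f : M →ₗ[A] (Fin n → FracQuotient A)), Function.Injective f := by
  -- Take a minimal kernel among the maps to finite powers. If it is nonzero, a further coordinate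
  -- that does not kill some element of it makes it strictly smaller.
  obtain ⟨S, ⟨n, f, rfl⟩, hS⟩ := IsArtinian.set_has_minimal
    {S : Submodule A M | ∃ (n : ℕ) (f : M →ₗ[A] (Fin n → FracQuotient A)), LinearMap.ker f = S}
    ⟨_, 0, 0, rfl⟩
  refine ⟨n, f, LinearMap.ker_eq_bot.1 ?_⟩
  by_contra hne
  obtain ⟨x, hx, hx0⟩ := Submodule.exists_mem_ne_zero_of_ne_bot hne
  obtain ⟨g, hg⟩ := exists_fracQuotient_ne_zero (A := A) hx0
  refine hS _ ⟨n + 1, (Fin.consLinearEquiv A fun _ => FracQuotient A).toLinearMap ∘ₗ g.prod f, rfl⟩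
    ?_
  rw [LinearEquiv.ker_comp, LinearMap.ker_prod]
  exact lt_of_le_of_ne inf_le_right fun h => hg (by
    rw [← h] at hx
    exact hx.1)

theorem exists_pow_smul_eq_zero {π : A} (hπ : Irreducible π) {a : A} (ha : a ≠ 0) {x : M}
    (hx : a • x = 0) : ∃ n, π ^ n • x = 0 := by
  obtain ⟨n, u, rfl⟩ := IsDiscreteValuationRing.eq_unit_mul_pow_irreducible ha hπ
  refine ⟨n, ?_⟩
  rwa [mul_smul, u.isUnit.smul_eq_zero] at hx

/-- A nonzero torsion element has a nonzero multiple annihilated by `π`. -/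
theorem exists_smul_ne_zero_of_torsion {π : A} (hπ : Irreducible π) {a : A} (ha : a ≠ 0) {x : M}
    (hx : a • x = 0) (hx0 : x ≠ 0) : ∃ n, π ^ n • x ≠ 0 ∧ π • π ^ n • x = 0 := by
  classical
  have h := exists_pow_smul_eq_zero hπ ha hx
  have hn : Nat.find h ≠ 0 := fun h0 => hx0 (by simpa [h0] using Nat.find_spec h)
  refine ⟨Nat.find h - 1, Nat.find_min h (by omega), ?_⟩
  rw [smul_smul, ← pow_succ', Nat.sub_add_cancel (by omega)]
  exact Nat.find_spec h

/-- Such a module is a vector space over the residue field, and a basis of it must be finite since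
infinite direct sums are not reflexive. -/
theorem IsMatlisReflexive.isArtinian_of_smul_eq_zero {π : A} (hπ : Irreducible π)
    (hM : IsMatlisReflexive A M) (h : ∀ x : M, π • x = 0) : IsArtinian A M := by
  have ht : Module.IsTorsionBySet A M (maximalIdeal A : Set A) := fun x a => by
    obtain ⟨b, hb⟩ := Ideal.mem_span_singleton.1 (hπ.maximalIdeal_eq.le a.2)
    change (a : A) • x = 0
    rw [hb, mul_comm, mul_smul, h, smul_zero]
  let := Ideal.Quotient.field (maximalIdeal A)
  let : Module (A ⧸ maximalIdeal A) M := ht.module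
  have : IsScalarTower A (A ⧸ maximalIdeal A) M := ht.isScalarTower
  let e := (Module.Basis.ofVectorSpace (A ⧸ maximalIdeal A) M).repr.restrictScalars A
  have := (hM.of_linearEquiv e).finite_of_finsupp
  have : IsArtinian A (A ⧸ maximalIdeal A) := by
    have : IsSimpleModule A (A ⧸ maximalIdeal A) :=
      isSimpleModule_iff_isCoatom.2 (Ideal.isMaximal_def.1 inferInstance)
    infer_instance
  let e' := e.trans (Finsupp.linearEquivFunOnFinite A (A ⧸ maximalIdeal A) _)
  exact isArtinian_of_linearEquiv e'.symm

/-- A torsion module whose socle is artinian embeds into a finite power of `K ⧸ A`. -/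
theorem exists_embedding_of_socle {π : A} (hπ : Irreducible π)
    (hM : ∀ x : M, ∃ a : A, a ≠ 0 ∧ a • x = 0)
    (h : IsArtinian A (LinearMap.ker (LinearMap.lsmul A M π))) :
    ∃ (n : ℕ) (f : M →ₗ[A] (Fin n → FracQuotient A)), Function.Injective f := by
  obtain ⟨n, f, hf⟩ := exists_embedding_of_isArtinian (A := A)
    (M := LinearMap.ker (LinearMap.lsmul A M π))
  obtain ⟨g, hg⟩ := (injective_fracQuotient A).of_pi.exists_extend_of_injective
    (LinearMap.ker (LinearMap.lsmul A M π)).subtype Subtype.val_injective f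
  refine ⟨n, g, (injective_iff_map_eq_zero _).2 fun x hx => ?_⟩
  by_contra hx0
  obtain ⟨a, ha, hax⟩ := hM x
  -- The socle is essential in a torsion module, so a nonzero kernel of `g` would meet it; there `g`
  -- agrees with the injective map `f`.
  obtain ⟨k, hk, hk'⟩ := exists_smul_ne_zero_of_torsion hπ ha hax hx0
  have h1 := LinearMap.congr_fun hg ⟨π ^ k • x, hk'⟩
  rw [LinearMap.comp_apply, Submodule.subtype_apply, map_smul, hx, smul_zero] at h1
  exact hk (congrArg Subtype.val (hf (h1.symm.trans (map_zero f).symm)))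

theorem IsMatlisReflexive.exists_embedding_of_torsion (hM : IsMatlisReflexive A M)
    (h : ∀ x : M, ∃ a : A, a ≠ 0 ∧ a • x = 0) :
    ∃ (n : ℕ) (f : M →ₗ[A] (Fin n → FracQuotient A)), Function.Injective f := by
  obtain ⟨π, hπ⟩ := IsDiscreteValuationRing.exists_irreducible A
  refine exists_embedding_of_socle hπ h ?_
  exact (hM.of_injective (i := Submodule.subtype _)
    Subtype.val_injective).isArtinian_of_smul_eq_zero hπ fun x => Subtype.ext x.2

/-- The chain `πⁿ Ax` stabilizes, so `πⁿ x = π^(n+1) b x` for some `b`. Then `πⁿ (1 - π b)` kills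
`x`, and it is nonzero because `π` is not a unit. -/
theorem torsion_of_isArtinian [IsArtinian A M] (x : M) : ∃ a : A, a ≠ 0 ∧ a • x = 0 := by
  obtain ⟨π, hπ⟩ := IsDiscreteValuationRing.exists_irreducible A
  obtain ⟨n, ⟨y, hy'⟩, hy⟩ := IsArtinian.exists_pow_succ_smul_dvd π
    (⟨x, Submodule.mem_span_singleton_self x⟩ : Submodule.span A {x})
  obtain ⟨b, rfl⟩ := Submodule.mem_span_singleton.1 hy'
  refine ⟨π ^ n * (1 - π * b), mul_ne_zero (pow_ne_zero _ hπ.ne_zero) fun h => ?_, ?_⟩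
  · exact hπ.not_isUnit (.of_mul_eq_one b (sub_eq_zero.1 h).symm)
  · have h1 : π ^ (n + 1) • b • x = π ^ n • x := congrArg Subtype.val hy
    rw [mul_sub, mul_one, sub_smul, ← h1, smul_smul, sub_eq_zero, pow_succ, mul_assoc]

/-- The functionals vanishing on a submodule. -/
def matlisAnnihilator (S : Submodule A M) : Submodule A (MatlisDual A M) where
  carrier := {f | ∀ x ∈ S, f x = 0}
  zero_mem' := fun x _ => rfl
  add_mem' := fun hf hg x hx => by rw [LinearMap.add_apply, hf x hx, hg x hx, add_zero]
  smul_mem' := fun a f hf x hx => by rw [LinearMap.smul_apply, hf x hx, smul_zero]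

/-- Functionals separate a submodule from the elements outside it. A chain condition on the dual
thereby becomes the opposite chain condition on `M`. -/
theorem matlisAnnihilator_strictAnti :
    StrictAnti (matlisAnnihilator : Submodule A M → Submodule A (MatlisDual A M)) := fun S T h => by
  obtain ⟨x, hx, hxS⟩ := SetLike.exists_of_lt h
  obtain ⟨f, hf, hfx⟩ := exists_matlisDual_of_notMem (A := A) hxS
  exact lt_of_le_not_ge (fun g hg y hy => hg y (h.le hy)) fun hle => hfx (hle hf x hx)

theorem isArtinian_of_isNoetherian_matlisDual [IsNoetherian A (MatlisDual A M)] :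
    IsArtinian A M :=
  matlisAnnihilator_strictAnti.wellFoundedLT

theorem isNoetherian_of_isArtinian_matlisDual [IsArtinian A (MatlisDual A M)] :
    IsNoetherian A M :=
  isNoetherian_iff'.2 matlisAnnihilator_strictAnti.wellFoundedGT

/-- A noetherian module has no nonzero divisible submodules. -/
theorem eq_zero_of_fractionRing_to_finite [IsNoetherian A M] (f : FractionRing A →ₗ[A] M) :
    f = 0 := by
  obtain ⟨π, hπ⟩ := IsDiscreteValuationRing.exists_irreducible A
  rw [← LinearMap.range_eq_bot]
  refine Submodule.eq_bot_of_le_smul_of_le_jacobson_bot (maximalIdeal A) _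
    (IsNoetherian.noetherian _) ?_ (maximalIdeal_le_jacobson ⊥)
  rintro _ ⟨x, rfl⟩
  obtain ⟨y, rfl⟩ := smul_surjective_fractionRing π hπ.ne_zero x
  rw [map_smul]
  exact Submodule.smul_mem_smul ((mem_maximalIdeal π).2 hπ.not_isUnit) ⟨y, rfl⟩

instance isLocalizedModule_mk_one :
    IsLocalizedModule (nonZeroDivisors A) (TensorProduct.mk A (FractionRing A) M 1) :=
  (isLocalizedModule_iff_isBaseChange (nonZeroDivisors A) (FractionRing A) _).2
    (TensorProduct.isBaseChange A M (FractionRing A))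

theorem one_tmul_eq_zero {x : M} :
    (1 : FractionRing A) ⊗ₜ[A] x = 0 ↔ ∃ a : A, a ≠ 0 ∧ a • x = 0 := by
  refine (IsLocalizedModule.eq_zero_iff (nonZeroDivisors A)
    (TensorProduct.mk A (FractionRing A) M 1)).trans ?_
  exact ⟨fun ⟨c, hc⟩ => ⟨c, nonZeroDivisors.ne_zero c.2, hc⟩,
    fun ⟨a, ha, hax⟩ => ⟨⟨a, mem_nonZeroDivisors_of_ne_zero ha⟩, hax⟩⟩

theorem subsingleton_fractionRing_tensor_iff :
    Subsingleton (FractionRing A ⊗[A] M) ↔ ∀ x : M, ∃ a : A, a ≠ 0 ∧ a • x = 0 := by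
  constructor
  · exact fun _ x => one_tmul_eq_zero.1 (Subsingleton.elim _ _)
  · intro h
    refine subsingleton_of_forall_eq 0 fun z => ?_
    induction z with
    | zero => rfl
    | add z w hz hw => rw [hz, hw, add_zero]
    | tmul c x => rw [show c ⊗ₜ[A] x = c • (1 ⊗ₜ[A] x) by rw [smul_tmul', smul_eq_mul, mul_one],
        one_tmul_eq_zero.2 (h x), smul_zero]

/-- A reflexive module has a finite free submodule with torsion quotient. -/
theorem IsMatlisReflexive.exists_finite_torsion (hM : IsMatlisReflexive A M) :
    ∃ (n : ℕ) (i : (Fin n → A) →ₗ[A] M), Function.Injective i ∧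
      ∀ x : M, ∃ a : A, a ≠ 0 ∧ a • x ∈ LinearMap.range i := by
  -- The free submodule on a maximal independent set `s` is reflexive as a submodule of `M`, which
  -- forces `s` to be finite. Maximality makes the quotient torsion.
  obtain ⟨s, hs, hmax⟩ := exists_maximal_linearIndepOn A (id : M → M)
  have : Finite s := ((hM.of_injective (i := Finsupp.linearCombination A fun x : s => (x : M))
    hs)).finite_of_finsupp
  obtain ⟨n, ⟨e⟩⟩ := Finite.exists_equiv_fin s
  let j : (Fin n → A) ≃ₗ[A] (s →₀ A) :=
    (LinearEquiv.funCongrLeft A A e).trans (Finsupp.linearEquivFunOnFinite A A s).symm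
  have hr : LinearMap.range (Finsupp.linearCombination A (fun x : s => (x : M)) ∘ₗ j.toLinearMap) =
      Submodule.span A s := by
    rw [LinearMap.range_comp, LinearEquiv.range, Submodule.map_top, Finsupp.range_linearCombination,
      Subtype.range_coe]
  refine ⟨n, Finsupp.linearCombination A (fun x : s => (x : M)) ∘ₗ j.toLinearMap,
    (show Function.Injective (Finsupp.linearCombination A fun x : s => (x : M)) from hs).comp
      j.injective, fun x => ?_⟩
  rw [hr]
  by_cases hx : x ∈ s
  · exact ⟨1, one_ne_zero, Submodule.smul_mem _ _ (Submodule.subset_span hx)⟩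
  · simpa using hmax x hx

/-! ### Chain conditions, injective cogenerator and projective generator over a complete ring -/

section Complete

variable [IsAdicComplete (maximalIdeal A) A]

variable (A) in
-- Its dual is cyclic, since endomorphisms of `K ⧸ A` are scalars, and so it is noetherian.
theorem isArtinian_fracQuotient : IsArtinian A (FracQuotient A) := by
  obtain ⟨e⟩ := nonempty_matlisInjective_equiv_fracQuotient A
  have : Module.Finite A (MatlisDual A (FracQuotient A)) := by
    refine .of_surjective (LinearMap.toSpanSingleton A _ e.symm.toLinearMap) fun f => ?_
    obtain ⟨a, ha⟩ := exists_smul_of_fracQuotient_end (e.toLinearMap ∘ₗ f)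
    refine ⟨a, LinearMap.ext fun x => e.injective ?_⟩
    simpa using (ha x).symm
  exact isArtinian_of_isNoetherian_matlisDual

theorem isArtinian_of_embedding {n : ℕ} (f : M →ₗ[A] (Fin n → FracQuotient A))
    (hf : Function.Injective f) : IsArtinian A M := by
  have := isArtinian_fracQuotient A
  exact isArtinian_of_injective f hf

theorem IsMatlisReflexive.of_isArtinian [IsArtinian A M] : IsMatlisReflexive A M := by
  obtain ⟨n, f, hf⟩ := exists_embedding_of_isArtinian (A := A) (M := M)
  exact ((isMatlisReflexive_fracQuotient A).pi n).of_injective hf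

theorem IsMatlisReflexive.isArtinian_of_torsion (hM : IsMatlisReflexive A M)
    (h : ∀ x : M, ∃ a : A, a ≠ 0 ∧ a • x = 0) : IsArtinian A M := by
  obtain ⟨n, f, hf⟩ := hM.exists_embedding_of_torsion h
  exact isArtinian_of_embedding f hf

/-- The dual of `K ⊗ M^∨` is `Hom(K, M^∨∨)`, that is `Hom(K, M) = 0`. So `K ⊗ M^∨` vanishes, `M^∨`
is torsion and reflexive, thus artinian, and `M` is noetherian. -/
theorem IsMatlisReflexive.isNoetherian_of_hom_eq_zero (hM : IsMatlisReflexive A M)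
    (h : ∀ f : FractionRing A →ₗ[A] M, f = 0) : IsNoetherian A M := by
  have : Subsingleton (FractionRing A ⊗[A] MatlisDual A M) := by
    refine subsingleton_of_forall_eq 0 fun z => eq_zero_of_matlisDual (A := A) fun φ => ?_
    let e := LinearEquiv.ofBijective _ hM
    have h1 : TensorProduct.curry φ = 0 := by
      have h2 := h (e.symm.toLinearMap ∘ₗ TensorProduct.curry φ)
      refine LinearMap.ext fun x => e.symm.injective ?_
      rw [LinearMap.zero_apply, map_zero]
      exact LinearMap.congr_fun h2 x
    have h3 : φ = 0 := TensorProduct.ext h1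
    rw [h3, LinearMap.zero_apply]
  have := hM.matlisDual.isArtinian_of_torsion (subsingleton_fractionRing_tensor_iff.1 this)
  exact isNoetherian_of_isArtinian_matlisDual

/-- This determines the kernel of the localization functor: vanishing of the tensor product is the
artinian half of finite length, vanishing of `Hom` the noetherian half. -/
theorem IsMatlisReflexive.isFiniteLength_iff (hM : IsMatlisReflexive A M) :
    IsFiniteLength A M ↔
      Subsingleton (FractionRing A ⊗[A] M) ∧ ∀ f : FractionRing A →ₗ[A] M, f = 0 := by
  rw [isFiniteLength_iff_isNoetherian_isArtinian, subsingleton_fractionRing_tensor_iff]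
  exact ⟨fun ⟨_, _⟩ => ⟨torsion_of_isArtinian, eq_zero_of_fractionRing_to_finite⟩,
    fun h => ⟨hM.isNoetherian_of_hom_eq_zero h.2, hM.isArtinian_of_torsion h.1⟩⟩

theorem IsMatlisReflexive.exists_isArtinian_quotient (hM : IsMatlisReflexive A M) :
    ∃ (n : ℕ) (i : (Fin n → A) →ₗ[A] M), Function.Injective i ∧
      IsArtinian A (M ⧸ LinearMap.range i) := by
  obtain ⟨n, i, hi, h⟩ := hM.exists_finite_torsion
  refine ⟨n, i, hi, (hM.of_surjective (Submodule.mkQ_surjective _)).isArtinian_of_torsion ?_⟩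
  intro x
  obtain ⟨x, rfl⟩ := Submodule.mkQ_surjective _ x
  obtain ⟨a, ha, hax⟩ := h x
  exact ⟨a, ha, by rwa [← map_smul, Submodule.mkQ_apply, Submodule.Quotient.mk_eq_zero]⟩

theorem isMatlisReflexive_iff :
    IsMatlisReflexive A M ↔ ∃ U : Submodule A M, IsNoetherian A U ∧ IsArtinian A (M ⧸ U) := by
  constructor
  · intro hM
    obtain ⟨n, i, -, hq⟩ := hM.exists_isArtinian_quotient
    exact ⟨LinearMap.range i, inferInstance, hq⟩
  · rintro ⟨U, hU, hq⟩
    exact .of_exact (i := U.subtype) .of_finite .of_isArtinian U.mkQ_surjective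
      (LinearMap.exact_subtype_mkQ U)

/-- The injective cogenerator `K ⊕ K ⧸ A` of the category of reflexive modules. -/
theorem IsMatlisReflexive.exists_embedding (hM : IsMatlisReflexive A M) :
    ∃ (n : ℕ) (f : M →ₗ[A] (Fin n → FractionRing A × FracQuotient A)), Function.Injective f := by
  obtain ⟨r, i, hi, _⟩ := hM.exists_isArtinian_quotient
  obtain ⟨m, f, hf⟩ := exists_embedding_of_isArtinian (A := A) (M := M ⧸ LinearMap.range i)
  let j : (Fin r → A) →ₗ[A] (Fin r → FractionRing A) := (Algebra.linearMap A _).compLeft _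
  have hj : Function.Injective j := (IsFractionRing.injective A (FractionRing A)).comp_left
  obtain ⟨g, hg⟩ := (injective_fractionRing A).of_pi.exists_extend_of_injective i hi j
  let c : M →ₗ[A] (Fin (r + m) → FractionRing A × FracQuotient A) := LinearMap.pi
    (Fin.addCases
      (fun a => LinearMap.inl A _ _ ∘ₗ LinearMap.proj a ∘ₗ g)
      (fun b => LinearMap.inr A _ _ ∘ₗ LinearMap.proj b ∘ₗ f ∘ₗ Submodule.mkQ _))
  refine ⟨r + m, c, (injective_iff_map_eq_zero _).2 fun x hx => ?_⟩
  have h1 : g x = 0 := funext fun a => by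
    have := congrFun hx (Fin.castAdd m a)
    simpa [c] using this
  have h2 : f (Submodule.mkQ _ x) = 0 := funext fun b => by
    have := congrFun hx (Fin.natAdd r b)
    simpa [c] using this
  -- An element killed by `f` lies in the free submodule, where `g` restricts to the embedding `j`
  -- into `Kʳ`.
  have h3 := hf (h2.trans (map_zero f).symm)
  rw [Submodule.mkQ_apply, Submodule.Quotient.mk_eq_zero] at h3
  obtain ⟨y, rfl⟩ := h3
  have h4 : j y = 0 := by rw [← hg]; exact h1
  rw [hj (h4.trans (map_zero j).symm), map_zero]

/-- The dual of `K ⧸ A` consists of scalars. A map `K → K ⧸ A` lifts to `K → K`, because `K` is flat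
and reflexive, and the lift is multiplication by its value at `1`. -/
theorem exists_surjective_matlisDual :
    ∃ δ : (A × FractionRing A) →ₗ[A] MatlisDual A (FractionRing A × FracQuotient A),
      Function.Surjective δ := by
  obtain ⟨e⟩ := nonempty_matlisInjective_equiv_fracQuotient A
  let δ₁ : A →ₗ[A] MatlisDual A (FractionRing A × FracQuotient A) :=
    LinearMap.toSpanSingleton A _ (e.symm.toLinearMap ∘ₗ LinearMap.snd A _ _)
  let δ₂ : FractionRing A →ₗ[A] MatlisDual A (FractionRing A × FracQuotient A) :=
    (LinearMap.mul A (FractionRing A)).compr₂ (e.symm.toLinearMap ∘ₗ fracClass) |>.compl₂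
      (LinearMap.fst A (FractionRing A) (FracQuotient A))
  refine ⟨δ₁.coprod δ₂, fun f => ?_⟩
  obtain ⟨a, ha⟩ := exists_smul_of_fracQuotient_end (e.toLinearMap ∘ₗ f ∘ₗ LinearMap.inr A _ _)
  obtain ⟨g, hg⟩ := (isMatlisReflexive_fractionRing A).exists_lift_of_flat
    (Submodule.mkQ_surjective _ : Function.Surjective (fracClass (A := A)))
    (e.toLinearMap ∘ₗ f ∘ₗ LinearMap.inl A _ _)
  refine ⟨(a, g 1), LinearMap.ext fun ⟨q, x⟩ => e.injective ?_⟩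
  have hgq : g q = q * g 1 := by
    have := IsLocalization.linearMap_compatibleSMul (nonZeroDivisors A) (FractionRing A)
      (FractionRing A) (FractionRing A)
    rw [← smul_eq_mul q (g 1), ← LinearMap.map_smul_of_tower g, smul_eq_mul, mul_one]
  have h1 := LinearMap.congr_fun hg q
  have h2 := ha x
  simp only [LinearMap.comp_apply, LinearEquiv.coe_coe, LinearMap.inl_apply,
    LinearMap.inr_apply] at h1 h2
  have h3 : f (q, x) = f (q, 0) + f (0, x) := by rw [← map_add]; simp
  rw [h3, map_add, ← h1, h2, hgq, mul_comm q, add_comm]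
  simp [δ₁, δ₂]

/-- The projective generator `A ⊕ K` of the category of reflexive modules. -/
theorem IsMatlisReflexive.exists_surjective (hM : IsMatlisReflexive A M) :
    ∃ (n : ℕ) (f : (Fin n → A × FractionRing A) →ₗ[A] M), Function.Surjective f := by
  -- Dualizing an embedding of `M^∨` turns it into a surjection onto the bidual, which is `M`.
  obtain ⟨n, f, hf⟩ := hM.matlisDual.exists_embedding
  obtain ⟨δ, hδ⟩ := exists_surjective_matlisDual (A := A)
  let e := LinearEquiv.ofBijective _ hM
  let Δ : (Fin n → A × FractionRing A) →ₗ[A]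
      MatlisDual A (Fin n → FractionRing A × FracQuotient A) :=
    (LinearMap.lsum A (fun _ => FractionRing A × FracQuotient A) A).toLinearMap ∘ₗ δ.compLeft _
  have hΔ : Function.Surjective Δ :=
    (LinearEquiv.surjective (LinearMap.lsum A (fun _ => FractionRing A × FracQuotient A) A)).comp
      hδ.comp_left
  exact ⟨n, e.symm.toLinearMap ∘ₗ matlisDualMap f ∘ₗ Δ,
    e.symm.surjective.comp ((matlisDualMap_surjective hf).comp hΔ)⟩

end Complete

end Finiteness

/-! ### Indecomposable modules over a complete discrete valuation ring -/

section Indecomposable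

open TensorProduct IsLocalRing

/-! ### Retracts, uniserial modules and heights -/

section General

variable {R : Type u} [CommRing R]

/-- A nonzero retract of an indecomposable module is the whole module. -/
theorem CategoryTheory.Indecomposable.nonempty_iso_of_retract {M N : ModuleCat.{u} R}
    (hM : Indecomposable M) (i : N →ₗ[R] M) (r : M →ₗ[R] N) (hri : r ∘ₗ i = LinearMap.id)
    [Nontrivial N] : Nonempty (M ≅ N) := by
  let e := lequivProdOfRightSplitExact (j := (LinearMap.ker r).subtype) Subtype.val_injective
    (Submodule.range_subtype _) hri
  let e' : M ≅ ModuleCat.of R (LinearMap.ker r) ⊞ N :=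
    e.symm.toModuleIso.trans (ModuleCat.biprodIsoProd (ModuleCat.of R (LinearMap.ker r)) N).symm
  rcases hM.2 _ _ e' with h | h
  · have h1 : Subsingleton (LinearMap.ker r) := ModuleCat.isZero_iff_subsingleton.1 h
    have h2 : Function.Injective r := LinearMap.ker_eq_bot.1 (Submodule.subsingleton_iff_eq_bot.1 h1)
    have h3 : Function.Surjective r := fun x => ⟨i x, LinearMap.congr_fun hri x⟩
    exact ⟨(LinearEquiv.ofBijective r ⟨h2, h3⟩).toModuleIso⟩
  · exact absurd (ModuleCat.isZero_iff_subsingleton.1 h) (not_subsingleton N)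

/-- The submodules of `M` are totally ordered. -/
def IsUniserial (R M : Type*) [CommRing R] [AddCommGroup M] [Module R M] : Prop :=
  ∀ x y : M, (∃ a : R, x = a • y) ∨ ∃ a : R, y = a • x

theorem IsUniserial.of_surjective {M N : Type*} [AddCommGroup M] [Module R M] [AddCommGroup N]
    [Module R N] (hM : IsUniserial R M) {f : M →ₗ[R] N} (hf : Function.Surjective f) :
    IsUniserial R N := fun x y => by
  obtain ⟨x, rfl⟩ := hf x
  obtain ⟨y, rfl⟩ := hf y
  exact (hM x y).imp (fun ⟨a, ha⟩ => ⟨a, by rw [ha, map_smul]⟩)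
    (fun ⟨a, ha⟩ => ⟨a, by rw [ha, map_smul]⟩)

theorem IsUniserial.indecomposable {M : ModuleCat.{u} R} [Nontrivial M] (hM : IsUniserial R M) :
    Indecomposable M := by
  refine ⟨fun h => not_subsingleton M (ModuleCat.isZero_iff_subsingleton.1 h), fun Y Z e => ?_⟩
  let e' : M ≃ₗ[R] Y × Z := (e.trans (ModuleCat.biprodIsoProd Y Z)).toLinearEquiv
  have h := hM.of_surjective (f := e'.toLinearMap) e'.surjective
  by_contra! hYZ
  rw [ModuleCat.isZero_iff_subsingleton, ModuleCat.isZero_iff_subsingleton,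
    not_subsingleton_iff_nontrivial, not_subsingleton_iff_nontrivial] at hYZ
  obtain ⟨_, _⟩ := hYZ
  obtain ⟨y, hy⟩ := exists_ne (0 : Y)
  obtain ⟨z, hz⟩ := exists_ne (0 : Z)
  rcases h (y, 0) (0, z) with ⟨a, ha⟩ | ⟨a, ha⟩
  · exact hy (by simpa using congrArg Prod.fst ha)
  · exact hz (by simpa using congrArg Prod.snd ha)

/-- If all elements of order `π` have infinite height, then the torsion submodule is divisible. -/
theorem exists_smul_eq_of_height {R M : Type*} [CommRing R] [AddCommGroup M] [Module R M] {π : R}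
    (h : ∀ x : M, π • x = 0 → ∀ n, ∃ y, π ^ n • y = x) (n : ℕ)
    (x : M) (hx : π ^ n • x = 0) : ∃ y, π ^ (n + 1) • y = 0 ∧ π • y = x := by
  induction n generalizing x with
  | zero => exact ⟨0, smul_zero _, by simpa using hx.symm⟩
  | succ n ih =>
    -- Since `πⁿ x` has order dividing `π`, it equals `π^(n+1) z` for some `z`. Then `x - π z` is
    -- killed by `πⁿ`, and induction divides it by `π`.
    obtain ⟨z, hz⟩ := h (π ^ n • x) (by rw [smul_smul, ← pow_succ', hx]) (n + 1)
    obtain ⟨y, -, hy⟩ := ih (x - π • z) (by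
      rw [smul_sub, smul_smul, ← pow_succ, hz, sub_self])
    have h1 : π • (y + z) = x := by rw [smul_add, hy, sub_add_cancel]
    exact ⟨y + z, by rw [pow_succ, mul_smul, h1, hx], h1⟩

end General

variable {A : Type u} [CommRing A] [IsDomain A] [IsDiscreteValuationRing A]

variable (A) in
theorem isUniserial_fractionRing : IsUniserial A (FractionRing A) := fun x y => by
  by_cases hy : y = 0
  · exact .inr ⟨0, by rw [hy, zero_smul]⟩
  by_cases hx : x = 0
  · exact .inl ⟨0, by rw [hx, zero_smul]⟩
  refine (ValuationRing.isInteger_or_isInteger A (x / y)).imp (fun ⟨a, ha⟩ => ⟨a, ?_⟩)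
    (fun ⟨a, ha⟩ => ⟨a, ?_⟩)
  · rw [Algebra.smul_def, ha, div_mul_cancel₀ _ hy]
  · rw [Algebra.smul_def, ha, inv_div, div_mul_cancel₀ _ hx]

variable (A) in
theorem isUniserial_self : IsUniserial A A := fun x y => by
  obtain ⟨c, h | h⟩ := ValuationRing.cond x y
  · exact .inr ⟨c, by rw [← h, mul_comm, smul_eq_mul]⟩
  · exact .inl ⟨c, by rw [← h, mul_comm, smul_eq_mul]⟩

instance nontrivial_cyclic (i : ℕ) (hi : 1 ≤ i) :
    Nontrivial (matlisModule A (.cyclic i hi)) := by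
  have h : maximalIdeal A ^ i ≤ maximalIdeal A := Ideal.pow_le_self (by omega)
  have h' : maximalIdeal A ^ i ≠ ⊤ := fun h1 =>
    Ideal.IsPrime.ne_top' (I := maximalIdeal A) (top_le_iff.1 (h1 ▸ h))
  exact Submodule.Quotient.nontrivial_iff.2 h'

variable (A) in
/-- The injective envelope of the residue field is `K ⧸ A`. -/
noncomputable def envelopeEquiv : matlisModule A .envelope ≃ₗ[A] FracQuotient A :=
  (nonempty_envelope_equiv_fracQuotient A).some

instance nontrivial_fracQuotient : Nontrivial (FracQuotient A) := by
  obtain ⟨π, hπ⟩ := IsDiscreteValuationRing.exists_irreducible A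
  exact ⟨_, _, invPow_one_ne_zero hπ⟩

instance nontrivial_matlisModule (t : MatlisLabel) : Nontrivial (matlisModule A t) := by
  cases t with
  | ring => exact inferInstanceAs (Nontrivial A)
  | envelope => exact (envelopeEquiv A).toEquiv.nontrivial
  | quotientField => exact inferInstanceAs (Nontrivial (FractionRing A))
  | cyclic i hi => infer_instance

theorem indecomposable_matlisModule (t : MatlisLabel) : Indecomposable (matlisModule A t) := by
  refine IsUniserial.indecomposable ?_
  cases t with
  | ring => exact isUniserial_self A
  | envelope =>
    exact (isUniserial_fractionRing A).of_surjective
      (f := (envelopeEquiv A).symm.toLinearMap ∘ₗ fracClass)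
      ((envelopeEquiv A).symm.surjective.comp (Submodule.mkQ_surjective _))
  | quotientField => exact isUniserial_fractionRing A
  | cyclic i hi => exact (isUniserial_self A).of_surjective (Submodule.mkQ_surjective _)

theorem isMatlisReflexive_matlisModule [IsAdicComplete (maximalIdeal A) A] (t : MatlisLabel) :
    IsMatlisReflexive A (matlisModule A t) := by
  cases t with
  | ring => exact isMatlisReflexive_self A
  | envelope => exact (isMatlisReflexive_fracQuotient A).of_linearEquiv (envelopeEquiv A).symm
  | quotientField => exact isMatlisReflexive_fractionRing A
  | cyclic i hi => exact (isMatlisReflexive_self A).of_surjective (Submodule.mkQ_surjective _)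

/-! ### Invariants that separate the modules of the list -/

section Invariants

variable {π : A} (hπ : Irreducible π)
include hπ

/-- Divisibility by `π`, absence of `π`-torsion and, for cyclic modules, the powers of `π` acting as
zero together determine the label. -/
theorem smul_surjective_matlisModule_iff (t : MatlisLabel) :
    (∀ x : matlisModule A t, ∃ y, π • y = x) ↔ t = .envelope ∨ t = .quotientField := by
  cases t with
  | ring =>
    simp only [reduceCtorEq, or_self, iff_false]
    intro h
    obtain ⟨y, hy⟩ := h (1 : A)
    exact hπ.not_isUnit (.of_mul_eq_one y hy)
  | envelope =>
    simp only [reduceCtorEq, or_false, iff_true]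
    intro x
    obtain ⟨y, hy⟩ := smul_surjective_fracQuotient π hπ.ne_zero (envelopeEquiv A x)
    exact ⟨(envelopeEquiv A).symm y, by rw [← map_smul, hy, LinearEquiv.symm_apply_apply]⟩
  | quotientField =>
    simp only [reduceCtorEq, false_or, iff_true]
    exact smul_surjective_fractionRing π hπ.ne_zero
  | cyclic i hi =>
    simp only [reduceCtorEq, or_self, iff_false]
    intro h
    have h0 : ∀ x : A ⧸ maximalIdeal A ^ i, x = 0 := fun x => by
      obtain ⟨y, rfl⟩ := exists_smul_eq_of_irreducible hπ h (π ^ i) (pow_ne_zero _ hπ.ne_zero) x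
      obtain ⟨y, rfl⟩ := Submodule.mkQ_surjective _ y
      change Submodule.mkQ _ (π ^ i • y) = 0
      rw [Submodule.mkQ_apply, Submodule.Quotient.mk_eq_zero, mem_maximalIdeal_pow_iff hπ]
      exact dvd_mul_right _ _
    obtain ⟨x, hx⟩ := exists_ne (0 : matlisModule A (.cyclic i hi))
    exact hx (h0 x)

theorem exists_smul_eq_zero_matlisModule_iff (t : MatlisLabel) :
    (∀ x : matlisModule A t, π • x = 0 → x = 0) ↔ t = .ring ∨ t = .quotientField := by
  cases t with
  | ring =>
    simp only [reduceCtorEq, or_false, iff_true]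
    exact fun x hx => (mul_eq_zero.1 hx).resolve_left hπ.ne_zero
  | envelope =>
    simp only [reduceCtorEq, or_self, iff_false]
    intro h
    have h1 := h ((envelopeEquiv A).symm (invPow π 1)) (by
      rw [← map_smul, (smul_invPow_eq_zero hπ).2 (by rw [pow_one]), map_zero])
    exact invPow_one_ne_zero hπ (by simpa using h1)
  | quotientField =>
    simp only [reduceCtorEq, false_or, iff_true]
    intro (x : FractionRing A) hx
    have : algebraMap A (FractionRing A) π * x = 0 := by rw [← Algebra.smul_def]; exact hx
    exact (mul_eq_zero.1 this).resolve_left (by simpa using hπ.ne_zero)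
  | cyclic i hi =>
    simp only [reduceCtorEq, or_self, iff_false]
    intro h
    have h1 := h (Submodule.Quotient.mk (π ^ (i - 1)) : A ⧸ maximalIdeal A ^ i) (by
      change Submodule.Quotient.mk (π • π ^ (i - 1)) = _
      refine (Submodule.Quotient.mk_eq_zero _).2 ((mem_maximalIdeal_pow_iff hπ).2 ?_)
      rw [smul_eq_mul, ← pow_succ', Nat.sub_add_cancel hi])
    have h2 := (mem_maximalIdeal_pow_iff hπ).1 ((Submodule.Quotient.mk_eq_zero _).1 h1)
    rw [pow_dvd_pow_iff hπ.ne_zero hπ.not_isUnit] at h2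
    omega

theorem pow_smul_cyclic_iff (i : ℕ) (hi : 1 ≤ i) (n : ℕ) :
    (∀ x : matlisModule A (.cyclic i hi), π ^ n • x = 0) ↔ i ≤ n := by
  rw [← pow_dvd_pow_iff hπ.ne_zero hπ.not_isUnit]
  constructor
  · intro h
    have h1 := h (Submodule.Quotient.mk 1 : A ⧸ maximalIdeal A ^ i)
    have h2 : (Submodule.Quotient.mk (π ^ n • 1) : A ⧸ maximalIdeal A ^ i) = 0 := h1
    rw [Submodule.Quotient.mk_eq_zero, mem_maximalIdeal_pow_iff hπ] at h2
    simpa using h2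
  · intro h (x : A ⧸ maximalIdeal A ^ i)
    obtain ⟨x, rfl⟩ := Submodule.mkQ_surjective _ x
    change Submodule.mkQ _ (π ^ n • x) = 0
    rw [Submodule.mkQ_apply, Submodule.Quotient.mk_eq_zero, mem_maximalIdeal_pow_iff hπ]
    exact h.mul_right _

end Invariants

theorem matlisModule_injective {s t : MatlisLabel} (e : matlisModule A s ≃ₗ[A] matlisModule A t) :
    s = t := by
  obtain ⟨π, hπ⟩ := IsDiscreteValuationRing.exists_irreducible A
  have h1 : (∀ x : matlisModule A s, ∃ y, π • y = x) ↔ ∀ x : matlisModule A t, ∃ y, π • y = x :=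
    ⟨fun h x => by
      obtain ⟨y, hy⟩ := h (e.symm x)
      exact ⟨e y, by rw [← map_smul, hy, LinearEquiv.apply_symm_apply]⟩,
    fun h x => by
      obtain ⟨y, hy⟩ := h (e x)
      exact ⟨e.symm y, by rw [← map_smul, hy, LinearEquiv.symm_apply_apply]⟩⟩
  have h2 : (∀ x : matlisModule A s, π • x = 0 → x = 0) ↔
      ∀ x : matlisModule A t, π • x = 0 → x = 0 :=
    ⟨fun h x hx => e.symm.map_eq_zero_iff.1 (h _ (by rw [← map_smul, hx, map_zero])),
    fun h x hx => e.map_eq_zero_iff.1 (h _ (by rw [← map_smul, hx, map_zero]))⟩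
  have h3 : ∀ n, (∀ x : matlisModule A s, π ^ n • x = 0) ↔ ∀ x : matlisModule A t, π ^ n • x = 0 :=
    fun n => ⟨fun h x => e.symm.map_eq_zero_iff.1 (by rw [map_smul, h]),
      fun h x => e.map_eq_zero_iff.1 (by rw [map_smul, h])⟩
  rw [smul_surjective_matlisModule_iff hπ, smul_surjective_matlisModule_iff hπ] at h1
  rw [exists_smul_eq_zero_matlisModule_iff hπ, exists_smul_eq_zero_matlisModule_iff hπ] at h2
  cases s <;> cases t <;> first | rfl | (exfalso; revert h1 h2; simp; done) | skip
  simp only [pow_smul_cyclic_iff hπ] at h3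
  congr 1
  exact le_antisymm ((h3 _).2 le_rfl) ((h3 _).1 le_rfl)

/-! ### Direct summands and the classification of indecomposable modules -/

section Classification

variable {M : Type u} [AddCommGroup M] [Module A M]

/-- An element of order `π` and finite height generates the socle of a cyclic direct summand. -/
theorem exists_cyclic_retract {π : A} (hπ : Irreducible π) {n : ℕ} {y : M}
    (h : π ^ (n + 1) • y = 0) (hy : ∀ z : M, π ^ (n + 1) • z ≠ π ^ n • y) :
    ∃ (i : (A ⧸ maximalIdeal A ^ (n + 1)) →ₗ[A] M) (r : M →ₗ[A] (A ⧸ maximalIdeal A ^ (n + 1))),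
      r ∘ₗ i = LinearMap.id := by
  let i : (A ⧸ maximalIdeal A ^ (n + 1)) →ₗ[A] M :=
    (maximalIdeal A ^ (n + 1)).liftQ (LinearMap.toSpanSingleton A M y) fun a ha => by
      obtain ⟨b, rfl⟩ := (mem_maximalIdeal_pow_iff hπ).1 ha
      rw [LinearMap.mem_ker, LinearMap.toSpanSingleton_apply, mul_comm, mul_smul, h, smul_zero]
  -- The height condition on `y` says that its order modulo `S = π^(n+1) M` is still `π^(n+1)`. So
  -- `y ↦ π^(-n-1)` defines a map to `K ⧸ A` that extends to `M ⧸ S`. Its values are killed by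
  -- `π^(n+1)`, hence lie in the copy of `A ⧸ 𝔪^(n+1)`.
  let S := LinearMap.range (LinearMap.lsmul A M (π ^ (n + 1)))
  obtain ⟨k, hk⟩ := (injective_fracQuotient A).exists_extend
    (S.mkQ ∘ₗ LinearMap.toSpanSingleton A M y)
    (LinearMap.toSpanSingleton A _ (invPow π (n + 1))) fun a ha => by
      rw [LinearMap.mem_ker, LinearMap.comp_apply, LinearMap.toSpanSingleton_apply,
        Submodule.mkQ_apply, Submodule.Quotient.mk_eq_zero] at ha
      obtain ⟨z, hz⟩ := ha
      rw [LinearMap.mem_ker, LinearMap.toSpanSingleton_apply, smul_invPow_eq_zero hπ]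
      by_cases ha0 : a = 0
      · simp [ha0]
      obtain ⟨m, u, rfl⟩ := IsDiscreteValuationRing.eq_unit_mul_pow_irreducible ha0 hπ
      rw [Units.dvd_mul_left]
      refine pow_dvd_pow π (Nat.succ_le_of_lt ?_)
      by_contra! hmn
      refine hy (π ^ (n - m) • (u⁻¹ : Aˣ) • z) ?_
      have h1 : π ^ (n + 1) • z = ((u : A) * π ^ m) • y := hz
      have h2 : π ^ (n + 1) • (u⁻¹ : Aˣ) • z = π ^ m • y := by
        rw [smul_comm, h1, Units.smul_def, smul_smul, ← mul_assoc, Units.inv_mul, one_mul]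
      rw [smul_comm, h2, smul_smul, ← pow_add, Nat.sub_add_cancel hmn]
  let f := k ∘ₗ S.mkQ
  have hf : ∀ m, f m ∈ LinearMap.range (cyclicToFracQuotient hπ (n + 1)) := fun m => by
    obtain ⟨b, hb⟩ := exists_eq_smul_invPow_of_pow_smul hπ (n := n + 1) (x := f m) (by
      have h1 : S.mkQ (π ^ (n + 1) • m) = 0 := (Submodule.Quotient.mk_eq_zero S).2 ⟨m, rfl⟩
      rw [← map_smul, LinearMap.comp_apply, h1, map_zero])
    exact ⟨Submodule.Quotient.mk b, by rw [hb, cyclicToFracQuotient_mk]⟩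
  let e := LinearEquiv.ofInjective _ (cyclicToFracQuotient_injective hπ (n + 1))
  refine ⟨i, e.symm.toLinearMap ∘ₗ f.codRestrict _ hf, ?_⟩
  refine LinearMap.ext fun x => e.injective (Subtype.ext ?_)
  obtain ⟨a, rfl⟩ := Submodule.mkQ_surjective _ x
  have h1 := LinearMap.congr_fun hk a
  rw [LinearMap.comp_apply, LinearMap.comp_apply, LinearEquiv.coe_coe, LinearEquiv.apply_symm_apply]
  exact h1

/-- In a torsion-free module over a complete discrete valuation ring, an element not divisible
by `π` generates a direct summand. -/
theorem exists_ring_retract [IsAdicComplete (maximalIdeal A) A] {π : A} (hπ : Irreducible π)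
    (h0 : ∀ x : M, π • x = 0 → x = 0) {x : M} (hx : ∀ y, π • y ≠ x) :
    ∃ (i : A →ₗ[A] M) (r : M →ₗ[A] A), r ∘ₗ i = LinearMap.id := by
  have htf : Module.IsTorsionFree A M := by
    refine ⟨fun a ha => (isSMulRegular_iff_right_eq_zero_of_smul).2 fun y hy => ?_⟩
    by_contra hy0
    obtain ⟨n, hn, hn'⟩ := exists_smul_ne_zero_of_torsion hπ ha.ne_zero hy hy0
    exact hn (h0 _ hn')
  -- The map `e ↦ x ⊗ e` does not kill `π⁻¹`: by flatness `M ⧸ πM` embeds into `M ⊗ K ⧸ A`, and `x ∉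
  -- πM`. So it is split injective. Currying a retraction gives a map from `M` to `End(K ⧸ A) ≅ A`
  -- with `x ↦ 1`.
  let j : FracQuotient A →ₗ[A] M ⊗[A] FracQuotient A := TensorProduct.mk A M _ x
  have hj1 : j (invPow π 1) ≠ 0 := by
    intro h
    have h1 := Module.Flat.lTensor_preserves_injective_linearMap (M := M) _
      (cyclicToFracQuotient_injective hπ 1)
    have h2 : x ⊗ₜ[A] (Ideal.Quotient.mk (maximalIdeal A ^ 1) 1) = 0 := by
      refine h1 (Eq.trans ?_ (map_zero _).symm)
      rw [LinearMap.lTensor_tmul]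
      change x ⊗ₜ[A] ((1 : A) • invPow π 1) = 0
      rw [one_smul]
      exact h
    have h3 := congrArg (TensorProduct.tensorQuotEquivQuotSMul M (maximalIdeal A ^ 1)) h2
    rw [TensorProduct.tensorQuotEquivQuotSMul_tmul_mk, map_zero, one_smul,
      Submodule.Quotient.mk_eq_zero, pow_one, hπ.maximalIdeal_eq,
      Submodule.ideal_span_singleton_smul] at h3
    obtain ⟨y, -, hy⟩ := h3
    exact hx y hy
  have hj : Function.Injective j := (injective_iff_map_eq_zero _).2 fun e he => by
    by_contra he0
    obtain ⟨a, ha⟩ := exists_smul_eq_invPow_one hπ he0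
    exact hj1 (by rw [← ha, map_smul, he, smul_zero])
  obtain ⟨r, hr⟩ := (injective_fracQuotient A).exists_extend_of_injective j hj LinearMap.id
  let s : A ≃ₗ[A] (FracQuotient A →ₗ[A] FracQuotient A) :=
    LinearEquiv.ofBijective (LinearMap.lsmul A (FracQuotient A))
      ⟨(injective_iff_map_eq_zero _).2 fun a ha =>
        eq_zero_of_smul_fracQuotient fun y => LinearMap.congr_fun ha y,
      fun f => (exists_smul_of_fracQuotient_end f).imp fun a ha => LinearMap.ext fun y =>
        (ha y).symm⟩
  refine ⟨LinearMap.toSpanSingleton A M x, s.symm.toLinearMap ∘ₗ TensorProduct.curry r,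
    LinearMap.ext_ring (s.injective ?_)⟩
  rw [LinearMap.comp_apply, LinearMap.comp_apply, LinearEquiv.coe_coe, LinearEquiv.apply_symm_apply,
    LinearMap.toSpanSingleton_apply, one_smul]
  refine LinearMap.ext fun y => (LinearMap.congr_fun hr y).trans ?_
  exact (one_smul A y).symm

/-- The assignment `π⁻¹ ↦ x` extends to `K ⧸ A → M` as `M` is injective. The extension is injective
because it does not kill `π⁻¹`, and it splits because `K ⧸ A` is injective. -/
theorem exists_fracQuotient_retract {π : A} (hπ : Irreducible π) (hM : Module.Injective A M)
    {x : M} (hx : π • x = 0) (hx0 : x ≠ 0) :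
    ∃ (i : FracQuotient A →ₗ[A] M) (r : M →ₗ[A] FracQuotient A), r ∘ₗ i = LinearMap.id := by
  obtain ⟨i, hi⟩ := hM.exists_extend (LinearMap.toSpanSingleton A _ (invPow π 1))
    (LinearMap.toSpanSingleton A M x) fun a ha => by
      rw [LinearMap.mem_ker, LinearMap.toSpanSingleton_apply, smul_invPow_eq_zero hπ, pow_one] at ha
      obtain ⟨b, rfl⟩ := ha
      rw [LinearMap.mem_ker, LinearMap.toSpanSingleton_apply, mul_comm, mul_smul, hx, smul_zero]
  have hi1 : i (invPow π 1) = x := by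
    simpa using LinearMap.congr_fun hi 1
  have hinj : Function.Injective i := (injective_iff_map_eq_zero _).2 fun e he => by
    by_contra he0
    obtain ⟨a, ha⟩ := exists_smul_eq_invPow_one hπ he0
    exact hx0 (by rw [← hi1, ← ha, map_smul, he, smul_zero])
  obtain ⟨r, hr⟩ := (injective_fracQuotient A).exists_extend_of_injective i hinj LinearMap.id
  exact ⟨i, r, hr⟩

/-- The map `1 ↦ x` extends from `A` to `K`. The extension is injective since `M` is torsion-free,
and splits since `K` is injective. -/
theorem exists_fractionRing_retract {π : A} (hπ : Irreducible π) (hM : Module.Injective A M)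
    (h0 : ∀ x : M, π • x = 0 → x = 0) [Nontrivial M] :
    ∃ (i : FractionRing A →ₗ[A] M) (r : M →ₗ[A] FractionRing A), r ∘ₗ i = LinearMap.id := by
  obtain ⟨x, hx⟩ := exists_ne (0 : M)
  have hreg : ∀ (a : A) (y : M), a ≠ 0 → a • y = 0 → y = 0 := fun a y ha hy => by
    by_contra hy0
    obtain ⟨n, hn, hn'⟩ := exists_smul_ne_zero_of_torsion hπ ha hy hy0
    exact hn (h0 _ hn')
  obtain ⟨i, hi⟩ := hM.exists_extend_of_injective (Algebra.linearMap A (FractionRing A))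
    (IsFractionRing.injective A (FractionRing A)) (LinearMap.toSpanSingleton A M x)
  have hi' : ∀ a : A, i (algebraMap A _ a) = a • x := fun a => LinearMap.congr_fun hi a
  have hinj : Function.Injective i := (injective_iff_map_eq_zero _).2 fun q hq => by
    obtain ⟨b, c, hc, rfl⟩ := IsFractionRing.div_surjective (A := A) q
    have hc0 : algebraMap A (FractionRing A) c ≠ 0 := by
      simpa using nonZeroDivisors.ne_zero hc
    have h1 : i (algebraMap A _ b) = 0 := by
      rw [← mul_div_cancel₀ (algebraMap A (FractionRing A) b) hc0, ← Algebra.smul_def, map_smul, hq,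
        smul_zero]
    rw [hi'] at h1
    have hb : b = 0 := by
      by_contra hb
      exact hx (hreg b x hb h1)
    rw [hb, map_zero, zero_div]
  obtain ⟨r, hr⟩ := (injective_fractionRing A).exists_extend_of_injective i hinj LinearMap.id
  exact ⟨i, r, hr⟩

/-- Every indecomposable module over a complete discrete valuation ring is in the list. -/
theorem exists_iso_matlisModule [IsAdicComplete (maximalIdeal A) A] {M : ModuleCat.{u} A}
    (hM : Indecomposable M) : ∃ t, Nonempty (M ≅ matlisModule A t) := by
  obtain ⟨π, hπ⟩ := IsDiscreteValuationRing.exists_irreducible A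
  have : Nontrivial M := by
    rw [← not_subsingleton_iff_nontrivial]
    exact fun h => hM.1 (ModuleCat.isZero_iff_subsingleton.2 h)
  -- If all socle elements have infinite height, the torsion is divisible, which leaves `K`, `A` or
  -- `K ⧸ A`. A socle element of finite height yields a cyclic summand.
  by_cases h : ∀ x : M, π • x = 0 → ∀ n, ∃ y, π ^ n • y = x
  · by_cases h0 : ∀ x : M, π • x = 0 → x = 0
    · by_cases hd : ∀ x : M, ∃ y, π • y = x
      · obtain ⟨i, r, hir⟩ := exists_fractionRing_retract hπ (injective_of_smul_surjective hπ hd) h0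
        exact ⟨.quotientField, hM.nonempty_iso_of_retract (N := matlisModule A .quotientField) i r hir⟩
      · push Not at hd
        obtain ⟨x, hx⟩ := hd
        obtain ⟨i, r, hir⟩ := exists_ring_retract hπ h0 hx
        exact ⟨.ring, hM.nonempty_iso_of_retract (N := matlisModule A .ring) i r hir⟩
    · push Not at h0
      obtain ⟨x, hx, hx0⟩ := h0
      let T : Submodule A M := Submodule.torsion' A M (Submonoid.powers π)
      have hT : ∀ x, x ∈ T ↔ ∃ n, π ^ n • x = 0 := fun x => by
        constructor
        · rintro ⟨⟨_, n, rfl⟩, hn⟩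
          exact ⟨n, hn⟩
        · rintro ⟨n, hn⟩
          exact ⟨⟨_, n, rfl⟩, hn⟩
      have hinj : Module.Injective A T := injective_of_smul_surjective hπ fun ⟨x, hx⟩ => by
        obtain ⟨n, hn⟩ := (hT x).1 hx
        obtain ⟨y, hy, rfl⟩ := exists_smul_eq_of_height h n x hn
        exact ⟨⟨y, (hT y).2 ⟨_, hy⟩⟩, rfl⟩
      let x' : T := ⟨x, (hT x).2 ⟨1, by rwa [pow_one]⟩⟩
      obtain ⟨i, r, hir⟩ := exists_fracQuotient_retract hπ hinj (x := x') (Subtype.ext hx)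
        fun h => hx0 (congrArg Subtype.val h)
      obtain ⟨k, hk⟩ := hinj.exists_extend_of_injective T.subtype Subtype.val_injective LinearMap.id
      refine ⟨.envelope, hM.nonempty_iso_of_retract (N := matlisModule A .envelope)
        (T.subtype ∘ₗ i ∘ₗ (envelopeEquiv A).toLinearMap)
        ((envelopeEquiv A).symm.toLinearMap ∘ₗ r ∘ₗ k) (LinearMap.ext fun z => ?_)⟩
      have h1 := LinearMap.congr_fun hk (i (envelopeEquiv A z))
      have h2 := LinearMap.congr_fun hir (envelopeEquiv A z)
      simp only [LinearMap.comp_apply, LinearMap.id_apply, LinearEquiv.coe_coe] at h1 h2 ⊢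
      rw [h1, h2, LinearEquiv.symm_apply_apply]
  · push Not at h
    obtain ⟨x, hx, m, hm⟩ := h
    classical
    -- The least exponent `n + 1` with `x ∉ π^(n+1) M` is positive, so `x = πⁿ y`, and `y` generates
    -- a summand `A ⧸ 𝔪^(n+1)`.
    have hex : ∃ n, ∀ y : M, π ^ n • y ≠ x := ⟨m, hm⟩
    have h0 : Nat.find hex ≠ 0 := fun h0 => Nat.find_spec hex x (by rw [h0, pow_zero, one_smul])
    obtain ⟨n, hn⟩ := Nat.exists_eq_succ_of_ne_zero h0
    have h1 := Nat.find_min hex (m := n) (by omega)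
    push Not at h1
    obtain ⟨y, rfl⟩ := h1
    have h2 := Nat.find_spec hex
    rw [hn] at h2
    obtain ⟨i, r, hir⟩ := exists_cyclic_retract hπ (n := n) (y := y)
      (by rw [pow_succ', mul_smul, hx]) h2
    exact ⟨.cyclic (n + 1) (by omega),
      hM.nonempty_iso_of_retract (N := matlisModule A (.cyclic (n + 1) (by omega))) i r hir⟩

end Classification

/-- The colimit of the modules `A ⧸ 𝔪ⁱ` is the injective envelope of the residue field. -/
theorem nonempty_envelope_equiv_directLimit {π : A} (hπ : Irreducible π) :
    Nonempty (matlisModule A .envelope ≃ₗ[A]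
      Module.DirectLimit (fun i : ℕ => A ⧸ maximalIdeal A ^ i)
        (powTransition ((mem_maximalIdeal π).2 hπ.not_isUnit))) := by
  have hc : ∀ (i j : ℕ) (hij : i ≤ j) (x : A ⧸ maximalIdeal A ^ i),
      cyclicToFracQuotient hπ j (powTransition ((mem_maximalIdeal π).2 hπ.not_isUnit) i j hij x) =
        cyclicToFracQuotient hπ i x := fun i j hij x => by
    obtain ⟨a, rfl⟩ := Submodule.mkQ_surjective _ x
    change (π ^ (j - i) * a) • invPow π j = a • invPow π i
    have h := pow_smul_invPow hπ (j - i) i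
    rw [Nat.sub_add_cancel hij] at h
    rw [mul_comm, mul_smul, h]
  let f := Module.DirectLimit.lift A ℕ (fun i : ℕ => A ⧸ maximalIdeal A ^ i)
    (powTransition ((mem_maximalIdeal π).2 hπ.not_isUnit)) (cyclicToFracQuotient hπ) hc
  have hf : Function.Bijective f := by
    refine ⟨Module.DirectLimit.lift_injective _ _ (cyclicToFracQuotient_injective hπ), fun x => ?_⟩
    obtain ⟨n, b, rfl⟩ := exists_eq_smul_invPow hπ x
    exact ⟨Module.DirectLimit.of A ℕ (fun i : ℕ => A ⧸ maximalIdeal A ^ i) _ n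
      (Submodule.Quotient.mk b), Module.DirectLimit.lift_of _ _ _⟩
  exact ⟨(envelopeEquiv A).trans (LinearEquiv.ofBijective f hf).symm⟩

end Indecomposable

/-! ### The category of Matlis reflexive modules -/

section ReflCategory

open IsLocalRing Limits

theorem mono_reflProp_of_injective {R : Type u} [CommRing R]
    {M N : (reflProp R).FullSubcategory} (f : M ⟶ N)
    (hf : Function.Injective f.hom.hom) : Mono f :=
  (reflProp R).ι.mono_of_mono_map ((ModuleCat.mono_iff_injective _).2 hf)

theorem epi_reflProp_of_surjective {R : Type u} [CommRing R]
    {M N : (reflProp R).FullSubcategory} (f : M ⟶ N)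
    (hf : Function.Surjective f.hom.hom) : Epi f :=
  (reflProp R).ι.epi_of_epi_map ((ModuleCat.epi_iff_surjective _).2 hf)

/-- A projective object of `refl R` with torsion which is the image of a torsion-free reflexive
module vanishes. -/
theorem subsingleton_of_projective {R : Type u} [CommRing R]
    {M : (reflProp R).FullSubcategory} [Projective M] {π : R} {P : Type u}
    [AddCommGroup P] [Module R P] (hP : IsMatlisReflexive R P)
    (hP0 : ∀ x : P, π • x = 0 → x = 0) (f : P →ₗ[R] M.obj) (hf : Function.Surjective f)
    (x : M.obj) (hx : π • x = 0) : x = 0 := by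
  let P' : (reflProp R).FullSubcategory := ⟨ModuleCat.of R P, hP⟩
  let f' : P' ⟶ M := ObjectProperty.homMk (ModuleCat.ofHom f)
  have := epi_reflProp_of_surjective f' hf
  let s := Projective.factorThru (𝟙 M) f'
  have hs : ∀ y : M.obj, f (s.hom.hom y) = y := fun y =>
    congrArg (fun g : M ⟶ M => g.hom.hom y) (Projective.factorThru_comp (𝟙 M) f')
  have h1 : s.hom.hom x = 0 := hP0 _ (by
    rw [← map_smul, hx, map_zero])
  rw [← hs x, h1, map_zero]

variable {A : Type u} [CommRing A] [IsDomain A] [IsDiscreteValuationRing A]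

instance isClosedUnderSubobjects_reflProp : (reflProp A).IsClosedUnderSubobjects where
  prop_of_mono f _ hY :=
    IsMatlisReflexive.of_injective (i := f.hom) hY ((ModuleCat.mono_iff_injective f).1 inferInstance)

instance isClosedUnderQuotients_reflProp : (reflProp A).IsClosedUnderQuotients where
  prop_of_epi f _ hX :=
    IsMatlisReflexive.of_surjective (p := f.hom) hX
      ((ModuleCat.epi_iff_surjective f).1 inferInstance)

instance containsZero_reflProp : (reflProp A).ContainsZero where
  exists_zero := ⟨ModuleCat.of A PUnit.{u + 1}, ModuleCat.isZero_of_subsingleton _,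
    IsMatlisReflexive.of_subsingleton (A := A) (M := PUnit.{u + 1})⟩

instance isClosedUnderBinaryProducts_reflProp : (reflProp A).IsClosedUnderBinaryProducts where
  limitsOfShape_le := by
    rintro X ⟨p⟩
    let e : p.diag ≅ pair (p.diag.obj ⟨.left⟩) (p.diag.obj ⟨.right⟩) := diagramIsoPair p.diag
    have h := IsMatlisReflexive.prod (p.prop_diag_obj ⟨.left⟩) (p.prop_diag_obj ⟨.right⟩)
    let i := (IsLimit.conePointsIsoOfNatIso p.isLimit
      (ModuleCat.binaryProductLimitCone _ _).isLimit e).toLinearEquiv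
    exact h.of_linearEquiv i.symm

instance isClosedUnderFiniteProducts_reflProp : (reflProp A).IsClosedUnderFiniteProducts :=
  .mk'

/-- Kernels and cokernels of maps of reflexive modules are reflexive, so monomorphisms and
epimorphisms in `refl A` are the injective and the surjective maps. -/
instance preservesMonomorphisms_reflProp : (reflProp A).ι.PreservesMonomorphisms :=
  (reflProp A).preservesMonomorphisms_ι_of_isNormalEpiCategory

instance preservesEpimorphisms_reflProp : (reflProp A).ι.PreservesEpimorphisms :=
  (reflProp A).preservesEpimorphisms_ι_of_isNormalMonoCategory

theorem injective_of_mono_reflProp {M N : (reflProp A).FullSubcategory} (f : M ⟶ N) [Mono f] :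
    Function.Injective f.hom.hom :=
  (ModuleCat.mono_iff_injective _).1 (inferInstanceAs (Mono ((reflProp A).ι.map f)))

theorem surjective_of_epi_reflProp {M N : (reflProp A).FullSubcategory} (f : M ⟶ N) [Epi f] :
    Function.Surjective f.hom.hom :=
  (ModuleCat.epi_iff_surjective _).1 (inferInstanceAs (Epi ((reflProp A).ι.map f)))

theorem projective_reflProp_of_flat (M : (reflProp A).FullSubcategory) [Module.Flat A M.obj] :
    Projective M where
  factors {X Y} f e _ := by
    obtain ⟨g, hg⟩ := IsMatlisReflexive.exists_lift_of_flat X.property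
      (surjective_of_epi_reflProp e) f.hom.hom
    exact ⟨ObjectProperty.homMk (ModuleCat.ofHom g),
      ObjectProperty.hom_ext _ (ModuleCat.hom_ext hg)⟩

theorem injective_reflProp_of_injective (M : (reflProp A).FullSubcategory)
    (hM : Module.Injective A M.obj) : Injective M where
  factors {X Y} f i _ := by
    obtain ⟨g, hg⟩ := hM.exists_extend_of_injective i.hom.hom (injective_of_mono_reflProp i)
      f.hom.hom
    exact ⟨ObjectProperty.homMk (ModuleCat.ofHom g),
      ObjectProperty.hom_ext _ (ModuleCat.hom_ext hg)⟩

/-- The equation ties the abelian structure to the usual addition of linear maps. -/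
theorem abelian_reflProp : ∃ h : Abelian (reflProp A).FullSubcategory,
    h.toPreadditive = (inferInstance : Preadditive (reflProp A).FullSubcategory) :=
  ⟨inferInstance, rfl⟩

/-- Injectivity would split the monomorphism given by multiplication with `π` and make `A` divisible
by `π`. -/
theorem not_injective_ring {M : (reflProp A).FullSubcategory}
    (e : M.obj ≅ matlisModule A .ring) : ¬ Injective M := fun hM => by
  obtain ⟨π, hπ⟩ := IsDiscreteValuationRing.exists_irreducible A
  have h0 : ∀ x : M.obj, π • x = 0 → x = 0 := fun x hx => by
    refine e.toLinearEquiv.map_eq_zero_iff.1 ?_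
    refine (exists_smul_eq_zero_matlisModule_iff hπ .ring).2 (.inl rfl) _ ?_
    rw [← map_smul, hx, map_zero]
  let f : M ⟶ M := ObjectProperty.homMk (ModuleCat.ofHom (LinearMap.lsmul A M.obj π))
  have : Mono f := mono_reflProp_of_injective f ((injective_iff_map_eq_zero _).2 h0)
  let r := Injective.factorThru (𝟙 M) f
  have hr : ∀ x : M.obj, r.hom.hom (π • x) = x := fun x =>
    congrArg (fun g : M ⟶ M => g.hom.hom x) (Injective.comp_factorThru (𝟙 M) f)
  have h1 := (smul_surjective_matlisModule_iff hπ (.ring)).1 fun x => by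
    refine ⟨e.toLinearEquiv (r.hom.hom (e.toLinearEquiv.symm x)), ?_⟩
    rw [← map_smul, ← map_smul, hr, LinearEquiv.apply_symm_apply]
  simp at h1

section Complete

variable [IsAdicComplete (maximalIdeal A) A]

variable (A) in
theorem reflProp_eq_arnoProp : reflProp A = arnoProp A :=
  funext fun _ => propext isMatlisReflexive_iff

instance flat_row (n : ℕ) : Module.Flat A (Fin n → A × FractionRing A) :=
  inferInstance

variable (A) in
theorem isMatlisReflexive_row (n : ℕ) : IsMatlisReflexive A (Fin n → A × FractionRing A) :=
  ((isMatlisReflexive_self A).prod (isMatlisReflexive_fractionRing A)).pi n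

instance enoughProjectives_reflProp : EnoughProjectives (reflProp A).FullSubcategory where
  presentation M := by
    obtain ⟨n, f, hf⟩ := IsMatlisReflexive.exists_surjective M.property
    let P : (reflProp A).FullSubcategory :=
      ⟨ModuleCat.of A (Fin n → A × FractionRing A), isMatlisReflexive_row A n⟩
    have : Module.Flat A P.obj := flat_row n
    exact ⟨{ p := P
             projective := projective_reflProp_of_flat P
             f := ObjectProperty.homMk (ModuleCat.ofHom f)
             epi := epi_reflProp_of_surjective _ hf }⟩

instance enoughInjectives_reflProp : EnoughInjectives (reflProp A).FullSubcategory where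
  presentation M := by
    obtain ⟨n, f, hf⟩ := IsMatlisReflexive.exists_embedding M.property
    let J : (reflProp A).FullSubcategory :=
      ⟨ModuleCat.of A (Fin n → FractionRing A × FracQuotient A),
        ((isMatlisReflexive_fractionRing A).prod (isMatlisReflexive_fracQuotient A)).pi n⟩
    exact ⟨{ J := J
             injective := injective_reflProp_of_injective J
               (.of_pi (.of_prod (injective_fractionRing A) (injective_fracQuotient A)))
             f := ObjectProperty.homMk (ModuleCat.ofHom f)
             mono := mono_reflProp_of_injective _ hf }⟩

/-- The field of fractions is the unique indecomposable projective and injective object of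
`refl A`. -/
theorem projective_injective_iff (M : (reflProp A).FullSubcategory) :
    (Indecomposable M.obj ∧ Projective M ∧ Injective M) ↔
      Nonempty (M.obj ≅ matlisModule A .quotientField) := by
  obtain ⟨π, hπ⟩ := IsDiscreteValuationRing.exists_irreducible A
  constructor
  · rintro ⟨hM, hP, hI⟩
    obtain ⟨t, ⟨e⟩⟩ := exists_iso_matlisModule hM
    -- A projective quotient of a torsion-free reflexive module embeds into it and is torsion-free.
    -- This excludes `K ⧸ A`, a quotient of `K`, and `A ⧸ 𝔪ⁱ`, a quotient of `A`.
    have key : ∀ (P : Type u) [AddCommGroup P] [Module A P], IsMatlisReflexive A P →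
        (∀ x : P, π • x = 0 → x = 0) → ∀ f : P →ₗ[A] matlisModule A t, Function.Surjective f →
        t = .ring ∨ t = .quotientField := fun P _ _ h1 h2 f hf => by
      rw [← exists_smul_eq_zero_matlisModule_iff hπ]
      intro x hx
      have h3 := subsingleton_of_projective (M := M) h1 h2
        (e.toLinearEquiv.symm.toLinearMap ∘ₗ f) (e.toLinearEquiv.symm.surjective.comp hf)
        (e.toLinearEquiv.symm x) (by rw [← map_smul, hx, map_zero])
      exact e.toLinearEquiv.symm.map_eq_zero_iff.1 h3
    cases t with
    | ring => exact absurd hI (not_injective_ring e)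
    | envelope =>
      have := key (FractionRing A) (isMatlisReflexive_fractionRing A)
        ((exists_smul_eq_zero_matlisModule_iff hπ .quotientField).2 (.inr rfl))
        ((envelopeEquiv A).symm.toLinearMap ∘ₗ fracClass)
        ((envelopeEquiv A).symm.surjective.comp (Submodule.mkQ_surjective _))
      simp at this
    | quotientField => exact ⟨e⟩
    | cyclic i hi =>
      have := key A (isMatlisReflexive_self A)
        ((exists_smul_eq_zero_matlisModule_iff hπ .ring).2 (.inl rfl))
        (Submodule.mkQ (maximalIdeal A ^ i)) (Submodule.mkQ_surjective _)
      simp at this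
  · rintro ⟨e⟩
    have : Module.Flat A (matlisModule A .quotientField) :=
      inferInstanceAs (Module.Flat A (FractionRing A))
    have : Module.Flat A M.obj := Module.Flat.of_linearEquiv e.toLinearEquiv
    refine ⟨?_, projective_reflProp_of_flat M,
      injective_reflProp_of_injective M (.of_linearEquiv e.toLinearEquiv.symm
        (injective_fractionRing A))⟩
    have h := indecomposable_matlisModule (A := A) .quotientField
    exact ⟨fun h0 => h.1 (h0.of_iso e.symm), fun Y Z f => h.2 Y Z (e.symm.trans f)⟩

end Complete

end ReflCategory

/-! ### The functor `Hom_A(A ⊕ K, -)` -/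

section HomRow

open IsLocalRing

theorem nonempty_linearEquiv_of_ker_eq {R X Y Z : Type*} [Ring R] [AddCommGroup X] [Module R X]
    [AddCommGroup Y] [Module R Y] [AddCommGroup Z] [Module R Z] {f : X →ₗ[R] Y} {g : X →ₗ[R] Z}
    (hf : Function.Surjective f) (hg : Function.Surjective g)
    (h : LinearMap.ker f = LinearMap.ker g) : Nonempty (Y ≃ₗ[R] Z) :=
  ⟨(f.quotKerEquivOfSurjective hf).symm.trans
    ((Submodule.quotEquivOfEq _ _ h).trans (g.quotKerEquivOfSurjective hg))⟩

variable {A : Type u} [CommRing A] {L M N : Type u} [AddCommGroup L] [Module A L] [AddCommGroup M] [Module A M]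
  [AddCommGroup N] [Module A N]

/-- Postcomposition, as a map of modules over the triangular matrix ring. -/
def homRowMap (f : M →ₗ[A] N) : ((A × FractionRing A) →ₗ[A] M) →ₗ[TriRing A (FractionRing A)]
    ((A × FractionRing A) →ₗ[A] N) where
  toFun h := f ∘ₗ h
  map_add' _ _ := LinearMap.comp_add _ _ _
  map_smul' _ _ := rfl

@[simp] theorem homRowMap_apply (f : M →ₗ[A] N) (h : (A × FractionRing A) →ₗ[A] M) :
    homRowMap f h = f ∘ₗ h := rfl

theorem map_smul_fractionRing {V W : Type*} [AddCommGroup V] [Module A V]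
    [Module (FractionRing A) V] [IsScalarTower A (FractionRing A) V] [AddCommGroup W] [Module A W]
    [Module (FractionRing A) W] [IsScalarTower A (FractionRing A) W] (f : V →ₗ[A] W)
    (c : FractionRing A) (v : V) : f (c • v) = c • f v :=
  (IsLocalization.linearMap_compatibleSMul (nonZeroDivisors A) (FractionRing A) V W).map_smul f c v

theorem eq_of_homRowMap_eq {f g : M →ₗ[A] N} (h : homRowMap f = homRowMap g) : f = g := by
  refine LinearMap.ext fun x => ?_
  have := LinearMap.congr_fun (LinearMap.congr_fun h
    (LinearMap.toSpanSingleton A M x ∘ₗ LinearMap.fst A A (FractionRing A))) (1, 0)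
  simpa using this

variable [IsDomain A] [IsDiscreteValuationRing A]

/-- `Hom(F, -)` is exact on reflexive modules for flat `F`. -/
theorem IsMatlisReflexive.exists_factor_of_flat {F : Type u} [AddCommGroup F] [Module A F]
    [Module.Flat A F] (hL : IsMatlisReflexive A L) {f : L →ₗ[A] M} {g : M →ₗ[A] N}
    (hfg : Function.Exact f g) (h : F →ₗ[A] M) (hgh : g ∘ₗ h = 0) :
    ∃ k : F →ₗ[A] L, f ∘ₗ k = h := by
  obtain ⟨k, hk⟩ := hL.exists_lift_of_flat f.surjective_rangeRestrict
    (h.codRestrict (LinearMap.range f) fun x => (hfg _).1 (LinearMap.congr_fun hgh x))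
  exact ⟨k, LinearMap.ext fun x => congrArg Subtype.val (LinearMap.congr_fun hk x)⟩

theorem homRowMap_surjective (hM : IsMatlisReflexive A M) {f : M →ₗ[A] N}
    (hf : Function.Surjective f) : Function.Surjective (homRowMap f) := fun g =>
  hM.exists_lift_of_flat hf g

theorem homRowMap_exact (hL : IsMatlisReflexive A L) {f : L →ₗ[A] M} {g : M →ₗ[A] N}
    (hfg : Function.Exact f g) : Function.Exact (homRowMap f) (homRowMap g) := fun h => by
  constructor
  · exact fun hh => hL.exists_factor_of_flat hfg h hh
  · rintro ⟨k, rfl⟩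
    rw [homRowMap_apply, homRowMap_apply, ← LinearMap.comp_assoc, hfg.linearMap_comp_eq_zero,
      LinearMap.zero_comp]

/-- Endomorphisms of `A ⊕ K` are triangular because the noetherian module `A` receives no nonzero
map from the divisible module `K`. The entry `K → K` is a scalar since `A`-linear maps between
`K`-vector spaces are `K`-linear. -/
theorem TriRing.rowMul_bijective : Function.Bijective
    (TriRing.rowMul : TriRing A (FractionRing A) → _) := by
  constructor
  · intro x y h
    have h1 := LinearMap.congr_fun h (1, 0)
    have h2 := LinearMap.congr_fun h (0, 1)
    simp only [rowMul_apply, one_mul, one_smul, zero_mul, zero_smul, add_zero, zero_add,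
      Prod.mk.injEq] at h1 h2
    exact TriRing.ext h1.1 h1.2 h2.2
  · intro g
    refine ⟨⟨(g (1, 0)).1, (g (1, 0)).2, (g (0, 1)).2⟩, ?_⟩
    refine LinearMap.prod_ext (LinearMap.ext_ring ?_) (LinearMap.ext fun t => ?_)
    · ext <;> simp
    · have h1 := LinearMap.congr_fun (eq_zero_of_fractionRing_to_finite
        (LinearMap.fst A _ _ ∘ₗ g ∘ₗ LinearMap.inr A A (FractionRing A))) t
      have h2 := map_smul_fractionRing
        (LinearMap.snd A _ _ ∘ₗ g ∘ₗ LinearMap.inr A A (FractionRing A)) t 1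
      simp only [LinearMap.comp_apply, LinearMap.inr_apply, LinearMap.fst_apply,
        LinearMap.snd_apply, smul_eq_mul, mul_one, LinearMap.zero_apply] at h1 h2
      ext <;> simp [h1, h2]

/-- `Hom_A(A ⊕ K, (A ⊕ K)ⁿ)` is free over the triangular matrix ring. -/
noncomputable def homRowFree (A : Type u) [CommRing A] [IsDomain A] [IsDiscreteValuationRing A]
    (n : ℕ) : (Fin n → TriRing A (FractionRing A)) ≃ₗ[TriRing A (FractionRing A)]
      ((A × FractionRing A) →ₗ[A] (Fin n → A × FractionRing A)) :=
  LinearEquiv.ofBijective (σ₁₂ := RingHom.id _)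
    { toFun := fun x : Fin n → TriRing A (FractionRing A) =>
        (LinearMap.pi fun i => TriRing.rowMul (x i) :
          (A × FractionRing A) →ₗ[A] (Fin n → A × FractionRing A))
      map_add' := fun x y => LinearMap.ext fun v => funext fun i =>
        LinearMap.congr_fun (TriRing.rowMul_add (x i) (y i)) v
      map_smul' := fun c x => LinearMap.ext fun v => funext fun i =>
        LinearMap.congr_fun (TriRing.rowMul_mul c (x i)) v }
    ⟨fun x y h => funext fun i => TriRing.rowMul_bijective.1
      (LinearMap.ext fun v => congrFun (LinearMap.congr_fun h v) i),
    fun p => by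
      choose x hx using fun i => TriRing.rowMul_bijective.2 (LinearMap.proj i ∘ₗ p)
      exact ⟨x, LinearMap.ext fun v => funext fun i => LinearMap.congr_fun (hx i) v⟩⟩

theorem homRowFree_apply {n : ℕ} (x : Fin n → TriRing A (FractionRing A))
    (v : A × FractionRing A) (i : Fin n) : homRowFree A n x v i = TriRing.rowMul (x i) v := rfl

/-- A homomorphism of modules over the triangular matrix ring defined on `Hom_A(A ⊕ K, (A ⊕ K)ⁿ)`
is given by postcomposition. -/
theorem exists_eq_comp_of_row {n : ℕ} (φ : ((A × FractionRing A) →ₗ[A] (Fin n → A × FractionRing A))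
      →ₗ[TriRing A (FractionRing A)] ((A × FractionRing A) →ₗ[A] N)) :
    ∃ g : (Fin n → A × FractionRing A) →ₗ[A] N, ∀ p, φ p = g ∘ₗ p := by
  -- The inclusions of the summands are the standard basis of this free module, so `φ` is determined
  -- by their images.
  let q : Fin n → ((A × FractionRing A) →ₗ[A] (Fin n → A × FractionRing A)) := fun i =>
    LinearMap.single A (fun _ => A × FractionRing A) i
  refine ⟨∑ i, φ (q i) ∘ₗ LinearMap.proj i, fun p => ?_⟩
  obtain ⟨x, rfl⟩ := (homRowFree A n).surjective p
  have h1 : homRowFree A n x = ∑ i, x i • q i := by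
    refine LinearMap.ext fun v => funext fun j => ?_
    rw [homRowFree_apply, LinearMap.sum_apply, Finset.sum_apply, Finset.sum_eq_single j]
    · change _ = (Pi.single j (TriRing.rowMul (x j) v) : Fin n → A × FractionRing A) j
      rw [Pi.single_eq_same]
    · intro i _ hij
      change (Pi.single i (TriRing.rowMul (x i) v) : Fin n → A × FractionRing A) j = 0
      rw [Pi.single_eq_of_ne hij.symm]
    · simp
  have h2 : φ (homRowFree A n x) = ∑ i, x i • φ (q i) := by
    rw [h1, map_sum]
    exact Finset.sum_congr rfl fun i _ => map_smul φ _ _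
  rw [h2]
  refine LinearMap.ext fun v => ?_
  rw [LinearMap.comp_apply, LinearMap.sum_apply, LinearMap.sum_apply]
  rfl

section Complete

variable [IsAdicComplete (maximalIdeal A) A]

/-- Fullness: on a cover `q` by a power of `A ⊕ K`, `φ` is postcomposition with some `g`. Each `y ∈
ker q` is the value of a map from `A`, so `g` kills `ker q` and descends to `M`. -/
theorem exists_eq_homRowMap (hM : IsMatlisReflexive A M)
    (φ : ((A × FractionRing A) →ₗ[A] M) →ₗ[TriRing A (FractionRing A)]
      ((A × FractionRing A) →ₗ[A] N)) : ∃ f : M →ₗ[A] N, φ = homRowMap f := by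
  obtain ⟨n, q, hq⟩ := hM.exists_surjective
  obtain ⟨g, hg⟩ := exists_eq_comp_of_row (φ ∘ₗ homRowMap q)
  have hker : LinearMap.ker q ≤ LinearMap.ker g := fun y hy => by
    have h1 := hg (LinearMap.toSpanSingleton A _ y ∘ₗ LinearMap.fst A A (FractionRing A))
    have h2 : q ∘ₗ LinearMap.toSpanSingleton A _ y ∘ₗ LinearMap.fst A A (FractionRing A) = 0 :=
      LinearMap.ext fun v => by simp [LinearMap.mem_ker.1 hy]
    rw [LinearMap.comp_apply, homRowMap_apply, h2, map_zero] at h1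
    simpa using (LinearMap.congr_fun h1 (1, 0)).symm
  let f : M →ₗ[A] N := (LinearMap.ker q).liftQ g hker ∘ₗ
    (q.quotKerEquivOfSurjective hq).symm.toLinearMap
  have hf : f ∘ₗ q = g := LinearMap.ext fun y => by
    have : (q.quotKerEquivOfSurjective hq).symm (q y) = Submodule.Quotient.mk y := by
      rw [LinearEquiv.symm_apply_eq]; rfl
    rw [LinearMap.comp_apply, LinearMap.comp_apply, LinearEquiv.coe_coe, this]
    rfl
  refine ⟨f, LinearMap.ext fun p => ?_⟩
  obtain ⟨p, rfl⟩ := homRowMap_surjective (isMatlisReflexive_row A n) hq p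
  rw [← LinearMap.comp_apply, hg, ← hf]
  rfl

theorem IsMatlisReflexive.exists_presentation (hM : IsMatlisReflexive A M) :
    ∃ (n m : ℕ) (q : (Fin n → A × FractionRing A) →ₗ[A] M)
      (s : (Fin m → A × FractionRing A) →ₗ[A] (Fin n → A × FractionRing A)),
      Function.Surjective q ∧ Function.Exact s q := by
  obtain ⟨n, q, hq⟩ := hM.exists_surjective
  obtain ⟨m, s, hs⟩ := ((isMatlisReflexive_row A n).of_injective
    (i := (LinearMap.ker q).subtype) Subtype.val_injective).exists_surjective
  refine ⟨n, m, q, (LinearMap.ker q).subtype ∘ₗ s, hq, LinearMap.exact_iff.2 ?_⟩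
  rw [LinearMap.range_comp_of_range_eq_top _ (LinearMap.range_eq_top.2 hs), Submodule.range_subtype]

/-- A functor which is right exact and sends the projective generators to finitely generated free
modules has finitely presented values. -/
theorem finitePresentation_of_exact {S X Y Z : Type*} [Ring S] [AddCommGroup X] [Module S X]
    [AddCommGroup Y] [Module S Y] [AddCommGroup Z] [Module S Z] [Module.Finite S X]
    [Module.FinitePresentation S Y] {f : X →ₗ[S] Y} {g : Y →ₗ[S] Z} (hfg : Function.Exact f g)
    (hg : Function.Surjective g) : Module.FinitePresentation S Z := by
  refine Module.finitePresentation_of_surjective g hg ?_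
  rw [LinearMap.exact_iff.1 hfg]
  exact Module.Finite.iff_fg.1 (Module.Finite.range f)

instance finitePresentation_homRow_row (n : ℕ) :
    Module.FinitePresentation (TriRing A (FractionRing A))
      ((A × FractionRing A) →ₗ[A] (Fin n → A × FractionRing A)) :=
  .of_equiv (homRowFree A n)

theorem finitePresentation_homRow (hM : IsMatlisReflexive A M) :
    Module.FinitePresentation (TriRing A (FractionRing A)) ((A × FractionRing A) →ₗ[A] M) := by
  obtain ⟨n, m, q, s, hq, hs⟩ := hM.exists_presentation
  exact finitePresentation_of_exact (homRowMap_exact (isMatlisReflexive_row A m) hs)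
    (homRowMap_surjective (isMatlisReflexive_row A n) hq)

variable (A) in
theorem fpProp_homRow (M : (reflProp A).FullSubcategory) :
    fpProp (TriRing A (FractionRing A))
      (((reflProp A).ι ⋙ homRow A (FractionRing A)).obj M) :=
  finitePresentation_homRow M.property

/-- A presentation of `X` is a map of free modules, which comes from a map `s` between powers of `A
⊕ K`. By exactness, `X` is the value at the cokernel of `s`. -/
theorem exists_homRow_equiv (X : Type u) [AddCommGroup X] [Module (TriRing A (FractionRing A)) X]
    [Module.FinitePresentation (TriRing A (FractionRing A)) X] :
    ∃ M : ModuleCat.{u} A, IsMatlisReflexive A M ∧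
      Nonempty (((A × FractionRing A) →ₗ[A] M) ≃ₗ[TriRing A (FractionRing A)] X) := by
  obtain ⟨n, m, f, g, hf, hgf⟩ :=
    Module.FinitePresentation.exists_fin' (TriRing A (FractionRing A)) X
  obtain ⟨s, hs⟩ := exists_eq_homRowMap (isMatlisReflexive_row A m)
    ((homRowFree A n).toLinearMap ∘ₗ g ∘ₗ (homRowFree A m).symm.toLinearMap)
  refine ⟨ModuleCat.of A ((Fin n → A × FractionRing A) ⧸ LinearMap.range s),
    (isMatlisReflexive_row A n).of_surjective (Submodule.mkQ_surjective _),
    nonempty_linearEquiv_of_ker_eq (f := homRowMap (LinearMap.range s).mkQ)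
      (g := f ∘ₗ (homRowFree A n).symm.toLinearMap)
      (homRowMap_surjective (isMatlisReflexive_row A n) (Submodule.mkQ_surjective _))
      (hf.comp (LinearEquiv.surjective _)) ?_⟩
  rw [LinearMap.exact_iff.1 (homRowMap_exact (isMatlisReflexive_row A m)
    (LinearMap.exact_map_mkQ_range s)), ← hs, LinearMap.ker_comp, LinearMap.exact_iff.1 hgf,
    LinearMap.range_comp, LinearMap.range_comp_of_range_eq_top _ (LinearEquiv.range _)]
  exact Submodule.map_equiv_eq_comap_symm _ _

variable (A) in
theorem isEquivalence_homRow : ((fpProp (TriRing A (FractionRing A))).lift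
    ((reflProp A).ι ⋙ homRow A (FractionRing A)) (fpProp_homRow A)).IsEquivalence where
  faithful := ⟨fun {M N f g} h => by
    refine ObjectProperty.hom_ext _ (ModuleCat.hom_ext (eq_of_homRowMap_eq ?_))
    exact congrArg (fun k => k.hom.hom) h⟩
  full := ⟨fun {M N} φ => by
    obtain ⟨f, hf⟩ := exists_eq_homRowMap M.property φ.hom.hom
    exact ⟨ObjectProperty.homMk (ModuleCat.ofHom f),
      ObjectProperty.hom_ext _ (ModuleCat.hom_ext hf.symm)⟩⟩
  essSurj := ⟨fun X => by
    have : Module.FinitePresentation (TriRing A (FractionRing A)) X.obj := X.property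
    obtain ⟨M, hM, ⟨e⟩⟩ := exists_homRow_equiv (A := A) X.obj
    exact ⟨⟨M, hM⟩, ⟨ObjectProperty.isoMk _ e.toModuleIso⟩⟩⟩

end Complete

end HomRow

/-! ### The functor `M ↦ (K ⊗ M, Hom(K, M))` -/

section LocPair

open TensorProduct IsLocalRing

variable {A : Type u} [CommRing A] {L M N : Type u} [AddCommGroup L] [Module A L] [AddCommGroup M]
  [Module A M] [AddCommGroup N] [Module A N]

/-- `Hom_A(K, M)` as a vector space over the field of fractions `K`. -/
instance homFracModule : Module (FractionRing A) (FractionRing A →ₗ[A] M) where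
  smul d h := h ∘ₗ LinearMap.mulLeft A d
  one_smul h := LinearMap.ext fun x => congrArg h (one_mul x)
  mul_smul c d h := LinearMap.ext fun x => congrArg h (by
    change c * d * x = d * (c * x)
    ring)
  smul_zero d := LinearMap.zero_comp _
  smul_add d h k := LinearMap.add_comp _ _ _
  add_smul c d h := LinearMap.ext fun x => (congrArg h (add_mul c d x)).trans (map_add h _ _)
  zero_smul h := LinearMap.ext fun x => (congrArg h (zero_mul x)).trans (map_zero h)

theorem homFrac_smul_apply (d x : FractionRing A) (h : FractionRing A →ₗ[A] M) :
    (d • h) x = h (d * x) := rfl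

/-- The canonical map `Hom_A(K, M) → K ⊗ M`. -/
noncomputable def homFracToTensor (A M : Type u) [CommRing A] [AddCommGroup M] [Module A M] :
    (FractionRing A →ₗ[A] M) →ₗ[FractionRing A] FractionRing A ⊗[A] M where
  toFun h := 1 ⊗ₜ h 1
  map_add' h k := tmul_add _ _ _
  map_smul' d h := by
    have := map_smul_fractionRing (TensorProduct.mk A (FractionRing A) M 1 ∘ₗ h) d 1
    simpa [homFrac_smul_apply] using this

/-- The pair `(K ⊗ M, Hom(K, M))`. -/
abbrev LocPair (A M : Type u) [CommRing A] [AddCommGroup M] [Module A M] : Type u :=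
  (FractionRing A ⊗[A] M) × (FractionRing A →ₗ[A] M)

/-- The matrix ring acts on `(K ⊗ M, Hom(K, M))`, viewed as column vectors. -/
noncomputable instance locPairSMul :
    SMul (TriRing (FractionRing A) (FractionRing A)) (LocPair A M) where
  smul x y := (x.a • y.1 + x.b • homFracToTensor A M y.2, x.d • y.2)

theorem locPair_smul_fst (x : TriRing (FractionRing A) (FractionRing A)) (y : LocPair A M) :
    (x • y).1 = x.a • y.1 + x.b • homFracToTensor A M y.2 := rfl

theorem locPair_smul_snd (x : TriRing (FractionRing A) (FractionRing A)) (y : LocPair A M) :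
    (x • y).2 = x.d • y.2 := rfl

/-- `(K ⊗ M, Hom(K, M))`, viewed as column vectors, is a module over the triangular matrix
ring. -/
noncomputable instance locPairModule :
    Module (TriRing (FractionRing A) (FractionRing A)) (LocPair A M) where
  one_smul y := by
    ext1 <;> simp [locPair_smul_fst, locPair_smul_snd]
  mul_smul x y z := by
    ext1
    · simp only [locPair_smul_fst, locPair_smul_snd, TriRing.mul_a, TriRing.mul_b, smul_eq_mul,
        map_smul, mul_smul, add_smul, smul_add, add_assoc]
    · exact mul_smul _ _ _
  smul_zero x := by
    ext1 <;> simp [locPair_smul_fst, locPair_smul_snd]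
  smul_add x y z := by
    ext1
    · simp only [locPair_smul_fst, Prod.fst_add, Prod.snd_add, map_add, smul_add]
      abel
    · exact smul_add _ _ _
  add_smul x y z := by
    ext1
    · simp only [locPair_smul_fst, Prod.fst_add, TriRing.add_a, TriRing.add_b, add_smul]
      abel
    · exact add_smul _ _ _
  zero_smul y := by
    ext1 <;> simp [locPair_smul_fst, locPair_smul_snd]

theorem locPair_smul_def (x : TriRing (FractionRing A) (FractionRing A)) (y : LocPair A M) :
    x • y = (x.a • y.1 + x.b • homFracToTensor A M y.2, x.d • y.2) := rfl

/-- Postcomposition as a map of vector spaces. -/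
def homFracMap (f : M →ₗ[A] N) :
    (FractionRing A →ₗ[A] M) →ₗ[FractionRing A] (FractionRing A →ₗ[A] N) where
  toFun h := f ∘ₗ h
  map_add' _ _ := LinearMap.comp_add _ _ _
  map_smul' _ _ := rfl

/-- The action of `M ↦ (K ⊗ M, Hom(K, M))` on linear maps. -/
noncomputable def locPairMap (f : M →ₗ[A] N) :
    LocPair A M →ₗ[TriRing (FractionRing A) (FractionRing A)] LocPair A N where
  toFun y := (f.baseChange (FractionRing A) y.1, homFracMap f y.2)
  map_add' y z := by simp
  map_smul' x y := by
    have : f.baseChange (FractionRing A) (homFracToTensor A M y.2) =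
        homFracToTensor A N (homFracMap f y.2) := rfl
    simp only [locPair_smul_def, map_add, map_smul, this, RingHom.id_apply]

theorem locPairMap_apply (f : M →ₗ[A] N) (y : LocPair A M) :
    locPairMap f y = (f.baseChange (FractionRing A) y.1, homFracMap f y.2) := rfl

theorem locPairMap_id : locPairMap (LinearMap.id : M →ₗ[A] M) = LinearMap.id :=
  LinearMap.ext fun y => by
    rw [locPairMap_apply, LinearMap.baseChange_id]
    rfl

theorem locPairMap_comp (f : L →ₗ[A] M) (g : M →ₗ[A] N) :
    locPairMap (g ∘ₗ f) = locPairMap g ∘ₗ locPairMap f :=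
  LinearMap.ext fun y => by
    rw [locPairMap_apply, LinearMap.baseChange_comp]
    rfl

theorem locPairMap_comp_apply (f : L →ₗ[A] M) (g : M →ₗ[A] N) (y : LocPair A L) :
    locPairMap (g ∘ₗ f) y = locPairMap g (locPairMap f y) := by
  rw [locPairMap_comp, LinearMap.comp_apply]

theorem locPairMap_zero : locPairMap (0 : M →ₗ[A] N) = 0 :=
  LinearMap.ext fun y => by
    rw [locPairMap_apply, LinearMap.baseChange_zero]
    rfl

theorem locPairMap_add (f g : M →ₗ[A] N) : locPairMap (f + g) = locPairMap f + locPairMap g :=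
  LinearMap.ext fun y => by
    rw [locPairMap_apply, LinearMap.baseChange_add]
    exact Prod.ext rfl (LinearMap.add_comp _ _ _)

/-- `locPairMap` as an additive map. -/
noncomputable def locPairAddHom : (M →ₗ[A] N) →+
    (LocPair A M →ₗ[TriRing (FractionRing A) (FractionRing A)] LocPair A N) where
  toFun := locPairMap
  map_zero' := locPairMap_zero
  map_add' := locPairMap_add

theorem locPairMap_sum {n : ℕ} (f : Fin n → M →ₗ[A] N) :
    locPairMap (∑ i, f i) = ∑ i, locPairMap (f i) :=
  map_sum locPairAddHom f Finset.univ

theorem locPairMap_injective {f : M →ₗ[A] N} (hf : Function.Injective f) :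
    Function.Injective (locPairMap f) := by
  refine Function.Injective.prodMap (f := f.baseChange (FractionRing A)) (g := homFracMap f)
    ?_ fun h k hhk => LinearMap.ext fun x => hf (LinearMap.congr_fun hhk x)
  have : Module.Flat A (FractionRing A) := IsLocalization.flat _ (nonZeroDivisors A)
  exact Module.Flat.lTensor_preserves_injective_linearMap f hf

theorem sum_single_comp_proj (n : ℕ) :
    ∑ i : Fin n, LinearMap.single A (fun _ => M) i ∘ₗ LinearMap.proj i = LinearMap.id := by
  refine LinearMap.ext fun x => funext fun j => ?_
  simp [LinearMap.sum_apply, Finset.sum_apply, Pi.single_apply]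

/-- The canonical generator of the pair of `A ⊕ K`. -/
noncomputable def locGen (A : Type u) [CommRing A] : LocPair A (A × FractionRing A) :=
  (1 ⊗ₜ (1, 0), LinearMap.inr A A (FractionRing A))

/-- The element `x • locGen A` has first component `x.a ⊗ (1, 0) + x.b ⊗ (0, 1)` and second
component `x.d • inr`. Projecting to `A` and to `K` recovers the three entries. -/
theorem eq_zero_of_smul_locGen {x : TriRing (FractionRing A) (FractionRing A)}
    (hx : x • locGen A = 0) : x = 0 := by
  have h1 : x.a • ((1 : FractionRing A) ⊗ₜ[A] ((1, 0) : A × FractionRing A)) +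
      x.b • ((1 : FractionRing A) ⊗ₜ[A] ((0, 1) : A × FractionRing A)) = 0 := congrArg Prod.fst hx
  have h2 : x.d • LinearMap.inr A A (FractionRing A) = 0 := congrArg Prod.snd hx
  rw [smul_tmul', smul_tmul', smul_eq_mul, smul_eq_mul, mul_one, mul_one] at h1
  have ha := congrArg (TensorProduct.rid A _ ∘
    (LinearMap.fst A A (FractionRing A)).lTensor (FractionRing A)) h1
  have hb := congrArg (LinearMap.mul' A _ ∘
    (LinearMap.snd A A (FractionRing A)).lTensor (FractionRing A)) h1
  have hd := congrArg Prod.snd (LinearMap.congr_fun h2 1)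
  rw [homFrac_smul_apply] at hd
  exact TriRing.ext (by simpa using ha) (by simpa using hb) (by simpa using hd)

variable [IsDomain A] [IsDiscreteValuationRing A]

theorem locPairMap_surjective (hM : IsMatlisReflexive A M) {f : M →ₗ[A] N}
    (hf : Function.Surjective f) : Function.Surjective (locPairMap f) :=
  Function.Surjective.prodMap (f := f.baseChange (FractionRing A)) (g := homFracMap f)
    (LinearMap.lTensor_surjective _ hf) fun h => hM.exists_lift_of_flat hf h

/-- The first component is exact by flatness of `K`, the second because the flat module `K` is
projective relative to reflexive modules. -/
theorem locPairMap_exact (hL : IsMatlisReflexive A L) {f : L →ₗ[A] M} {g : M →ₗ[A] N}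
    (hfg : Function.Exact f g) : Function.Exact (locPairMap f) (locPairMap g) := fun y => by
  constructor
  · intro hy
    obtain ⟨v, hv⟩ := (Module.Flat.lTensor_exact (FractionRing A) hfg y.1).1 (congrArg Prod.fst hy)
    obtain ⟨k, hk⟩ := hL.exists_factor_of_flat hfg y.2 (congrArg Prod.snd hy)
    exact ⟨(v, k), Prod.ext hv hk⟩
  · rintro ⟨z, rfl⟩
    rw [← locPairMap_comp_apply, hfg.linearMap_comp_eq_zero, locPairMap_zero, LinearMap.zero_apply]

/-- `K ⊗ (A ⊕ K)` is spanned over `K` by the two unit vectors, and `Hom(K, A ⊕ K)` is spanned by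
`inr` because `Hom(K, A) = 0`. -/
theorem exists_smul_locGen (z : LocPair A (A × FractionRing A)) :
    ∃ x : TriRing (FractionRing A) (FractionRing A), x • locGen A = z := by
  obtain ⟨v, h⟩ := z
  have h1 : ∃ α β : FractionRing A, α • (1 ⊗ₜ[A] ((1, 0) : A × FractionRing A)) +
      β • (1 ⊗ₜ[A] ((0, 1) : A × FractionRing A)) = v := by
    induction v with
    | zero => exact ⟨0, 0, by simp⟩
    | add v w hv hw =>
      obtain ⟨α, β, rfl⟩ := hv
      obtain ⟨α', β', rfl⟩ := hw
      exact ⟨α + α', β + β', by rw [add_smul, add_smul]; abel⟩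
    | tmul c p =>
      obtain ⟨a, t⟩ := p
      have h2 := map_smul_fractionRing
        (TensorProduct.mk A (FractionRing A) (A × FractionRing A) 1 ∘ₗ LinearMap.inr A A _) t 1
      simp only [LinearMap.comp_apply, LinearMap.inr_apply, mk_apply, smul_eq_mul, mul_one] at h2
      have h3 : ((a, t) : A × FractionRing A) = a • (1, 0) + (0, t) := by simp
      refine ⟨c * algebraMap A _ a, c * t, ?_⟩
      rw [mul_smul, mul_smul, ← h2, algebraMap_smul, ← tmul_smul, ← smul_add, ← tmul_add, ← h3,
        smul_tmul', smul_eq_mul, mul_one]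
  obtain ⟨α, β, rfl⟩ := h1
  refine ⟨⟨α, β, (h 1).2⟩, Prod.ext rfl (LinearMap.ext fun x => ?_)⟩
  have h4 := LinearMap.congr_fun (eq_zero_of_fractionRing_to_finite
    (LinearMap.fst A A (FractionRing A) ∘ₗ h)) x
  have h5 := map_smul_fractionRing (LinearMap.snd A A (FractionRing A) ∘ₗ h) x 1
  simp only [LinearMap.comp_apply, LinearMap.fst_apply, LinearMap.zero_apply, LinearMap.snd_apply,
    smul_eq_mul, mul_one] at h4 h5
  change ((0 : A), (h 1).2 * x) = h x
  exact Prod.ext h4.symm (by rw [h5, mul_comm])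

/-- The canonical generators of the pair of `(A ⊕ K)ⁿ`. -/
noncomputable def locPairGen (A : Type u) [CommRing A] (n : ℕ) (i : Fin n) :
    LocPair A (Fin n → A × FractionRing A) :=
  locPairMap (LinearMap.single A (fun _ => A × FractionRing A) i) (locGen A)

theorem locPair_bijective (n : ℕ) : Function.Bijective
    (Fintype.linearCombination (TriRing (FractionRing A) (FractionRing A)) (locPairGen A n)) := by
  constructor
  · refine (injective_iff_map_eq_zero _).2 fun x hx => funext fun j => ?_
    refine eq_zero_of_smul_locGen ?_
    have h1 := congrArg (locPairMap (LinearMap.proj (R := A) (φ := fun _ => A × FractionRing A) j)) hx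
    rw [Fintype.linearCombination_apply, map_sum, map_zero, Finset.sum_eq_single j] at h1
    · rw [map_smul, locPairGen, ← locPairMap_comp_apply, LinearMap.proj_comp_single_same,
        locPairMap_id] at h1
      exact h1
    · intro i _ hij
      rw [map_smul, locPairGen, ← locPairMap_comp_apply, LinearMap.proj_comp_single_ne _ _ _ _ hij.symm,
        locPairMap_zero, LinearMap.zero_apply, smul_zero]
    · simp
  · intro y
    choose x hx using fun i => exists_smul_locGen
      (locPairMap (LinearMap.proj (R := A) (φ := fun _ => A × FractionRing A) i) y)
    refine ⟨x, ?_⟩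
    rw [Fintype.linearCombination_apply]
    have h1 := LinearMap.congr_fun
      (congrArg locPairMap (sum_single_comp_proj (A := A) (M := A × FractionRing A) n)) y
    rw [locPairMap_id, locPairMap_sum, LinearMap.sum_apply] at h1
    refine Eq.trans (Finset.sum_congr rfl fun i _ => ?_) h1
    rw [locPairMap_comp_apply, ← hx, map_smul, locPairGen]

/-- The pair of `(A ⊕ K)ⁿ` is free over the triangular matrix ring. -/
noncomputable def locPairFree (A : Type u) [CommRing A] [IsDomain A] [IsDiscreteValuationRing A]
    (n : ℕ) : (Fin n → TriRing (FractionRing A) (FractionRing A))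
      ≃ₗ[TriRing (FractionRing A) (FractionRing A)] LocPair A (Fin n → A × FractionRing A) :=
  LinearEquiv.ofBijective _ (locPair_bijective n)

theorem locPair_ext {n : ℕ} {X : Type*} [AddCommGroup X]
    [Module (TriRing (FractionRing A) (FractionRing A)) X]
    {φ ψ : LocPair A (Fin n → A × FractionRing A)
      →ₗ[TriRing (FractionRing A) (FractionRing A)] X}
    (h : ∀ i, φ (locPairGen A n i) = ψ (locPairGen A n i)) : φ = ψ := by
  refine LinearMap.ext fun y => ?_
  obtain ⟨x, rfl⟩ := (locPair_bijective n).2 y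
  rw [Fintype.linearCombination_apply, map_sum, map_sum]
  exact Finset.sum_congr rfl fun i _ => by rw [map_smul, map_smul, h]

end LocPair

/-! ### Morphisms between localized modules -/

section Roofs

open TensorProduct IsLocalRing

variable {A : Type u} [CommRing A] {M N : Type u} [AddCommGroup M] [Module A M] [AddCommGroup N]
  [Module A N]

theorem locPair_prod_ext {y : LocPair A (M × N)} (h1 : locPairMap (LinearMap.fst A M N) y = 0)
    (h2 : locPairMap (LinearMap.snd A M N) y = 0) : y = 0 := by
  have h : LinearMap.inl A M N ∘ₗ LinearMap.fst A M N + LinearMap.inr A M N ∘ₗ LinearMap.snd A M N =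
      LinearMap.id := by ext <;> simp
  have h3 := LinearMap.congr_fun (congrArg locPairMap h) y
  rw [locPairMap_add, LinearMap.add_apply, locPairMap_comp_apply, locPairMap_comp_apply, h1, h2,
    map_zero, map_zero, add_zero, locPairMap_id] at h3
  exact h3.symm

variable [IsDomain A] [IsDiscreteValuationRing A]

/-- Applied to the difference of two maps with equal images under the functor, it shows that they
agree after precomposition with a map that the functor inverts. -/
theorem bijective_locPairMap_ker_subtype (hM : IsMatlisReflexive A M) {f : M →ₗ[A] N}
    (hf : locPairMap f = 0) : Function.Bijective (locPairMap (LinearMap.ker f).subtype) := by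
  refine ⟨locPairMap_injective Subtype.val_injective, fun y => ?_⟩
  have hk : IsMatlisReflexive A (LinearMap.ker f) :=
    hM.of_injective (i := (LinearMap.ker f).subtype) Subtype.val_injective
  exact (locPairMap_exact hk (LinearMap.exact_subtype_ker_map f) y).1 (LinearMap.congr_fun hf y)

variable [IsAdicComplete (maximalIdeal A) A]

theorem IsMatlisReflexive.subsingleton_locPair_iff (hM : IsMatlisReflexive A M) :
    Subsingleton (LocPair A M) ↔ IsFiniteLength A M := by
  rw [hM.isFiniteLength_iff]
  constructor
  · intro h
    exact ⟨subsingleton_of_forall_eq 0 fun v =>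
      congrArg Prod.fst (Subsingleton.elim ((v, 0) : LocPair A M) 0),
      fun f => congrArg Prod.snd (Subsingleton.elim ((0, f) : LocPair A M) 0)⟩
  · rintro ⟨h1, h2⟩
    exact subsingleton_of_forall_eq 0 fun y => Prod.ext (Subsingleton.elim _ _) (h2 y.2)

/-- A map of reflexive modules becomes invertible if and only if its kernel and its cokernel
have finite length. -/
theorem bijective_locPairMap_iff (hM : IsMatlisReflexive A M) (hN : IsMatlisReflexive A N)
    (f : M →ₗ[A] N) : Function.Bijective (locPairMap f) ↔
      IsFiniteLength A (LinearMap.ker f) ∧ IsFiniteLength A (N ⧸ LinearMap.range f) := by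
  have hk : IsMatlisReflexive A (LinearMap.ker f) :=
    hM.of_injective (i := (LinearMap.ker f).subtype) Subtype.val_injective
  have hc : IsMatlisReflexive A (N ⧸ LinearMap.range f) :=
    hN.of_surjective (Submodule.mkQ_surjective _)
  have e1 := locPairMap_exact hk (LinearMap.exact_subtype_ker_map f)
  have e2 := locPairMap_exact hM (LinearMap.exact_map_mkQ_range f)
  have i1 := locPairMap_injective (f := (LinearMap.ker f).subtype) Subtype.val_injective
  have s2 := locPairMap_surjective hN (Submodule.mkQ_surjective (LinearMap.range f))
  rw [← hk.subsingleton_locPair_iff, ← hc.subsingleton_locPair_iff]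
  constructor
  · intro hf
    constructor
    · refine subsingleton_of_forall_eq 0 fun y => i1 ?_
      rw [map_zero]
      exact hf.1 ((e1.apply_apply_eq_zero y).trans (map_zero _).symm)
    · refine subsingleton_of_forall_eq 0 fun y => ?_
      obtain ⟨y, rfl⟩ := s2 y
      obtain ⟨z, rfl⟩ := hf.2 y
      exact e2.apply_apply_eq_zero z
  · rintro ⟨h1, h2⟩
    constructor
    · refine (injective_iff_map_eq_zero _).2 fun y hy => ?_
      obtain ⟨z, rfl⟩ := (e1 y).1 hy
      rw [Subsingleton.elim z 0, map_zero]
    · exact fun y => (e2 y).1 (Subsingleton.elim _ _)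

/-- Every map between the localizations of reflexive modules is given by a roof. -/
theorem exists_roof (hM : IsMatlisReflexive A M)
    (φ : LocPair A M →ₗ[TriRing (FractionRing A) (FractionRing A)] LocPair A N) :
    ∃ Z : Submodule A (M × N),
      Function.Bijective (locPairMap (LinearMap.fst A M N ∘ₗ Z.subtype)) ∧
      locPairMap (LinearMap.snd A M N ∘ₗ Z.subtype) =
        φ ∘ₗ locPairMap (LinearMap.fst A M N ∘ₗ Z.subtype) := by
  obtain ⟨n, q, hq⟩ := hM.exists_surjective
  let y : Fin n → LocPair A N := fun i => φ (locPairMap q (locPairGen A n i))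
  -- The images of the generators need not come from `N`, since their first components lie in `K ⊗
  -- N`. A common denominator `c` moves these into the image of `N`.
  obtain ⟨c, hc⟩ := IsLocalizedModule.exist_integer_multiples_of_finite (nonZeroDivisors A)
    (TensorProduct.mk A (FractionRing A) N 1) fun i => (y i).1
  choose y₀ hy₀ using hc
  have hc0 : algebraMap A (FractionRing A) c ≠ 0 := by
    simp
  -- The denominator is needed on the summands `A` only: `s` multiplies these by `c`, acts on
  -- generators as the invertible matrix `σ = diag(c, 1)`, and `g` realizes `φ` composed with `q`
  -- and `s`.
  let σ : TriRing (FractionRing A) (FractionRing A) := ⟨algebraMap A _ c, 0, 1⟩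
  let s : (Fin n → A × FractionRing A) →ₗ[A] (Fin n → A × FractionRing A) :=
    (LinearMap.prodMap (LinearMap.lsmul A A (c : A)) LinearMap.id).compLeft (Fin n)
  let gi : Fin n → (A × FractionRing A) →ₗ[A] N := fun i =>
    (LinearMap.toSpanSingleton A N (y₀ i)).coprod (y i).2
  let g : (Fin n → A × FractionRing A) →ₗ[A] N := ∑ i, gi i ∘ₗ LinearMap.proj i
  have hs : ∀ i, locPairMap s (locPairGen A n i) = σ • locPairGen A n i := fun i => by
    have h1 : s ∘ₗ LinearMap.single A (fun _ => A × FractionRing A) i =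
        LinearMap.single A (fun _ => A × FractionRing A) i ∘ₗ
          LinearMap.prodMap (LinearMap.lsmul A A (c : A)) LinearMap.id := by
      refine LinearMap.ext fun x => funext fun j => ?_
      by_cases hij : j = i
      · subst hij; simp [s]
      · simp [s, Pi.single_eq_of_ne hij]
    rw [locPairGen, ← locPairMap_comp_apply, h1, locPairMap_comp_apply, ← map_smul]
    congr 1
    refine Prod.ext ?_ (LinearMap.ext fun x => ?_)
    · rw [locPair_smul_fst]
      change (1 : FractionRing A) ⊗ₜ[A] (((c : A) • (1 : A), (0 : FractionRing A))) =
        algebraMap A (FractionRing A) c •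
          ((1 : FractionRing A) ⊗ₜ[A] ((1, 0) : A × FractionRing A)) +
            (0 : FractionRing A) • _
      rw [zero_smul, add_zero, algebraMap_smul, ← tmul_smul, Prod.smul_mk, smul_zero]
    · change ((c : A) • (0 : A), x) = ((0 : A), 1 * x)
      rw [smul_zero, one_mul]
  have hg : ∀ i, locPairMap g (locPairGen A n i) = σ • y i := fun i => by
    have h1 : g ∘ₗ LinearMap.single A (fun _ => A × FractionRing A) i = gi i := by
      refine LinearMap.ext fun x => ?_
      simp [g, Pi.single_apply, apply_ite]
    rw [locPairGen, ← locPairMap_comp_apply, h1]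
    refine Prod.ext ?_ ?_
    · rw [locPair_smul_fst]
      change (1 : FractionRing A) ⊗ₜ[A] ((gi i) (1, 0)) =
        algebraMap A (FractionRing A) c • (y i).1 + (0 : FractionRing A) • _
      rw [zero_smul, add_zero, algebraMap_smul, ← hy₀]
      simp [gi]
    · rw [locPair_smul_snd, one_smul]
      exact LinearMap.coprod_inr _ _
  have hgs : locPairMap g = φ ∘ₗ locPairMap q ∘ₗ locPairMap s := locPair_ext fun i => by
    rw [hg, LinearMap.comp_apply, LinearMap.comp_apply, hs, map_smul, map_smul]
  have hss : Function.Surjective (locPairMap s) := by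
    rw [← LinearMap.range_eq_top, eq_top_iff]
    rintro z -
    obtain ⟨x, rfl⟩ := (locPair_bijective n).2 z
    rw [Fintype.linearCombination_apply]
    refine Submodule.sum_mem _ fun i _ => Submodule.smul_mem _ _ ?_
    refine ⟨(⟨(algebraMap A (FractionRing A) c)⁻¹, 0, 1⟩ :
      TriRing (FractionRing A) (FractionRing A)) • locPairGen A n i, ?_⟩
    rw [map_smul, hs, smul_smul]
    refine Eq.trans (congrArg (· • locPairGen A n i) (TriRing.ext ?_ ?_ ?_)) (one_smul _ _) <;>
      simp [σ, hc0]
  let t : (Fin n → A × FractionRing A) →ₗ[A] M × N := (q ∘ₗ s).prod g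
  let p₁ := LinearMap.fst A M N ∘ₗ (LinearMap.range t).subtype
  let p₂ := LinearMap.snd A M N ∘ₗ (LinearMap.range t).subtype
  have ht : Function.Surjective (locPairMap t.rangeRestrict) :=
    locPairMap_surjective (isMatlisReflexive_row A n) t.surjective_rangeRestrict
  have h1 : ∀ w, locPairMap p₁ (locPairMap t.rangeRestrict w) =
      locPairMap q (locPairMap s w) := fun w => by
    rw [← locPairMap_comp_apply, ← locPairMap_comp_apply]; rfl
  have h2 : ∀ w, locPairMap p₂ (locPairMap t.rangeRestrict w) =
      φ (locPairMap p₁ (locPairMap t.rangeRestrict w)) := fun w => by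
    rw [h1, ← locPairMap_comp_apply]
    exact LinearMap.congr_fun hgs w
  refine ⟨LinearMap.range t, ⟨(injective_iff_map_eq_zero _).2 fun z hz => ?_, fun z => ?_⟩,
    LinearMap.ext fun z => ?_⟩
  · obtain ⟨w, rfl⟩ := ht z
    refine locPairMap_injective (f := (LinearMap.range t).subtype) Subtype.val_injective ?_
    rw [map_zero]
    have h3 := h2 w
    rw [show locPairMap p₁ (locPairMap t.rangeRestrict w) = 0 from hz, map_zero] at h3
    refine locPair_prod_ext ?_ ?_
    · rw [← locPairMap_comp_apply]; exact hz
    · rw [← locPairMap_comp_apply]; exact h3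
  · obtain ⟨w, rfl⟩ := locPairMap_surjective (isMatlisReflexive_row A n) hq z
    obtain ⟨w, rfl⟩ := hss w
    exact ⟨_, h1 w⟩
  · obtain ⟨w, rfl⟩ := ht z
    exact h2 w

instance finitePresentation_locPair_row (n : ℕ) :
    Module.FinitePresentation (TriRing (FractionRing A) (FractionRing A))
      (LocPair A (Fin n → A × FractionRing A)) :=
  .of_equiv (locPairFree A n)

theorem finitePresentation_locPair (hM : IsMatlisReflexive A M) :
    Module.FinitePresentation (TriRing (FractionRing A) (FractionRing A)) (LocPair A M) := by
  obtain ⟨n, m, q, s, hq, hs⟩ := hM.exists_presentation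
  exact finitePresentation_of_exact (locPairMap_exact (isMatlisReflexive_row A m) hs)
    (locPairMap_surjective (isMatlisReflexive_row A n) hq)

/-- The presentation map `φ` need not be induced by a map of modules. It is represented by a roof
whose left leg is inverted, so the right leg `s` has the same image as `φ`, and the cokernel of `s`
is sent to `X`. -/
theorem exists_locPair_equiv (X : Type u) [AddCommGroup X]
    [Module (TriRing (FractionRing A) (FractionRing A)) X]
    [Module.FinitePresentation (TriRing (FractionRing A) (FractionRing A)) X] :
    ∃ M : ModuleCat.{u} A, IsMatlisReflexive A M ∧
      Nonempty (LocPair A M ≃ₗ[TriRing (FractionRing A) (FractionRing A)] X) := by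
  obtain ⟨n, m, f, g, hf, hgf⟩ :=
    Module.FinitePresentation.exists_fin' (TriRing (FractionRing A) (FractionRing A)) X
  let φ := (locPairFree A n).toLinearMap ∘ₗ g ∘ₗ (locPairFree A m).symm.toLinearMap
  obtain ⟨Z, hZ, hZφ⟩ := exists_roof (isMatlisReflexive_row A m) φ
  have hZr : IsMatlisReflexive A Z :=
    ((isMatlisReflexive_row A m).prod (isMatlisReflexive_row A n)).of_injective (i := Z.subtype)
      Subtype.val_injective
  let s := LinearMap.snd A (Fin m → A × FractionRing A) (Fin n → A × FractionRing A) ∘ₗ Z.subtype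
  refine ⟨ModuleCat.of A ((Fin n → A × FractionRing A) ⧸ LinearMap.range s),
    (isMatlisReflexive_row A n).of_surjective (Submodule.mkQ_surjective _),
    nonempty_linearEquiv_of_ker_eq (f := locPairMap (LinearMap.range s).mkQ)
      (g := f ∘ₗ (locPairFree A n).symm.toLinearMap)
      (locPairMap_surjective (isMatlisReflexive_row A n) (Submodule.mkQ_surjective _))
      (hf.comp (LinearEquiv.surjective _)) ?_⟩
  rw [LinearMap.exact_iff.1 (locPairMap_exact hZr (LinearMap.exact_map_mkQ_range s)), hZφ,
    LinearMap.range_comp_of_range_eq_top _ (LinearMap.range_eq_top.2 hZ.2), LinearMap.ker_comp,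
    LinearMap.exact_iff.1 hgf, LinearMap.range_comp,
    LinearMap.range_comp_of_range_eq_top _ (LinearEquiv.range _)]
  exact Submodule.map_equiv_eq_comap_symm _ _

end Roofs

/-! ### Quotient categories -/

section Localization

/-- `W` consists of the maps inverted by `F`. The conditions `hroof` and `heq` yield a right
calculus of fractions, and they also make the induced functor full and faithful, respectively. -/
theorem nonempty_localization_equivalence {C D : Type*} [Category* C] [Category* D] (F : C ⥤ D)
    (W : MorphismProperty C) (hW : ∀ {X Y : C} (f : X ⟶ Y), W f ↔ IsIso (F.map f))
    (hroof : ∀ {X Y : C} (φ : F.obj X ⟶ F.obj Y), ∃ (Z : C) (s : Z ⟶ X) (f : Z ⟶ Y),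
      W s ∧ F.map f = F.map s ≫ φ)
    (heq : ∀ {X Y : C} (f g : X ⟶ Y), F.map f = F.map g →
      ∃ (Z : C) (s : Z ⟶ X), W s ∧ s ≫ f = s ≫ g) [F.EssSurj] :
    Nonempty (W.Localization ≌ D) := by
  have hF : W.IsInvertedBy F := fun _ _ f hf => (hW f).1 hf
  have hm : W.IsMultiplicative :=
    { id_mem := fun X => (hW _).2 (by rw [F.map_id]; infer_instance)
      comp_mem := fun f g hf hg => (hW _).2 (by
        have := (hW f).1 hf
        have := (hW g).1 hg
        rw [F.map_comp]
        infer_instance) }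
  have hc : W.HasRightCalculusOfFractions :=
    { exists_rightFraction := fun X Y φ => by
        have := (hW φ.s).1 φ.hs
        -- This gives an Ore square that commutes only after applying `F`; `heq` then corrects it by
        -- a further map in `W`.
        obtain ⟨Z, s, f, hs, hf⟩ := hroof (F.map φ.f ≫ inv (F.map φ.s))
        obtain ⟨Z', t, ht, htf⟩ := heq (f ≫ φ.s) (s ≫ φ.f) (by
          rw [F.map_comp, hf, F.map_comp]
          simp)
        exact ⟨.mk (t ≫ s) (W.comp_mem _ _ ht hs) (t ≫ f), by simpa using htf.symm⟩
      ext := fun X Y Y' f₁ f₂ s hs h => by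
        have := (hW s).1 hs
        obtain ⟨Z, t, ht, h'⟩ := heq f₁ f₂ (by
          rw [← cancel_mono (F.map s), ← F.map_comp, ← F.map_comp, h])
        exact ⟨Z, t, ht, h'⟩ }
  let G := Localization.lift F hF W.Q
  let α : W.Q ⋙ G ≅ F := Localization.fac F hF W.Q
  have hα : ∀ {X Y : C} (f : X ⟶ Y), G.map (W.Q.map f) = α.hom.app X ≫ F.map f ≫ α.inv.app Y :=
    fun {X Y} f => by
      have := α.hom.naturality f
      rw [← Category.assoc, ← this, Category.assoc, Iso.hom_inv_id_app, Category.comp_id]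
      rfl
  have hobj : ∀ X : W.Localization, ∃ x, W.Q.obj x = X :=
    fun X => ⟨_, (Localization.Construction.objEquiv W).apply_symm_apply X⟩
  have hfaith : G.Faithful := ⟨fun {X Y} f g hfg => by
    obtain ⟨x, rfl⟩ := hobj X
    obtain ⟨y, rfl⟩ := hobj Y
    obtain ⟨φ, hφ⟩ := Localization.exists_rightFraction W.Q W f
    -- After precomposition with both denominators, `f` and `g` come from morphisms of `C`, to which
    -- `heq` applies.
    obtain ⟨ψ, hψ⟩ := Localization.exists_rightFraction W.Q W (W.Q.map φ.s ≫ g)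
    have := Localization.inverts W.Q W _ φ.hs
    have := Localization.inverts W.Q W _ ψ.hs
    have h1 : W.Q.map ψ.s ≫ W.Q.map φ.s ≫ f = W.Q.map (ψ.s ≫ φ.f) := by
      rw [hφ, MorphismProperty.RightFraction.map_s_comp_map, W.Q.map_comp]
    have h2 : W.Q.map ψ.s ≫ W.Q.map φ.s ≫ g = W.Q.map ψ.f := by
      rw [hψ, MorphismProperty.RightFraction.map_s_comp_map]
    have h3 : G.map (W.Q.map (ψ.s ≫ φ.f)) = G.map (W.Q.map ψ.f) := by
      rw [← h1, ← h2, G.map_comp, G.map_comp, G.map_comp, G.map_comp, hfg]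
    rw [hα, hα, cancel_epi, cancel_mono] at h3
    obtain ⟨Z, t, ht, htf⟩ := heq _ _ h3
    have := Localization.inverts W.Q W _ ht
    rw [← cancel_epi (W.Q.map φ.s), ← cancel_epi (W.Q.map ψ.s), h1, h2, ← cancel_epi (W.Q.map t),
      ← W.Q.map_comp, ← W.Q.map_comp, htf]⟩
  have hfull : G.Full := ⟨fun {X Y} φ => by
    obtain ⟨x, rfl⟩ := hobj X
    obtain ⟨y, rfl⟩ := hobj Y
    obtain ⟨Z, s, f, hs, hf⟩ := hroof (α.inv.app x ≫ φ ≫ α.hom.app y)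
    have := Localization.inverts W.Q W _ hs
    refine ⟨inv (W.Q.map s) ≫ W.Q.map f, ?_⟩
    rw [G.map_comp, G.map_inv, IsIso.inv_comp_eq, hα, hα, hf]
    simp⟩
  have hess : G.EssSurj := ⟨fun Y => ⟨W.Q.obj (F.objPreimage Y),
    ⟨α.app _ ≪≫ F.objObjPreimageIso Y⟩⟩⟩
  have : G.IsEquivalence := { }
  exact ⟨G.asEquivalence⟩

end Localization

/-! ### Classes of reflexive modules modulo finite length -/

section QuotientCategories

open TensorProduct IsLocalRing

variable (A : Type u) [CommRing A]

/-- The functor `M ↦ (K ⊗ M, Hom(K, M))`. -/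
noncomputable def locPairFunctor :
    ModuleCat.{u} A ⥤ ModuleCat.{u} (TriRing (FractionRing A) (FractionRing A)) where
  obj M := ModuleCat.of _ (LocPair A M)
  map f := ModuleCat.ofHom (locPairMap f.hom)
  map_id M := ModuleCat.hom_ext (locPairMap_id (A := A) (M := M))
  map_comp f g := ModuleCat.hom_ext (locPairMap_comp f.hom g.hom)

/-- The functor `M ↦ K ⊗ M`. -/
noncomputable def fracTensorFunctor : ModuleCat.{u} A ⥤ ModuleCat.{u} (FractionRing A) where
  obj M := ModuleCat.of _ (FractionRing A ⊗[A] M)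
  map f := ModuleCat.ofHom (f.hom.baseChange (FractionRing A))
  map_id _ := ModuleCat.hom_ext LinearMap.baseChange_id
  map_comp f g := ModuleCat.hom_ext (LinearMap.baseChange_comp f.hom g.hom)

/-- The functor `M ↦ Hom(K, M)`. -/
noncomputable def homFracFunctor : ModuleCat.{u} A ⥤ ModuleCat.{u} (FractionRing A) where
  obj M := ModuleCat.of _ (FractionRing A →ₗ[A] M)
  map f := ModuleCat.ofHom (homFracMap f.hom)

variable {A}

theorem isIso_fullSubcategory_iff {S : Type u} [Ring S] {P : ObjectProperty (ModuleCat.{u} S)}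
    {X Y : P.FullSubcategory} (f : X ⟶ Y) : IsIso f ↔ Function.Bijective f.hom.hom := by
  rw [← ObjectProperty.isIso_hom_iff, ConcreteCategory.isIso_iff_bijective]

variable [IsDomain A] [IsDiscreteValuationRing A] [IsAdicComplete (maximalIdeal A) A]

/-- An equivalence criterion for the quotient category of a class of reflexive modules. -/
theorem nonempty_quotFl_equivalence {S : Type u} [Ring S] {P : ObjectProperty (ModuleCat.{u} A)}
    (hP : ∀ M, P M → IsMatlisReflexive A M)
    (hsub : ∀ {M : ModuleCat.{u} A}, P M → ∀ Z : Submodule A M, P (ModuleCat.of A Z))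
    (hprod : ∀ {M N : ModuleCat.{u} A}, P M → P N → P (ModuleCat.of A (M × N)))
    (F : ModuleCat.{u} A ⥤ ModuleCat.{u} S)
    (hF : ∀ M : P.FullSubcategory, fpProp S ((P.ι ⋙ F).obj M))
    (hbij : ∀ {M N : ModuleCat.{u} A}, P M → P N → ∀ f : M ⟶ N,
      Function.Bijective (locPairMap f.hom) ↔ Function.Bijective (F.map f).hom)
    (hroof : ∀ {M N : ModuleCat.{u} A}, P M → P N → ∀ φ : F.obj M ⟶ F.obj N,
      ∃ ψ : LocPair A M →ₗ[TriRing (FractionRing A) (FractionRing A)] LocPair A N,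
        ∀ {Z : ModuleCat.{u} A}, P Z → ∀ (s : Z ⟶ M) (f : Z ⟶ N),
          locPairMap f.hom = ψ ∘ₗ locPairMap s.hom → F.map f = F.map s ≫ φ)
    (hzero : ∀ {M N : ModuleCat.{u} A}, P M → P N → ∀ f g : M ⟶ N, F.map f = F.map g →
      locPairMap (f.hom - g.hom) = 0)
    (hess : ∀ X : ModuleCat.{u} S, fpProp S X → ∃ M, P M ∧ Nonempty (F.obj M ≅ X)) :
    Nonempty (QuotFl P ≌ (fpProp S).FullSubcategory) := by
  have : ((fpProp S).lift (P.ι ⋙ F) hF).EssSurj := ⟨fun X => by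
    obtain ⟨M, hM, ⟨e⟩⟩ := hess X.obj X.property
    exact ⟨⟨M, hM⟩, ⟨ObjectProperty.isoMk _ e⟩⟩⟩
  have hW : ∀ {X Y : P.FullSubcategory} (f : X ⟶ Y), modFlProp P f ↔
      Function.Bijective (locPairMap f.hom.hom) := fun {X Y} f =>
    (bijective_locPairMap_iff (hP _ X.property) (hP _ Y.property) f.hom.hom).symm
  refine nonempty_localization_equivalence ((fpProp S).lift (P.ι ⋙ F) hF) (modFlProp P)
    (fun {X Y} f => ?_) (fun {X Y} φ => ?_) (fun {X Y} f g h => ?_)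
  · rw [hW, isIso_fullSubcategory_iff]
    exact hbij X.property Y.property f.hom
  · obtain ⟨ψ, hψ⟩ := hroof X.property Y.property φ.hom
    -- The apex is a submodule of `X × Y`, so it stays in the class `P`.
    obtain ⟨Z, hZ, hZψ⟩ := exists_roof (hP _ X.property) ψ
    let Z' : P.FullSubcategory := ⟨ModuleCat.of A Z, hsub (hprod X.property Y.property) Z⟩
    let s : Z' ⟶ X := ObjectProperty.homMk
      (ModuleCat.ofHom (LinearMap.fst A X.obj Y.obj ∘ₗ Z.subtype))
    let f : Z' ⟶ Y := ObjectProperty.homMk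
      (ModuleCat.ofHom (LinearMap.snd A X.obj Y.obj ∘ₗ Z.subtype))
    exact ⟨Z', s, f, (hW s).2 hZ, ObjectProperty.hom_ext _ (hψ Z'.property s.hom f.hom hZψ)⟩
  · have h0 := hzero X.property Y.property f.hom g.hom (congrArg (fun k => k.hom) h)
    let k := f.hom.hom - g.hom.hom
    let Z : P.FullSubcategory := ⟨ModuleCat.of A (LinearMap.ker k), hsub X.property _⟩
    let s : Z ⟶ X := ObjectProperty.homMk (ModuleCat.ofHom (LinearMap.ker k).subtype)
    refine ⟨Z, s, (hW s).2 (bijective_locPairMap_ker_subtype (hP _ X.property) h0),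
      ObjectProperty.hom_ext _ (ModuleCat.hom_ext (LinearMap.ext fun x => ?_))⟩
    exact sub_eq_zero.1 x.2

end QuotientCategories

/-! ### The quotient categories of reflexive, noetherian and artinian modules -/

section ThreeQuotients

open TensorProduct IsLocalRing

variable {A : Type u} [CommRing A] {M N : Type u} [AddCommGroup M] [Module A M] [AddCommGroup N]
  [Module A N]

theorem locPairMap_sub (f g : M →ₗ[A] N) : locPairMap (f - g) = locPairMap f - locPairMap g :=
  map_sub locPairAddHom f g

theorem bijective_locPairMap_iff_and (f : M →ₗ[A] N) : Function.Bijective (locPairMap f) ↔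
    Function.Bijective (f.baseChange (FractionRing A)) ∧ Function.Bijective (homFracMap f) :=
  Prod.map_bijective (f := f.baseChange (FractionRing A)) (g := homFracMap f)

theorem bijective_of_subsingleton {X Y : Type*} [Subsingleton X] [Subsingleton Y] [Nonempty X]
    (f : X → Y) : Function.Bijective f :=
  ⟨Function.injective_of_subsingleton f, Function.surjective_to_subsingleton f⟩

variable [IsDomain A] [IsDiscreteValuationRing A]

theorem subsingleton_homFrac_of_isNoetherian [IsNoetherian A M] :
    Subsingleton (FractionRing A →ₗ[A] M) :=
  subsingleton_of_forall_eq 0 eq_zero_of_fractionRing_to_finite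

theorem subsingleton_fractionRing_tensor_of_isArtinian [IsArtinian A M] :
    Subsingleton (FractionRing A ⊗[A] M) :=
  subsingleton_fractionRing_tensor_iff.2 torsion_of_isArtinian

variable [IsAdicComplete (maximalIdeal A) A]

/-- The pair of `M` is finitely generated, and matrices act on second components through the entry
`d`, so the second components of generators span `Hom(K, M)`. -/
theorem finite_homFrac (hM : IsMatlisReflexive A M) :
    Module.Finite (FractionRing A) (FractionRing A →ₗ[A] M) := by
  obtain ⟨n, q, hq⟩ := hM.exists_surjective
  let f : Fin n → FractionRing A →ₗ[A] M := fun i => (locPairMap q (locPairGen A n i)).2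
  refine .of_surjective (Fintype.linearCombination (FractionRing A) f) fun h => ?_
  obtain ⟨y, hy⟩ := locPairMap_surjective (isMatlisReflexive_row A n) hq (0, h)
  obtain ⟨x, rfl⟩ := (locPair_bijective n).2 y
  refine ⟨fun i => (x i).d, ?_⟩
  have h1 := congrArg Prod.snd hy
  rw [Fintype.linearCombination_apply, map_sum, Prod.snd_sum] at h1
  rw [Fintype.linearCombination_apply]
  refine Eq.trans (Finset.sum_congr rfl fun i _ => ?_) h1
  rw [map_smul, locPair_smul_snd]

variable (A) in
/-- The class map `K → K ⧸ A` identifies `Kⁿ` with `Hom(K, (K ⧸ A)ⁿ)`. -/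
theorem nonempty_homFrac_pi_equiv (n : ℕ) :
    Nonempty ((FractionRing A →ₗ[A] (Fin n → FracQuotient A)) ≃ₗ[FractionRing A]
      (Fin n → FractionRing A)) := by
  obtain ⟨π, hπ⟩ := IsDiscreteValuationRing.exists_irreducible A
  let φ : (Fin n → FractionRing A) →ₗ[FractionRing A]
      (FractionRing A →ₗ[A] (Fin n → FracQuotient A)) :=
    { toFun := fun d => LinearMap.pi fun i => fracClass ∘ₗ LinearMap.mulLeft A (d i)
      map_add' := fun d e => LinearMap.ext fun x => funext fun i =>
        (congrArg fracClass (add_mul _ _ _)).trans (map_add _ _ _)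
      map_smul' := fun c d => LinearMap.ext fun x => funext fun i => congrArg fracClass (by
        change c * d i * x = d i * (c * x)
        ring) }
  have hφ : ∀ d x i, φ d x i = fracClass (d i * x) := fun _ _ _ => rfl
  refine ⟨(LinearEquiv.ofBijective φ ⟨(injective_iff_map_eq_zero _).2 fun d hd => funext fun i => ?_,
    fun h => ?_⟩).symm⟩
  · by_contra hdi
    refine invPow_one_ne_zero hπ ?_
    -- Evaluation at `dᵢ⁻¹ π⁻¹` produces the nonzero class of `π⁻¹`.
    have h1 := congrFun (LinearMap.congr_fun hd ((d i)⁻¹ * (algebraMap A _ π)⁻¹ ^ 1)) i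
    rwa [hφ, mul_inv_cancel_left₀ hdi] at h1
  · choose g hg using fun i => (isMatlisReflexive_fractionRing A).exists_lift_of_flat
      (p := fracClass) (Submodule.mkQ_surjective _)
      (LinearMap.proj (R := A) (φ := fun _ : Fin n => FracQuotient A) i ∘ₗ h)
    refine ⟨fun i => g i 1, LinearMap.ext fun x => funext fun i => ?_⟩
    have h1 := map_smul_fractionRing (g i) x 1
    have h2 := LinearMap.congr_fun (hg i) x
    rw [smul_eq_mul, mul_one, smul_eq_mul, mul_comm] at h1
    rw [hφ, ← h1]
    exact h2

variable (A) in
theorem nonempty_quotFl_reflProp : Nonempty (QuotFl (reflProp A) ≌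
    (fpProp (TriRing (FractionRing A) (FractionRing A))).FullSubcategory) := by
  refine nonempty_quotFl_equivalence (fun _ h => h)
    (fun h Z => IsMatlisReflexive.of_injective (i := Z.subtype) h Subtype.val_injective)
    (fun h h' => IsMatlisReflexive.prod h h') (locPairFunctor A)
    (fun M => finitePresentation_locPair M.property) (fun _ _ _ => Iff.rfl)
    (fun _ _ φ => ⟨φ.hom, fun _ s f h => ModuleCat.hom_ext h⟩) (fun _ _ f g h => ?_)
    fun X hX => ?_
  · exact (locPairMap_sub _ _).trans (sub_eq_zero.2 (congrArg ModuleCat.Hom.hom h))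
  · have : Module.FinitePresentation (TriRing (FractionRing A) (FractionRing A)) X := hX
    obtain ⟨M, hM, ⟨e⟩⟩ := exists_locPair_equiv (A := A) X
    exact ⟨M, hM, ⟨e.toModuleIso⟩⟩

variable (A) in
-- Here `Hom(K, M) = 0`, so the pair reduces to `K ⊗ M`, and any `K`-linear map extends by zero to a
-- map of pairs. Powers of `A` provide all finite dimensions.
theorem nonempty_quotFl_noethProp : Nonempty (QuotFl (noethProp A) ≌
    (fpProp (FractionRing A)).FullSubcategory) := by
  have hs : ∀ {M : ModuleCat.{u} A}, noethProp A M → Subsingleton (FractionRing A →ₗ[A] M) :=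
    fun {M} (h : IsNoetherian A M) => subsingleton_homFrac_of_isNoetherian
  refine nonempty_quotFl_equivalence
    (fun M (h : IsNoetherian A M) => IsMatlisReflexive.of_finite)
    (fun {M} (h : IsNoetherian A M) Z => (inferInstance : IsNoetherian A Z))
    (fun {M N} (h : IsNoetherian A M) (h' : IsNoetherian A N) =>
      (inferInstance : IsNoetherian A (M × N)))
    (fracTensorFunctor A) (fun M => ?_) (fun hM hN f => ?_) (fun {M N} hM hN φ => ?_)
    (fun hM hN f g h => ?_) fun X hX => ?_
  · have : IsNoetherian A M.obj := M.property
    exact Module.finitePresentation_of_finite (FractionRing A) (FractionRing A ⊗[A] M.obj)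
  · have := hs hM
    have := hs hN
    rw [bijective_locPairMap_iff_and]
    exact and_iff_left (bijective_of_subsingleton _)
  · have := hs hM
    have := hs hN
    let φ' : FractionRing A ⊗[A] M →ₗ[FractionRing A] FractionRing A ⊗[A] N := φ.hom
    refine ⟨{ toFun := fun y => (φ' y.1, 0)
              map_add' := fun y z => Prod.ext (map_add φ' y.1 z.1) (Subsingleton.elim _ _)
              map_smul' := fun x y => Prod.ext ?_ (Subsingleton.elim _ _) },
      fun _ s f h => ModuleCat.hom_ext (LinearMap.ext fun v => ?_)⟩
    · rw [locPair_smul_fst, Subsingleton.elim y.2 0]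
      simp [locPair_smul_fst]
    · exact congrArg Prod.fst (LinearMap.congr_fun h (v, 0))
  · have := hs hN
    refine LinearMap.ext fun y => Prod.ext ?_ (Subsingleton.elim _ _)
    rw [locPairMap_sub]
    exact sub_eq_zero.2 (LinearMap.congr_fun (congrArg ModuleCat.Hom.hom h) y.1)
  · have : Module.FinitePresentation (FractionRing A) X := hX
    refine ⟨ModuleCat.of A (ULift.{u} (Fin (Module.finrank (FractionRing A) X)) → A),
      (inferInstance : IsNoetherian A _), ⟨(LinearEquiv.ofFinrankEq
        (FractionRing A ⊗[A] (ULift.{u} (Fin (Module.finrank (FractionRing A) X)) → A)) X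
        ?_).toModuleIso⟩⟩
    simp

variable (A) in
-- Now `K ⊗ M = 0` and the pair reduces to `Hom(K, M)`. Powers of `K ⧸ A` provide all finite
-- dimensions.
theorem nonempty_quotFl_artProp : Nonempty (QuotFl (artProp A) ≌
    (fpProp (FractionRing A)).FullSubcategory) := by
  have hs : ∀ {M : ModuleCat.{u} A}, artProp A M → Subsingleton (FractionRing A ⊗[A] M) :=
    fun {M} (h : IsArtinian A M) => subsingleton_fractionRing_tensor_of_isArtinian
  refine nonempty_quotFl_equivalence
    (fun M (h : IsArtinian A M) => IsMatlisReflexive.of_isArtinian)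
    (fun {M} (h : IsArtinian A M) Z => (inferInstance : IsArtinian A Z))
    (fun {M N} (h : IsArtinian A M) (h' : IsArtinian A N) =>
      (inferInstance : IsArtinian A (M × N)))
    (homFracFunctor A) (fun M => ?_) (fun hM hN f => ?_) (fun {M N} hM hN φ => ?_)
    (fun hM hN f g h => ?_) fun X hX => ?_
  · have : IsArtinian A M.obj := M.property
    have := finite_homFrac (A := A) (M := M.obj) .of_isArtinian
    exact Module.finitePresentation_of_finite (FractionRing A) (FractionRing A →ₗ[A] M.obj)
  · have := hs hM
    have := hs hN
    rw [bijective_locPairMap_iff_and]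
    exact and_iff_right (bijective_of_subsingleton _)
  · have := hs hN
    refine ⟨{ toFun := fun y => (0, φ.hom y.2)
              map_add' := fun y z => Prod.ext (Subsingleton.elim _ _) (map_add φ.hom y.2 z.2)
              map_smul' := fun x y => Prod.ext (Subsingleton.elim _ _)
                (map_smul φ.hom x.d y.2) },
      fun _ s f h => ModuleCat.hom_ext (LinearMap.ext fun v => ?_)⟩
    exact congrArg Prod.snd (LinearMap.congr_fun h (0, v))
  · have := hs hN
    refine LinearMap.ext fun y => Prod.ext (Subsingleton.elim _ _) ?_
    rw [locPairMap_sub]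
    exact sub_eq_zero.2 (LinearMap.congr_fun (congrArg ModuleCat.Hom.hom h) y.2)
  · have : Module.FinitePresentation (FractionRing A) X := hX
    have := isArtinian_fracQuotient A
    obtain ⟨e⟩ := nonempty_homFrac_pi_equiv A (Module.finrank (FractionRing A) X)
    exact ⟨ModuleCat.of A (Fin (Module.finrank (FractionRing A) X) → FracQuotient A),
      (inferInstance : IsArtinian A _),
      ⟨(e ≪≫ₗ (Module.finBasis (FractionRing A) X).equivFun.symm).toModuleIso⟩⟩

end ThreeQuotients

theorem mainTheorem11 (A : Type u) [CommRing A] [IsDomain A] [IsDiscreteValuationRing A]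
    [IsAdicComplete (IsLocalRing.maximalIdeal A) A] :
    -- an indecomposable module is Matlis reflexive iff it is pure-injective
    (∀ M : ModuleCat.{u} A, Indecomposable M → (reflProp A M ↔ IsPureInjective A M)) ∧
    -- the complete list, without repetition, of indecomposable Matlis reflexive modules
    (∀ t : MatlisLabel, Indecomposable (matlisModule A t) ∧ reflProp A (matlisModule A t)) ∧
    (∀ M : ModuleCat.{u} A, Indecomposable M → reflProp A M →
      ∃! t : MatlisLabel, Nonempty (M ≅ matlisModule A t)) ∧
    -- `A` is the limit, and `E(A ⧸ 𝔪)` is the colimit, of the modules `A ⧸ 𝔪 ^ i`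
    Function.Bijective (AdicCompletion.of (IsLocalRing.maximalIdeal A) A) ∧
    (∀ (π : A) (hπ : Irreducible π),
      Nonempty (matlisModule A .envelope ≃ₗ[A]
        Module.DirectLimit (fun i : ℕ => A ⧸ IsLocalRing.maximalIdeal A ^ i)
          (powTransition ((IsLocalRing.mem_maximalIdeal π).2 hπ.not_isUnit)))) ∧
    -- `refl A = arno A` is abelian with enough projectives and enough injectives
    reflProp A = arnoProp A ∧
    (∃ h : Abelian (reflProp A).FullSubcategory,
      h.toPreadditive = (inferInstance : Preadditive (reflProp A).FullSubcategory)) ∧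
    EnoughProjectives (reflProp A).FullSubcategory ∧
    EnoughInjectives (reflProp A).FullSubcategory ∧
    -- `Q(A)` is the unique indecomposable object of `refl A` that is projective and injective
    (∀ M : (reflProp A).FullSubcategory,
      (Indecomposable M.obj ∧ Projective M ∧ Injective M) ↔
        Nonempty (M.obj ≅ matlisModule A .quotientField)) ∧
    -- `Hom_A(A ⊕ Q, -)` induces an equivalence from `refl A` to `mod [[A, Q], [0, Q]]`
    (∃ h : ∀ M : (reflProp A).FullSubcategory,
        fpProp (TriRing A (FractionRing A))
          (((reflProp A).ι ⋙ homRow A (FractionRing A)).obj M),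
      ((fpProp (TriRing A (FractionRing A))).lift
        ((reflProp A).ι ⋙ homRow A (FractionRing A)) h).IsEquivalence) ∧
    -- the quotient categories modulo `fl A`
    Nonempty (QuotFl (reflProp A) ≌
      (fpProp (TriRing (FractionRing A) (FractionRing A))).FullSubcategory) ∧
    Nonempty (QuotFl (noethProp A) ≌ (fpProp (FractionRing A)).FullSubcategory) ∧
    Nonempty (QuotFl (artProp A) ≌ (fpProp (FractionRing A)).FullSubcategory) := by
  -- The classification covers all indecomposable modules, and each module in the list is reflexive.
  have hrefl : ∀ M : ModuleCat.{u} A, Indecomposable M → reflProp A M := fun M hM => by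
    obtain ⟨t, ⟨e⟩⟩ := exists_iso_matlisModule hM
    exact (isMatlisReflexive_matlisModule t).of_linearEquiv e.toLinearEquiv.symm
  refine ⟨fun M hM => ⟨fun h => IsMatlisReflexive.isPureInjective h, fun _ => hrefl M hM⟩,
    fun t => ⟨indecomposable_matlisModule t, isMatlisReflexive_matlisModule t⟩, fun M hM _ => ?_,
    AdicCompletion.of_bijective _ _, fun π hπ => nonempty_envelope_equiv_directLimit hπ,
    reflProp_eq_arnoProp A, abelian_reflProp, inferInstance, inferInstance,
    projective_injective_iff, ⟨fpProp_homRow A, isEquivalence_homRow A⟩,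
    nonempty_quotFl_reflProp A, nonempty_quotFl_noethProp A, nonempty_quotFl_artProp A⟩
  obtain ⟨t, ⟨e⟩⟩ := exists_iso_matlisModule hM
  exact ⟨t, ⟨e⟩, fun s ⟨e'⟩ => matlisModule_injective (e'.symm ≪≫ e).toLinearEquiv⟩
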